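/- Let $G$ be a compact Lie group with a bi-invariant Riemannian metric $g_{\mathrm{bi}}$, acting smoothly and isometrically on a complete Riemannian manifold $(M,g_M)$. Write $G_x$ for the isotropy group and $G(x)$ for the orbit of $x\in M$, and let $M^{\mathrm{reg}}$ be the union of the principal orbits, where $G(x)$ is principal if for all $y$ near $x$ the group $G_x$ is contained in a conjugate of $G_y$. For $l>0$ let $g_l$ be the Cheeger deformation of $g_M$, that is, the metric on $M$ for which $$q:(G\times M,\ l^2g_{\mathrm{bi}}+g_M)\to (M,g_l),\qquad q(p,m)=pm,$$ is a Riemannian submersion, and let $$\tilde g_l=\tfrac1{l^2}\,g_l|_{T_xG(x)}+g_l|_{T_xG(x)^\perp}$$ with respect to the $g_M$-orthogonal splitting $T_xM=T_xG(x)\oplus T_xG(x)^\perp$. Let $\mathcal U\subset M^{\mathrm{reg}}$ be a $G$-invariant open set whose closure in $M$ is compact and contained in $M^{\mathrm{reg}}$. Then there is a smooth $G$-invariant Riemannian metric $\tilde g$ on $\mathcal U$ such that, for every integer $p\ge 0$, $\tilde g_l|_{\mathcal U}\to\tilde g$ in the $C^p$-topology (uniformly on $\mathcal U$) as $l\to 0^+$,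 and it has the following property. For every $x\in\mathcal U$, the quotient $G/G_x$ has a smooth structure for which the projection $\pi:G\to G/G_x$ is a smooth submersion, and for this structure there is a Riemannian metric $g_{\mathrm{nh},x}$ on $G/G_x$ (the normal homogeneous metric) for which $\pi:(G,g_{\mathrm{bi}})\to(G/G_x,g_{\mathrm{nh},x})$ is a Riemannian submersion. The map $$\Phi_x:(G/G_x,\,g_{\mathrm{nh},x})\to(\mathcal U,\tilde g),\qquad \Phi_x(gG_x)=gx,$$ is a Riemannian embedding, that is, a smooth embedding with $\Phi_x^*\tilde g=g_{\mathrm{nh},x}$, and its image, the orbit $G(x)$, is a totally geodesic submanifold of $(\mathcal U,\tilde g)$. -/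

import Mathlib

open Bundle Manifold MulAction Filter Topology
open scoped ContDiff

noncomputable section

namespace Cheeger

/-! ### Riemannian metrics and Riemannian submersions -/

/-- A smooth Riemannian metric on the open subset `U` of the manifold `M`
(the values outside `U` are irrelevant). -/
structure RiemannianMetricOn {E : Type*} [NormedAddCommGroup E] [NormedSpace ℝ E]
    {M : Type*} [TopologicalSpace M] [ChartedSpace E M] [IsManifold 𝓘(ℝ, E) ∞ M]
    (U : Set M) where
  /-- the scalar product on each tangent space -/
  inner (x : M) : TangentSpace 𝓘(ℝ, E) x →L[ℝ] TangentSpace 𝓘(ℝ, E) x →L[ℝ] ℝ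
  symm : ∀ x ∈ U, ∀ v w : TangentSpace 𝓘(ℝ, E) x, inner x v w = inner x w v
  pos : ∀ x ∈ U, ∀ v : TangentSpace 𝓘(ℝ, E) x, v ≠ 0 → 0 < inner x v v
  contMDiffOn : ContMDiffOn 𝓘(ℝ, E) (𝓘(ℝ, E).prod 𝓘(ℝ, E →L[ℝ] E →L[ℝ] ℝ)) ∞
    (fun x : M ↦ TotalSpace.mk' (E →L[ℝ] E →L[ℝ] ℝ)
      (E := fun x : M ↦ TangentSpace 𝓘(ℝ, E) x →L[ℝ] TangentSpace 𝓘(ℝ, E) x →L[ℝ] ℝ)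
      x (inner x)) U

/-- `q : (N, h) → (B, g)` is a Riemannian submersion: a smooth submersion whose differential is
isometric on horizontal vectors, those `h`-orthogonal to the kernel of the differential. -/
structure IsRiemannianSubmersion
    {EN : Type*} [NormedAddCommGroup EN] [NormedSpace ℝ EN]
    {HN : Type*} [TopologicalSpace HN] (IN : ModelWithCorners ℝ EN HN)
    {N : Type*} [TopologicalSpace N] [ChartedSpace HN N]
    {EB : Type*} [NormedAddCommGroup EB] [NormedSpace ℝ EB]
    {HB : Type*} [TopologicalSpace HB] (IB : ModelWithCorners ℝ EB HB)
    {B : Type*} [TopologicalSpace B] [ChartedSpace HB B]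
    (h : ∀ y : N, TangentSpace IN y → TangentSpace IN y → ℝ)
    (g : ∀ b : B, TangentSpace IB b → TangentSpace IB b → ℝ) (q : N → B) : Prop where
  isSubmersion : IsSubmersion IN IB ∞ q
  isometry : ∀ (y : N) (v w : TangentSpace IN y),
    (∀ z : TangentSpace IN y, mfderiv IN IB q y z = 0 → h y v z = 0) →
    (∀ z : TangentSpace IN y, mfderiv IN IB q y z = 0 → h y w z = 0) →
    g (q y) (mfderiv IN IB q y v) (mfderiv IN IB q y w) = h y v w

/-- The horizontal lift of `v` for a linear surjection `D : V → W` and a scalar product `h` on `V`: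
the unique `u` that is `h`-orthogonal to `ker D` and satisfies `D u = v`. -/
def horizontalLift {V W : Type*} [AddCommGroup V] [AddCommGroup W]
    (h : V → V → ℝ) (D : V → W) (v : W) : V :=
  Classical.epsilon fun u : V ↦ D u = v ∧ ∀ z : V, D z = 0 → h u z = 0

/-! ### The group, its action, and the Cheeger deformation -/

section Action

variable {EG : Type*} [NormedAddCommGroup EG] [NormedSpace ℝ EG]
  {G : Type*} [TopologicalSpace G] [ChartedSpace EG G] [Group G]
  {E : Type*} [NormedAddCommGroup E] [NormedSpace ℝ E]
  {M : Type*}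

/-- Invariance of a Riemannian metric on `G` under all left and right translations. -/
def IsBiinvariant [LieGroup 𝓘(ℝ, EG) ∞ G]
    (g : ContMDiffRiemannianMetric 𝓘(ℝ, EG) ∞ EG
      (fun p : G ↦ TangentSpace 𝓘(ℝ, EG) p)) : Prop :=
  ∀ (a p : G) (v w : TangentSpace 𝓘(ℝ, EG) p),
    g.inner (a * p) (mfderiv 𝓘(ℝ, EG) 𝓘(ℝ, EG) (fun b : G ↦ a * b) p v)
      (mfderiv 𝓘(ℝ, EG) 𝓘(ℝ, EG) (fun b : G ↦ a * b) p w) = g.inner p v w ∧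
    g.inner (p * a) (mfderiv 𝓘(ℝ, EG) 𝓘(ℝ, EG) (fun b : G ↦ b * a) p v)
      (mfderiv 𝓘(ℝ, EG) 𝓘(ℝ, EG) (fun b : G ↦ b * a) p w) = g.inner p v w

variable (G) in
/-- The field of bilinear forms `g` on the subset `U` of the `G`-manifold `M` is preserved by
every element of `G`. -/
def IsInvariantOn [TopologicalSpace M] [ChartedSpace E M] [MulAction G M] (U : Set M)
    (g : ∀ x : M, TangentSpace 𝓘(ℝ, E) x → TangentSpace 𝓘(ℝ, E) x → ℝ) : Prop :=
  ∀ (a : G), ∀ x ∈ U, ∀ v w : TangentSpace 𝓘(ℝ, E) x,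
    g (a • x) (mfderiv 𝓘(ℝ, E) 𝓘(ℝ, E) (fun y : M ↦ a • y) x v)
      (mfderiv 𝓘(ℝ, E) 𝓘(ℝ, E) (fun y : M ↦ a • y) x w) = g x v w

variable (G M) in
/-- The union of the principal orbits: `G(x)` is principal if, for all `y` near `x`, the isotropy
group of `x` is contained in a conjugate of the isotropy group of `y`, that is, in the isotropy
group of a point of `G(y)`. -/
def regularPart [TopologicalSpace M] [MulAction G M] : Set M :=
  {x | ∀ᶠ y in 𝓝 x, ∃ a : G, stabilizer G x ≤ stabilizer G (a • y)}

variable (EG G) in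
/-- The tangent space of the orbit `G(x)` at `x`: the image of the differential at `1` of the
orbit map `a ↦ a • x`. (The points `1 • x` and `x` are equal, and so are their tangent spaces.) -/
def orbitTangent [TopologicalSpace M] [ChartedSpace E M] [MulAction G M] (x : M) :
    Submodule ℝ (TangentSpace 𝓘(ℝ, E) x) :=
  LinearMap.range (show TangentSpace 𝓘(ℝ, EG) (1 : G) →L[ℝ] TangentSpace 𝓘(ℝ, E) x from
    mfderiv 𝓘(ℝ, EG) 𝓘(ℝ, E) (fun a : G ↦ a • x) 1).toLinearMap

variable [LieGroup 𝓘(ℝ, EG) ∞ G] [EMetricSpace M] [ChartedSpace E M] [IsManifold 𝓘(ℝ, E) ∞ M]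
  [RiemannianBundle (fun x : M ↦ TangentSpace 𝓘(ℝ, E) x)] [MulAction G M]

variable (E M) in
/-- The Riemannian metric of the manifold `M`. -/
def ambientMetric (x : M) (v w : TangentSpace 𝓘(ℝ, E) x) : ℝ := inner ℝ v w

/-- The product metric `l² g_bi + g_M` on `G × M`. -/
def productMetric
    (gbi : ContMDiffRiemannianMetric 𝓘(ℝ, EG) ∞ EG (fun p : G ↦ TangentSpace 𝓘(ℝ, EG) p))
    (l : ℝ) (z : G × M) (v w : TangentSpace (𝓘(ℝ, EG).prod 𝓘(ℝ, E)) z) : ℝ :=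
  l ^ 2 * gbi.inner z.1 v.1 w.1 + ambientMetric E M z.2 v.2 w.2

variable (EG E) in
/-- The differential at `(1, x)` of the quotient map `q (p, m) = p • m` of the Cheeger action
`a (p, m) = (p a⁻¹, a m)` on `G × M`. -/
def cheegerQuotientDeriv (x : M) :
    TangentSpace (𝓘(ℝ, EG).prod 𝓘(ℝ, E)) ((1, x) : G × M) →L[ℝ] TangentSpace 𝓘(ℝ, E) x :=
  mfderiv (𝓘(ℝ, EG).prod 𝓘(ℝ, E)) 𝓘(ℝ, E) (fun z : G × M ↦ z.1 • z.2) (1, x)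

/-- The Cheeger deformation `g_l`: the metric on `M ≅ (G × M) / G` induced by the submersion
`q : (G × M, l² g_bi + g_M) → M`. Each orbit of the Cheeger action contains exactly one point
`(1, x)`, and the action is isometric and preserves `q`, so that `g_l` may be computed there. -/
def cheegerMetric
    (gbi : ContMDiffRiemannianMetric 𝓘(ℝ, EG) ∞ EG (fun p : G ↦ TangentSpace 𝓘(ℝ, EG) p))
    (l : ℝ) (x : M) (v w : TangentSpace 𝓘(ℝ, E) x) : ℝ :=
  productMetric gbi l ((1, x) : G × M)
    (horizontalLift (productMetric gbi l ((1, x) : G × M)) (cheegerQuotientDeriv EG E x) v)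
    (horizontalLift (productMetric gbi l ((1, x) : G × M)) (cheegerQuotientDeriv EG E x) w)

variable (EG G) in
/-- The component of `v` tangent to the orbit in the orthogonal decomposition
`T_x M = T_x G(x) ⊕ (T_x G(x))^⊥`. -/
def orbitComponent (x : M) (v : TangentSpace 𝓘(ℝ, E) x) : TangentSpace 𝓘(ℝ, E) x :=
  Classical.epsilon fun u : TangentSpace 𝓘(ℝ, E) x ↦ u ∈ orbitTangent EG G x ∧
    ∀ z ∈ orbitTangent EG G x, ambientMetric E M x (v - u) z = 0

/-- The vertically rescaled Cheeger deformation: `l⁻² g_l` on `T_x G(x)` plus `g_l` on the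
orthogonal complement of `T_x G(x)`. -/
def rescaledMetric
    (gbi : ContMDiffRiemannianMetric 𝓘(ℝ, EG) ∞ EG (fun p : G ↦ TangentSpace 𝓘(ℝ, EG) p))
    (l : ℝ) (x : M) (v w : TangentSpace 𝓘(ℝ, E) x) : ℝ :=
  1 / l ^ 2 * cheegerMetric gbi l x (orbitComponent EG G x v) (orbitComponent EG G x w) +
    cheegerMetric gbi l x (v - orbitComponent EG G x v) (w - orbitComponent EG G x w)

end Action

/-! ### Convergence of tensors, the Levi-Civita connection, totally geodesic submanifolds -/

section Tensors

variable {E : Type*} [NormedAddCommGroup E] [NormedSpace ℝ E]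
  {M : Type*} [TopologicalSpace M] [ChartedSpace E M]

/-- The component of a `(0,2)`-tensor `T` for the coordinate vectors `a, b`, in the preferred chart
at `x₀`, as a function of the coordinates. -/
def tensorComponent (T : ∀ x : M, TangentSpace 𝓘(ℝ, E) x → TangentSpace 𝓘(ℝ, E) x → ℝ)
    (x₀ : M) (a b : E) (y : E) : ℝ :=
  T ((extChartAt 𝓘(ℝ, E) x₀).symm y)
    (mfderiv 𝓘(ℝ, E) 𝓘(ℝ, E) (extChartAt 𝓘(ℝ, E) x₀).symm y (show TangentSpace 𝓘(ℝ, E) y from a))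
    (mfderiv 𝓘(ℝ, E) 𝓘(ℝ, E) (extChartAt 𝓘(ℝ, E) x₀).symm y (show TangentSpace 𝓘(ℝ, E) y from b))

/-- Convergence in the `C^p`-topology, as `l → 0⁺`, of `(0,2)`-tensors `T l`, `l > 0`, to `T₀` on
the open set `U`: all tensors are of class `C^p` on `U`, and in each chart of the atlas all partial
derivatives of order at most `p` of their components converge, uniformly on the part of `U` in any
given compact subset of the chart domain. For `U` with compact closure, this is convergence in the
`C^p`-norm on `U` of a finite atlas. -/
def TendstoInCp (p : ℕ) (U : Set M)
    (T : ℝ → ∀ x : M, TangentSpace 𝓘(ℝ, E) x → TangentSpace 𝓘(ℝ, E) x → ℝ)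
    (T₀ : ∀ x : M, TangentSpace 𝓘(ℝ, E) x → TangentSpace 𝓘(ℝ, E) x → ℝ) : Prop :=
  ∀ (x₀ : M) (a b : E),
    (∀ l > 0, ContDiffOn ℝ p (tensorComponent (T l) x₀ a b)
      (extChartAt 𝓘(ℝ, E) x₀ '' ((extChartAt 𝓘(ℝ, E) x₀).source ∩ U))) ∧
    ContDiffOn ℝ p (tensorComponent T₀ x₀ a b)
      (extChartAt 𝓘(ℝ, E) x₀ '' ((extChartAt 𝓘(ℝ, E) x₀).source ∩ U)) ∧
    ∀ K : Set M, IsCompact K → K ⊆ (extChartAt 𝓘(ℝ, E) x₀).source → ∀ j ≤ p,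
      TendstoUniformlyOn (fun l ↦ iteratedFDeriv ℝ j (tensorComponent (T l) x₀ a b))
        (iteratedFDeriv ℝ j (tensorComponent T₀ x₀ a b)) (𝓝[>] 0)
        (extChartAt 𝓘(ℝ, E) x₀ '' (K ∩ U))

/-- The derivative at `p` of the function `g(Y, Z)` in the direction `v`. -/
def derivInner (g : ∀ x : M, TangentSpace 𝓘(ℝ, E) x →L[ℝ] TangentSpace 𝓘(ℝ, E) x →L[ℝ] ℝ)
    (Y Z : ∀ x : M, TangentSpace 𝓘(ℝ, E) x) (p : M) (v : TangentSpace 𝓘(ℝ, E) p) : ℝ :=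
  mfderiv 𝓘(ℝ, E) 𝓘(ℝ, ℝ) (fun x : M ↦ g x (Y x) (Z x)) p v

/-- `W = (∇_X Y)(p)` for the Levi-Civita connection `∇` of `g`, as given by the Koszul formula. -/
def IsLeviCivitaDerivAt [IsManifold 𝓘(ℝ, E) ∞ M]
    (g : ∀ x : M, TangentSpace 𝓘(ℝ, E) x →L[ℝ] TangentSpace 𝓘(ℝ, E) x →L[ℝ] ℝ)
    (X Y : ∀ x : M, TangentSpace 𝓘(ℝ, E) x) (p : M) (W : TangentSpace 𝓘(ℝ, E) p) : Prop :=
  ∀ Z : ∀ x : M, TangentSpace 𝓘(ℝ, E) x,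
    MDifferentiableAt 𝓘(ℝ, E) 𝓘(ℝ, E).tangent
      (fun x ↦ (⟨x, Z x⟩ : TangentBundle 𝓘(ℝ, E) M)) p →
    2 * g p W (Z p) =
      derivInner g Y Z p (X p) + derivInner g X Z p (Y p) - derivInner g X Y p (Z p)
        + g p (VectorField.mlieBracket 𝓘(ℝ, E) X Y p) (Z p)
        - g p (VectorField.mlieBracket 𝓘(ℝ, E) X Z p) (Y p)
        - g p (VectorField.mlieBracket 𝓘(ℝ, E) Y Z p) (X p)

/-- The image of the embedding `f : N → U ⊆ M` is totally geodesic in `(U, g)`: its second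
fundamental form vanishes, that is, `∇_X Y` is tangent to the image along the image whenever the
smooth vector fields `X` and `Y` on `U` are. -/
def HasTotallyGeodesicImage
    {EN : Type*} [NormedAddCommGroup EN] [NormedSpace ℝ EN]
    {HN : Type*} [TopologicalSpace HN] (IN : ModelWithCorners ℝ EN HN)
    {N : Type*} [TopologicalSpace N] [ChartedSpace HN N] [IsManifold 𝓘(ℝ, E) ∞ M]
    (U : Set M) (g : ∀ x : M, TangentSpace 𝓘(ℝ, E) x →L[ℝ] TangentSpace 𝓘(ℝ, E) x →L[ℝ] ℝ)
    (f : N → M) : Prop :=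
  ∀ X Y : ∀ x : M, TangentSpace 𝓘(ℝ, E) x,
    ContMDiffOn 𝓘(ℝ, E) 𝓘(ℝ, E).tangent ∞
      (fun x ↦ (⟨x, X x⟩ : TangentBundle 𝓘(ℝ, E) M)) U →
    ContMDiffOn 𝓘(ℝ, E) 𝓘(ℝ, E).tangent ∞
      (fun x ↦ (⟨x, Y x⟩ : TangentBundle 𝓘(ℝ, E) M)) U →
    (∀ n : N, ∃ u, mfderiv IN 𝓘(ℝ, E) f n u = X (f n)) →
    (∀ n : N, ∃ u, mfderiv IN 𝓘(ℝ, E) f n u = Y (f n)) →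
    ∀ n : N, ∃ u, IsLeviCivitaDerivAt g X Y (f n) (mfderiv IN 𝓘(ℝ, E) f n u)

end Tensors

end Cheeger

end

set_option linter.unusedSectionVars false
set_option synthInstance.maxHeartbeats 200000
set_option maxHeartbeats 1000000

noncomputable section

namespace Cheeger

/-! ### Linear algebra of the deformation -/

section LinearAlgebra

variable {V : Type*} [NormedAddCommGroup V] [NormedSpace ℝ V]
  {W : Type*} [NormedAddCommGroup W] [NormedSpace ℝ W]
  {W' : Type*} [NormedAddCommGroup W'] [NormedSpace ℝ W']

/-! The convergence is linear algebra at one point, made smooth in the point. Let `b` be the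
bi-invariant scalar product on the Lie algebra, `g` the metric on `T_x M`, `A` the derivative at `1`
of the orbit map, `A*` its adjoint and `P` the orthogonal projection onto the range of `A`. At `(1,
x)` the differential of `q` is `(X, v) ↦ A X + v`, and its horizontal vectors are the pairs `(A* s,
l² s)`. Hence for `l ≠ 0` the rescaled metric is `g(Q⁻¹ ·, ·)` with `Q = A A* + l² P + (1 - P)`
(`rescaled_eq_deformedForm`). Since `A A*` is invertible on the range of `A`, the operator `Q`
remains invertible at `l = 0`, and the limit metric is the same formula there.

Smoothness in `x` requires `P` to be smooth, that is, `A` to have locally constant rank. Near a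
point of a principal orbit the inclusion of isotropy groups makes the orbit map of a translate of
the nearby point factor smoothly through that of `x`, so the rank cannot increase
(`ker_orbitDeriv_le`); by lower semicontinuity it cannot decrease either. The deformed metrics are
then jointly smooth in `(l, x)` across `l = 0`, and compactness gives uniform convergence of all
derivatives (`tendstoInCp_deformedField`).

The limit metric gives `A X` the squared length `b(X, X)` if `X` is `b`-orthogonal to the kernel of
`A` (`deformedForm_zero_apply`), and at most `b(X, X)` in general (`deformedForm_zero_le`). The
first fact says that orbits carry the normal homogeneous metric. Both together make the orbits
totally geodesic: the action field `K` of `X` is a Killing field of the limit metric, and its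
squared length attains its upper bound `b(X, X)` wherever `X` is horizontal. There the length is
critical, so `∇_K K = -½ grad |K|² = 0`. Every tangent vector of an orbit is the value of such a
field, so the second fundamental form vanishes on the diagonal, and by polarization everywhere
(`koszulForm_eq_zero`).

The smooth structure of `G / G_x` comes from the constant rank theorem: by equivariance the orbit
map has constant rank, which yields `OrbitCoordinates`. Compactness of `G` turns the injective
immersion of the quotient into an embedding. -/

/-- A continuous bilinear form that is a scalar product. -/
structure IsScalarProduct (g : W →L[ℝ] W →L[ℝ] ℝ) : Prop where
  symm : ∀ v w, g v w = g w v
  pos : ∀ v, v ≠ 0 → 0 < g v v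

namespace IsScalarProduct

variable {g : W →L[ℝ] W →L[ℝ] ℝ}

lemma nonneg (hg : IsScalarProduct g) (v : W) : 0 ≤ g v v := by
  by_cases hv : v = 0
  · simp [hv]
  · exact (hg.pos v hv).le

lemma eq_zero (hg : IsScalarProduct g) {v : W} (hv : g v v = 0) : v = 0 := by
  by_contra h
  exact (hg.pos v h).ne' hv

lemma eq_zero_of_forall (hg : IsScalarProduct g) {v : W} (hv : ∀ w, g v w = 0) : v = 0 :=
  hg.eq_zero (hv v)

lemma ext (hg : IsScalarProduct g) {v w : W} (h : ∀ z, g v z = g w z) : v = w :=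
  sub_eq_zero.1 <| hg.eq_zero_of_forall fun z ↦ by simp [h z]

lemma bilinearComp (hg : IsScalarProduct g) {B : V →L[ℝ] W} (hB : Function.Injective B) :
    IsScalarProduct (g.bilinearComp B B) where
  symm _ _ := hg.symm _ _
  pos _ hv := hg.pos _ fun h ↦ hv (hB (h.trans (map_zero B).symm))

end IsScalarProduct

lemma isInvertible_of_injective [FiniteDimensional ℝ V] [FiniteDimensional ℝ W] {T : V →L[ℝ] W}
    (hT : Function.Injective T) (hd : Module.finrank ℝ V = Module.finrank ℝ W) :
    T.IsInvertible :=
  ⟨(LinearEquiv.ofInjectiveOfFinrankEq T.toLinearMap hT hd).toContinuousLinearEquiv,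
    by ext; rfl⟩

lemma finrank_clm_dual [FiniteDimensional ℝ V] :
    Module.finrank ℝ (V →L[ℝ] ℝ) = Module.finrank ℝ V := by
  rw [← LinearEquiv.finrank_eq (LinearMap.toContinuousLinearMap (E := V) (F' := ℝ) (𝕜 := ℝ))]
  exact Subspace.dual_finrank_eq

lemma IsScalarProduct.isInvertible [FiniteDimensional ℝ W] {g : W →L[ℝ] W →L[ℝ] ℝ}
    (hg : IsScalarProduct g) : g.IsInvertible := by
  refine isInvertible_of_injective (fun v w h ↦ hg.ext fun z ↦ by rw [h]) finrank_clm_dual.symm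

/-- Every linear form is represented by a vector. -/
lemma IsScalarProduct.exists_eq [FiniteDimensional ℝ W] {g : W →L[ℝ] W →L[ℝ] ℝ}
    (hg : IsScalarProduct g) (ℓ : W →L[ℝ] ℝ) : ∃ w, g w = ℓ := by
  obtain ⟨e, he⟩ := hg.isInvertible
  exact ⟨e.symm ℓ, by rw [← he]; simp⟩

/-- The adjoint of `A : (V, b) → (W, g)`. -/
def formAdjoint (b : V →L[ℝ] V →L[ℝ] ℝ) (g : W →L[ℝ] W →L[ℝ] ℝ) (A : V →L[ℝ] W) : W →L[ℝ] V :=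
  b.inverse ∘L ((ContinuousLinearMap.compL ℝ V W ℝ).flip A) ∘L g

lemma apply_formAdjoint [FiniteDimensional ℝ V] {b : V →L[ℝ] V →L[ℝ] ℝ} (hb : IsScalarProduct b)
    (g : W →L[ℝ] W →L[ℝ] ℝ) (A : V →L[ℝ] W) (w : W) (X : V) :
    b (formAdjoint b g A w) X = g w (A X) := by
  obtain ⟨e, he⟩ := hb.isInvertible
  have : b (formAdjoint b g A w) = (g w).comp A := by
    simp only [formAdjoint, ← he, ContinuousLinearMap.inverse_equiv]
    simp
  rw [this]; rfl

/-- `P` is the `g`-orthogonal projection onto the range of `A`. -/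
structure IsRangeProjection (g : W →L[ℝ] W →L[ℝ] ℝ) (A : V →L[ℝ] W) (P : W →L[ℝ] W) : Prop where
  mem_range : ∀ w, ∃ X, A X = P w
  orthogonal : ∀ w X, g (w - P w) (A X) = 0

/-- The orthogonal projection onto the range of the injective linear map `B`. -/
def gramProjection (g : W →L[ℝ] W →L[ℝ] ℝ) (B : V →L[ℝ] W) : W →L[ℝ] W :=
  B ∘L formAdjoint (g.bilinearComp B B) g B

/-- The pulled-back form on the source makes `B` isometric, so `B` composed with its adjoint is the
projection. The formula is smooth in `g` and `B`, which is why it is preferred to an abstract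
projection. -/
lemma isRangeProjection_gramProjection [FiniteDimensional ℝ V] {g : W →L[ℝ] W →L[ℝ] ℝ}
    (hg : IsScalarProduct g) {B : V →L[ℝ] W} (hB : Function.Injective B) :
    IsRangeProjection g B (gramProjection g B) where
  mem_range w := ⟨_, rfl⟩
  orthogonal w X := by
    have := apply_formAdjoint (hg.bilinearComp hB) g B w X
    simp only [ContinuousLinearMap.bilinearComp_apply] at this
    simp [gramProjection, this]

/-- `A` may have a kernel, so the Gram formula is applied to the inclusion of its range. -/
lemma exists_isRangeProjection [FiniteDimensional ℝ W] {g : W →L[ℝ] W →L[ℝ] ℝ}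
    (hg : IsScalarProduct g) (A : V →L[ℝ] W) : ∃ P, IsRangeProjection g A P := by
  let R : Submodule ℝ W := LinearMap.range A.toLinearMap
  have h := isRangeProjection_gramProjection hg (B := R.subtypeL) Subtype.val_injective
  refine ⟨gramProjection g R.subtypeL, fun w ↦ ?_, fun w X ↦ ?_⟩
  · obtain ⟨⟨_, X, hX⟩, hr⟩ := h.mem_range w
    exact ⟨X, hX.trans hr⟩
  · exact h.orthogonal w ⟨A X, X, rfl⟩

namespace IsRangeProjection

variable {g : W →L[ℝ] W →L[ℝ] ℝ} {A : V →L[ℝ] W} {P : W →L[ℝ] W}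

/-- The difference of the two candidates lies in the range of `A` and is orthogonal to it. -/
lemma eq_of_mem_of_orthogonal (hg : IsScalarProduct g) (hP : IsRangeProjection g A P)
    {u w : W} (hu : ∃ X, A X = u) (h : ∀ X, g (w - u) (A X) = 0) : P w = u := by
  obtain ⟨X, rfl⟩ := hu
  obtain ⟨Y, hY⟩ := hP.mem_range w
  have h1 := hP.orthogonal w (Y - X)
  have h2 := h (Y - X)
  rw [← sub_eq_zero]
  apply hg.eq_zero
  rw [← hY] at h1 ⊢
  have : A Y - A X = (w - A X) - (w - A Y) := by abel
  nth_rw 1 [this]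
  rw [map_sub g, sub_apply, ← map_sub A, h1, h2, sub_zero]

lemma unique (hg : IsScalarProduct g) (hP : IsRangeProjection g A P) {P' : W →L[ℝ] W}
    (hP' : IsRangeProjection g A P') : P = P' := by
  ext w
  exact hP.eq_of_mem_of_orthogonal hg (hP'.mem_range w) (hP'.orthogonal w)

lemma apply_range (hg : IsScalarProduct g) (hP : IsRangeProjection g A P) (X : V) :
    P (A X) = A X :=
  hP.eq_of_mem_of_orthogonal hg ⟨X, rfl⟩ (by simp)

lemma apply_apply (hg : IsScalarProduct g) (hP : IsRangeProjection g A P) (w : W) :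
    P (P w) = P w := by
  obtain ⟨X, hX⟩ := hP.mem_range w
  rw [← hX, hP.apply_range hg]

lemma apply_orthogonal (hg : IsScalarProduct g) (hP : IsRangeProjection g A P) {n : W}
    (hn : ∀ X, g n (A X) = 0) : P n = 0 :=
  hP.eq_of_mem_of_orthogonal hg ⟨0, map_zero A⟩ (by simpa using hn)

lemma orthogonal' (hP : IsRangeProjection g A P) (v w : W) :
    g (v - P v) (P w) = 0 := by
  obtain ⟨X, hX⟩ := hP.mem_range w
  rw [← hX, hP.orthogonal]

/-- The projection only depends on the range. -/
lemma of_range {V' : Type*} [NormedAddCommGroup V'] [NormedSpace ℝ V'] {B : V' →L[ℝ] W}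
    (hP : IsRangeProjection g B P)
    (h : LinearMap.range B.toLinearMap = LinearMap.range A.toLinearMap) :
    IsRangeProjection g A P where
  mem_range w := by
    obtain ⟨X, hX⟩ := hP.mem_range w
    have : P w ∈ LinearMap.range A.toLinearMap := h ▸ ⟨X, hX⟩
    exact this
  orthogonal w X := by
    have : A X ∈ LinearMap.range B.toLinearMap := h ▸ ⟨X, rfl⟩
    obtain ⟨Y, hY⟩ := this
    rw [← hY]
    exact hP.orthogonal w Y

end IsRangeProjection

/-- The operator `A A* + l² P + (1 - P)`. -/
def deformationOperator (b : V →L[ℝ] V →L[ℝ] ℝ) (g : W →L[ℝ] W →L[ℝ] ℝ) (A : V →L[ℝ] W)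
    (P : W →L[ℝ] W) (l : ℝ) : W →L[ℝ] W :=
  A ∘L formAdjoint b g A + l ^ 2 • P + (ContinuousLinearMap.id ℝ W - P)

/-- The rescaled deformation of the scalar product `g`, see `rescaledMetric`; the value at `l = 0`
is its limit. -/
def deformedForm (b : V →L[ℝ] V →L[ℝ] ℝ) (g : W →L[ℝ] W →L[ℝ] ℝ) (A : V →L[ℝ] W)
    (P : W →L[ℝ] W) (l : ℝ) : W →L[ℝ] W →L[ℝ] ℝ :=
  g ∘L (deformationOperator b g A P l).inverse

/-! ### The deformed scalar product at one point, including its limit at `l = 0`. -/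

section Deformation

variable [FiniteDimensional ℝ V] [FiniteDimensional ℝ W]
  {b : V →L[ℝ] V →L[ℝ] ℝ} {g : W →L[ℝ] W →L[ℝ] ℝ} {A : V →L[ℝ] W} {P : W →L[ℝ] W} {l : ℝ}

/-- The right-hand side is symmetric and, on the diagonal, a sum of three nonnegative terms;
invertibility of the operator and positivity of the deformed form are read off from it. -/
lemma apply_deformationOperator (hb : IsScalarProduct b) (hg : IsScalarProduct g)
    (hP : IsRangeProjection g A P) (v w : W) :
    g v (deformationOperator b g A P l w) =
      b (formAdjoint b g A v) (formAdjoint b g A w) + l ^ 2 * g (P v) (P w) +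
        g (v - P v) (w - P w) := by
  have h1 : g v (P w) = g (P v) (P w) := by
    have := hP.orthogonal' v w
    rw [map_sub, sub_apply] at this
    linarith
  have h2 : g v (w - P w) = g (v - P v) (w - P w) := by
    have := hP.orthogonal' w v
    rw [hg.symm] at this
    rw [map_sub g v, sub_apply, this, sub_zero]
  simp only [deformationOperator, add_apply, map_add,
    ContinuousLinearMap.comp_apply, smul_apply, map_smul, smul_eq_mul,
    sub_apply, ContinuousLinearMap.id_apply]
  rw [← h1, h2, apply_formAdjoint hb]

/-- No condition on `l`: if `Q w = 0`, the normal part of `w` and `A* w` vanish, so `w` lies in the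
range of `A` and is orthogonal to it. -/
lemma isInvertible_deformationOperator (hb : IsScalarProduct b) (hg : IsScalarProduct g)
    (hP : IsRangeProjection g A P) : (deformationOperator b g A P l).IsInvertible := by
  refine isInvertible_of_injective ?_ rfl
  rw [injective_iff_map_eq_zero]
  intro w hw
  have h := apply_deformationOperator (l := l) hb hg hP w w
  rw [hw, map_zero] at h
  have h1 := hb.nonneg (formAdjoint b g A w)
  have h2 := mul_nonneg (sq_nonneg l) (hg.nonneg (P w))
  have h3 := hg.nonneg (w - P w)
  have h4 : w - P w = 0 := hg.eq_zero (by linarith)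
  have h5 : formAdjoint b g A w = 0 := hb.eq_zero (by linarith)
  obtain ⟨X, hX⟩ := hP.mem_range w
  have h6 := apply_formAdjoint hb g A w X
  rw [h5, hX, ← sub_eq_zero.1 h4] at h6
  exact hg.eq_zero (by simpa using h6.symm)

lemma exists_deformationOperator_eq (hb : IsScalarProduct b) (hg : IsScalarProduct g)
    (hP : IsRangeProjection g A P) (w : W) : ∃ s, deformationOperator b g A P l s = w := by
  obtain ⟨e, he⟩ := isInvertible_deformationOperator (l := l) hb hg hP
  exact ⟨e.symm w, by rw [← he]; simp⟩

/-- Every vector has the form `Q s`, so this identity replaces any computation with the inverse of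
`Q`. -/
lemma deformedForm_apply (hb : IsScalarProduct b) (hg : IsScalarProduct g)
    (hP : IsRangeProjection g A P) (s w : W) :
    deformedForm b g A P l (deformationOperator b g A P l s) w = g s w := by
  obtain ⟨e, he⟩ := isInvertible_deformationOperator (l := l) hb hg hP
  simp [deformedForm, ← he]

lemma isScalarProduct_deformedForm (hb : IsScalarProduct b) (hg : IsScalarProduct g)
    (hP : IsRangeProjection g A P) : IsScalarProduct (deformedForm b g A P l) where
  symm v w := by
    obtain ⟨s, rfl⟩ := exists_deformationOperator_eq (l := l) hb hg hP v
    obtain ⟨t, rfl⟩ := exists_deformationOperator_eq (l := l) hb hg hP w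
    rw [deformedForm_apply hb hg hP, deformedForm_apply hb hg hP,
      apply_deformationOperator hb hg hP, apply_deformationOperator hb hg hP, hb.symm,
      hg.symm (P s), hg.symm (s - P s)]
  pos v hv := by
    obtain ⟨s, rfl⟩ := exists_deformationOperator_eq (l := l) hb hg hP v
    rw [deformedForm_apply hb hg hP]
    have h := apply_deformationOperator (l := l) hb hg hP s s
    have h1 := hb.nonneg (formAdjoint b g A s)
    have h2 := mul_nonneg (sq_nonneg l) (hg.nonneg (P s))
    have h3 := hg.nonneg (s - P s)
    refine lt_of_le_of_ne (by linarith) fun h0 ↦ hv ?_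
    have h4 : s - P s = 0 := hg.eq_zero (by linarith)
    have h5 : formAdjoint b g A s = 0 := hb.eq_zero (by linarith)
    have h6 : l ^ 2 * g (P s) (P s) = 0 := by linarith
    have h7 : l ^ 2 • P s = 0 := by
      rcases mul_eq_zero.1 h6 with h | h
      · rw [h, zero_smul]
      · rw [hg.eq_zero h, smul_zero]
    simp [deformationOperator, h5, h7, h4]

/-- If `Q s` lies in the range of `A`, then so does `s`. -/
lemma projection_eq_of_deformationOperator_eq (hg : IsScalarProduct g)
    (hP : IsRangeProjection g A P) {s : W} {X : V}
    (h : deformationOperator b g A P l s = A X) : P s = s := by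
  have h' : P (deformationOperator b g A P l s) = deformationOperator b g A P l s := by
    rw [h, hP.apply_range hg]
  simp only [deformationOperator, add_apply, map_add,
    ContinuousLinearMap.comp_apply, smul_apply, map_smul,
    sub_apply, ContinuousLinearMap.id_apply, map_sub,
    hP.apply_range hg, hP.apply_apply hg, sub_self, add_zero] at h'
  -- Applying `P` to `Q s` only removes the summand `s - P s`, which is therefore zero.
  have := left_eq_add.1 h'
  exact (sub_eq_zero.1 this).symm

lemma deformationOperator_of_projection_eq {s : W} (h : P s = s) :
    deformationOperator b g A P l s = A (formAdjoint b g A s) + l ^ 2 • s := by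
  simp [deformationOperator, h]

lemma deformationOperator_orthogonal (hb : IsScalarProduct b) (hg : IsScalarProduct g)
    (hP : IsRangeProjection g A P) {n : W} (hn : ∀ X, g n (A X) = 0) :
    deformationOperator b g A P l n = n := by
  have h1 : formAdjoint b g A n = 0 :=
    hb.eq_zero_of_forall fun X ↦ by rw [apply_formAdjoint hb, hn]
  simp [deformationOperator, h1, hP.apply_orthogonal hg hn]

lemma deformedForm_orthogonal (hb : IsScalarProduct b) (hg : IsScalarProduct g)
    (hP : IsRangeProjection g A P) {n : W} (hn : ∀ X, g n (A X) = 0) (w : W) :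
    deformedForm b g A P l n w = g n w := by
  conv_lhs => rw [← deformationOperator_orthogonal (l := l) hb hg hP hn]
  rw [deformedForm_apply hb hg hP]

/-- The horizontal part of `X`: a vector with the same image under `A` that is the adjoint of a
vector in the range of `A`. -/
lemma exists_formAdjoint_sub_mem_ker (hb : IsScalarProduct b) (hg : IsScalarProduct g)
    (hP : IsRangeProjection g A P) (X : V) :
    ∃ s, deformationOperator b g A P 0 s = A X ∧ A (formAdjoint b g A s) = A X := by
  -- On the range of `A` the operator at `l = 0` is `A A*`, so solving `Q s = A X` makes `A* s` a
  -- preimage of `A X`; being an adjoint, it is orthogonal to the kernel of `A`.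
  obtain ⟨s, hs⟩ := exists_deformationOperator_eq (l := 0) hb hg hP (A X)
  have h1 := deformationOperator_of_projection_eq (b := b) (g := g) (A := A) (l := 0)
    (projection_eq_of_deformationOperator_eq hg hP hs)
  refine ⟨s, hs, ?_⟩
  rw [← hs, h1]
  simp

/-- On horizontal vectors, the limit form is given by `b`. -/
lemma deformedForm_zero_apply (hb : IsScalarProduct b) (hg : IsScalarProduct g)
    (hP : IsRangeProjection g A P) {X : V} (hX : ∀ Z, A Z = 0 → b X Z = 0) (Y : V) :
    deformedForm b g A P 0 (A X) (A Y) = b X Y := by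
  obtain ⟨s, hs, hs'⟩ := exists_formAdjoint_sub_mem_ker hb hg hP X
  have hker : A (X - formAdjoint b g A s) = 0 := by rw [map_sub, hs', sub_self]
  have h2 : X - formAdjoint b g A s = 0 := by
    apply hb.eq_zero
    rw [map_sub b, sub_apply, hX _ hker, apply_formAdjoint hb, hker]
    simp
  rw [← hs, deformedForm_apply hb hg hP, ← apply_formAdjoint hb, ← sub_eq_zero.1 h2]

/-- If `Y` is the horizontal part of `X`, the left-hand side is `b Y X = b X X - b (X - Y) (X - Y)`.
This bound is what makes the length of an action field maximal where its generator is horizontal. -/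
lemma deformedForm_zero_le (hb : IsScalarProduct b) (hg : IsScalarProduct g)
    (hP : IsRangeProjection g A P) (X : V) :
    deformedForm b g A P 0 (A X) (A X) ≤ b X X := by
  obtain ⟨s, hs, hs'⟩ := exists_formAdjoint_sub_mem_ker hb hg hP X
  set Y := formAdjoint b g A s with hY
  have hker : A (X - Y) = 0 := by rw [map_sub, hs', sub_self]
  have h1 : b Y (X - Y) = 0 := by rw [hY, apply_formAdjoint hb, hker, map_zero]
  have h2 : deformedForm b g A P 0 (A X) (A X) = b Y X := by
    nth_rw 1 [← hs]
    rw [deformedForm_apply hb hg hP, ← apply_formAdjoint hb]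
  have h3 := hb.nonneg (X - Y)
  have h4 := hb.symm X Y
  simp only [map_sub, sub_apply] at h1 h3
  linarith

/-- Every vector of the range of `A` is the image of a horizontal vector. -/
lemma exists_horizontal (hb : IsScalarProduct b)
    (hg : IsScalarProduct g) (A : V →L[ℝ] W) (X : V) :
    ∃ Y, A Y = A X ∧ ∀ Z, A Z = 0 → b Y Z = 0 := by
  obtain ⟨P, hP⟩ := exists_isRangeProjection hg A
  obtain ⟨s, -, hs⟩ := exists_formAdjoint_sub_mem_ker hb hg hP X
  exact ⟨_, hs, fun Z hZ ↦ by rw [apply_formAdjoint hb, hZ, map_zero]⟩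

/-- The limit form is determined by its values on horizontal and on orthogonal vectors. -/
lemma deformedForm_zero_apply_add (hb : IsScalarProduct b) (hg : IsScalarProduct g)
    (hP : IsRangeProjection g A P) {X Y : V} (hX : ∀ Z, A Z = 0 → b X Z = 0)
    {n m : W} (hn : ∀ Z, g n (A Z) = 0) (hm : ∀ Z, g m (A Z) = 0) :
    deformedForm b g A P 0 (A X + n) (A Y + m) = b X Y + g n m := by
  have h := isScalarProduct_deformedForm (l := 0) hb hg hP
  simp only [map_add, add_apply]
  rw [deformedForm_zero_apply hb hg hP hX, h.symm (A X) m, deformedForm_orthogonal hb hg hP hm,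
    deformedForm_orthogonal hb hg hP hn, deformedForm_orthogonal hb hg hP hn, hn, hm]
  ring

/-- The limit form is natural. -/
lemma deformedForm_zero_map {V' : Type*} [NormedAddCommGroup V'] [NormedSpace ℝ V']
    [FiniteDimensional ℝ V'] [FiniteDimensional ℝ W']
    {b' : V' →L[ℝ] V' →L[ℝ] ℝ} {g' : W' →L[ℝ] W' →L[ℝ] ℝ} {A' : V' →L[ℝ] W'} {P' : W' →L[ℝ] W'}
    (hb : IsScalarProduct b) (hg : IsScalarProduct g) (hP : IsRangeProjection g A P)
    (hb' : IsScalarProduct b') (hg' : IsScalarProduct g') (hP' : IsRangeProjection g' A' P')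
    (S : V →L[ℝ] V') (hS : Function.Surjective S) (hbS : ∀ X Y, b' (S X) (S Y) = b X Y)
    (T : W →L[ℝ] W') (hT : Function.Injective T) (hgT : ∀ v w, g' (T v) (T w) = g v w)
    (hST : ∀ X, T (A X) = A' (S X)) (v w : W) :
    deformedForm b' g' A' P' 0 (T v) (T w) = deformedForm b g A P 0 v w := by
  -- Every vector is the image of a horizontal vector plus an orthogonal one; `S` and `T` preserve
  -- both kinds, and on them the limit form is `b` plus `g`.
  have key : ∀ v : W, ∃ X n, (∀ Z, A Z = 0 → b X Z = 0) ∧ (∀ Z, g n (A Z) = 0) ∧ v = A X + n := by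
    intro v
    obtain ⟨X, hX⟩ := hP.mem_range v
    obtain ⟨Y, hY, hY'⟩ := exists_horizontal hb hg A X
    exact ⟨Y, v - P v, hY', hP.orthogonal v, by rw [hY, hX]; abel⟩
  obtain ⟨X, n, hX, hn, rfl⟩ := key v
  obtain ⟨Y, m, hY, hm, rfl⟩ := key w
  rw [deformedForm_zero_apply_add hb hg hP hX hn hm, map_add T, map_add T, hST, hST,
    deformedForm_zero_apply_add hb' hg' hP' _ _ _, hbS, hgT]
  · intro Z hZ
    obtain ⟨Z, rfl⟩ := hS Z
    rw [hbS]
    exact hX Z (hT (by rw [hST, hZ, map_zero]))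
  · intro Z
    obtain ⟨Z, rfl⟩ := hS Z
    rw [← hST, hgT, hn]
  · intro Z
    obtain ⟨Z, rfl⟩ := hS Z
    rw [← hST, hgT, hm]

/-- A change of coordinates in the target. -/
lemma deformedForm_bilinearComp [FiniteDimensional ℝ W']
    (hb : IsScalarProduct b) (hg : IsScalarProduct g)
    (hP : IsRangeProjection g A P) (T : W' ≃L[ℝ] W) {P' : W' →L[ℝ] W'}
    (hP' : IsRangeProjection (g.bilinearComp (T : W' →L[ℝ] W) (T : W' →L[ℝ] W))
      ((T.symm : W →L[ℝ] W') ∘L A) P') :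
    deformedForm b (g.bilinearComp (T : W' →L[ℝ] W) (T : W' →L[ℝ] W)) ((T.symm : W →L[ℝ] W') ∘L A) P' l =
      (deformedForm b g A P l).bilinearComp (T : W' →L[ℝ] W) (T : W' →L[ℝ] W) := by
  have hg' := hg.bilinearComp (B := (T : W' →L[ℝ] W)) T.injective
  -- The adjoint, the projection and the operator `Q` are each intertwined by `T`.
  have hadj : ∀ w, formAdjoint b (g.bilinearComp (T : W' →L[ℝ] W) (T : W' →L[ℝ] W))
      ((T.symm : W →L[ℝ] W') ∘L A) w = formAdjoint b g A (T w) := by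
    intro w
    refine hb.ext fun Z ↦ ?_
    rw [apply_formAdjoint hb, apply_formAdjoint hb]
    simp
  have hPT : ∀ w, T (P' w) = P (T w) := by
    intro w
    refine (hP.eq_of_mem_of_orthogonal hg ?_ fun X ↦ ?_).symm
    · obtain ⟨X, hX⟩ := hP'.mem_range w
      exact ⟨X, by rw [← hX]; simp⟩
    · simpa using hP'.orthogonal w X
  have hQ : ∀ s, T (deformationOperator b (g.bilinearComp (T : W' →L[ℝ] W) (T : W' →L[ℝ] W))
      ((T.symm : W →L[ℝ] W') ∘L A) P' l s) = deformationOperator b g A P l (T s) := by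
    intro s
    simp [deformationOperator, hadj, hPT]
  ext v w
  obtain ⟨s, rfl⟩ := exists_deformationOperator_eq (l := l) hb hg' hP' v
  rw [deformedForm_apply hb hg' hP']
  simp only [ContinuousLinearMap.bilinearComp_apply, ContinuousLinearEquiv.coe_coe]
  rw [hQ, deformedForm_apply hb hg hP]

/-- The horizontal lift for `(X, v) ↦ A X + v` and the product form `l² b + g`. -/
lemma horizontalLift_eq (hb : IsScalarProduct b) (hg : IsScalarProduct g) (hl : l ≠ 0)
    {h : V × W → V × W → ℝ} (hh : ∀ z z', h z z' = l ^ 2 * b z.1 z'.1 + g z.2 z'.2)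
    {D : V × W → W} (hD : ∀ z, D z = A z.1 + z.2) (s : W) :
    horizontalLift h D (A (formAdjoint b g A s) + l ^ 2 • s) =
      (formAdjoint b g A s, l ^ 2 • s) := by
  -- A kernel vector is `(X, -A X)`, and its product with `(A* s, l² s)` is `l² g(s, A X) - l² g(s,
  -- A X)`.
  have hs : D (formAdjoint b g A s, l ^ 2 • s) = A (formAdjoint b g A s) + l ^ 2 • s ∧
      ∀ z, D z = 0 → h (formAdjoint b g A s, l ^ 2 • s) z = 0 := by
    refine ⟨hD _, fun z hz ↦ ?_⟩
    rw [hD, add_comm, add_eq_zero_iff_eq_neg] at hz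
    rw [hh, hz, apply_formAdjoint hb]
    simp
  obtain ⟨h1, h2⟩ := Classical.epsilon_spec (p := fun u : V × W ↦
    D u = A (formAdjoint b g A s) + l ^ 2 • s ∧ ∀ z, D z = 0 → h u z = 0) ⟨_, hs⟩
  change D (horizontalLift h D (A (formAdjoint b g A s) + l ^ 2 • s)) = _ at h1
  change ∀ z, D z = 0 → h (horizontalLift h D (A (formAdjoint b g A s) + l ^ 2 • s)) z = 0 at h2
  set u := horizontalLift h D (A (formAdjoint b g A s) + l ^ 2 • s)
  set u' : V × W := (formAdjoint b g A s, l ^ 2 • s)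
  -- Uniqueness of the lift: the difference of two lifts lies in the kernel and is orthogonal to it,
  -- hence to itself.
  have h3 : D (u - u') = 0 := by
    have h4 := hs.1
    rw [← h1, hD, hD] at h4
    rw [hD, Prod.fst_sub, Prod.snd_sub, map_sub, sub_add_sub_comm, h4, sub_self]
  have h5 : h (u - u') (u - u') = 0 := by
    have e1 := h2 _ h3
    have e2 := hs.2 _ h3
    rw [hh] at e1 e2 ⊢
    rw [Prod.fst_sub, Prod.snd_sub] at e1 e2 ⊢
    rw [map_sub b, map_sub g, sub_apply, sub_apply]
    linarith
  rw [hh] at h5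
  have h6 : 0 < l ^ 2 := by positivity
  have h7 := mul_nonneg h6.le (hb.nonneg (u - u').1)
  have h8 := hg.nonneg (u - u').2
  have h9 : l ^ 2 * b (u - u').1 (u - u').1 = 0 := by linarith
  rw [← sub_eq_zero]
  exact Prod.ext (hb.eq_zero ((mul_eq_zero.1 h9).resolve_left h6.ne'))
    (hg.eq_zero (by linarith))

/-- The rescaled form induced by the submersion `(X, v) ↦ A X + v` is the deformed form. -/
lemma rescaled_eq_deformedForm (hb : IsScalarProduct b) (hg : IsScalarProduct g)
    (hP : IsRangeProjection g A P) (hl : l ≠ 0)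
    {h : V × W → V × W → ℝ} (hh : ∀ z z', h z z' = l ^ 2 * b z.1 z'.1 + g z.2 z'.2)
    {D : V × W → W} (hD : ∀ z, D z = A z.1 + z.2) (v w : W) :
    1 / l ^ 2 * h (horizontalLift h D (P v)) (horizontalLift h D (P w)) +
      h (horizontalLift h D (v - P v)) (horizontalLift h D (w - P w)) =
    deformedForm b g A P l v w := by
  have hl2 : l ^ 2 ≠ 0 := pow_ne_zero 2 hl
  -- For a vector tangent to the orbit, the solution of `Q s = P v` is again tangent, where `Q` is
  -- `A A* + l²`; this is the base point of the horizontal vector `(A* s, l² s)`.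
  have hrange : ∀ v, ∃ s, P s = s ∧ deformationOperator b g A P l s = P v ∧
      horizontalLift h D (P v) = (formAdjoint b g A s, l ^ 2 • s) := by
    intro v
    obtain ⟨s, hs⟩ := exists_deformationOperator_eq (l := l) hb hg hP (P v)
    obtain ⟨X, hX⟩ := hP.mem_range v
    have hPs := projection_eq_of_deformationOperator_eq hg hP (hs.trans hX.symm)
    refine ⟨s, hPs, hs, ?_⟩
    rw [← hs, deformationOperator_of_projection_eq hPs, horizontalLift_eq hb hg hl hh hD]
  have horth : ∀ v, horizontalLift h D (v - P v) = (0, v - P v) := by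
    intro v
    have h1 : formAdjoint b g A (v - P v) = 0 :=
      hb.eq_zero_of_forall fun X ↦ by rw [apply_formAdjoint hb, hP.orthogonal]
    -- A normal vector has zero adjoint, so with `s = l⁻² (v - P v)` the lift is `(0, v - P v)` and
    -- no rescaling is needed.
    have h2 := horizontalLift_eq (A := A) hb hg hl hh hD ((l ^ 2)⁻¹ • (v - P v))
    rwa [map_smul, h1, smul_zero, map_zero, zero_add, smul_inv_smul₀ hl2] at h2
  obtain ⟨s, hs, hs1, hs2⟩ := hrange v
  obtain ⟨t, ht, ht1, ht2⟩ := hrange w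
  rw [hs2, ht2, horth, horth, hh, hh]
  have hv : deformedForm b g A P l v w = g s (P w) + g (v - P v) (w - P w) := by
    have e1 : v = P v + (v - P v) := by abel
    conv_lhs => rw [e1]
    rw [map_add, add_apply, ← hs1, deformedForm_apply hb hg hP, hs1,
      deformedForm_orthogonal hb hg hP (hP.orthogonal v)]
    have e2 := hP.orthogonal' w s
    have e3 := hP.orthogonal' v w
    rw [hs, hg.symm] at e2
    simp only [map_sub, sub_apply] at e2 e3 ⊢
    linarith
  rw [hv, ← ht1, deformationOperator_of_projection_eq ht, map_add, ← apply_formAdjoint hb g A s]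
  simp only [map_smul, smul_apply, smul_eq_mul, map_zero, mul_zero, zero_add]
  field_simp

end Deformation

end LinearAlgebra

/-! ### Smooth dependence of the deformation on its data -/

section SmoothDependence

variable {V : Type*} [NormedAddCommGroup V] [NormedSpace ℝ V]
  {W : Type*} [NormedAddCommGroup W] [NormedSpace ℝ W]
  {X : Type*} [NormedAddCommGroup X] [NormedSpace ℝ X]
  {n : ℕ∞ω} {x : X}
  {b : X → V →L[ℝ] V →L[ℝ] ℝ} {g : X → W →L[ℝ] W →L[ℝ] ℝ} {A : X → V →L[ℝ] W}
  {P : X → W →L[ℝ] W}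

lemma contDiffAt_inverse [CompleteSpace V] {T : X → V →L[ℝ] W} (hT : ContDiffAt ℝ n T x)
    (h : (T x).IsInvertible) : ContDiffAt ℝ n (fun y ↦ (T y).inverse) x := by
  obtain ⟨e, he⟩ := h
  have : ContDiffAt ℝ n ContinuousLinearMap.inverse (T x) := he ▸ contDiffAt_map_inverse e
  exact this.comp x hT

lemma contDiffAt_precomp (hA : ContDiffAt ℝ n A x) :
    ContDiffAt ℝ n (fun y ↦ (ContinuousLinearMap.compL ℝ V W ℝ).flip (A y)) x := by
  have h := ContinuousLinearMap.contDiff (𝕜 := ℝ) (n := n) (E := V →L[ℝ] W)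
    (F := (W →L[ℝ] ℝ) →L[ℝ] (V →L[ℝ] ℝ)) (ContinuousLinearMap.compL ℝ V W ℝ).flip
  exact h.contDiffAt.comp x hA

lemma contDiffAt_formAdjoint [FiniteDimensional ℝ V] (hb : ContDiffAt ℝ n b x)
    (hg : ContDiffAt ℝ n g x) (hA : ContDiffAt ℝ n A x) (h : (b x).IsInvertible) :
    ContDiffAt ℝ n (fun y ↦ formAdjoint (b y) (g y) (A y)) x := by
  have : CompleteSpace V := FiniteDimensional.complete ℝ V
  have h1 := contDiffAt_inverse hb h
  have h2 : ContDiffAt ℝ n (fun y ↦ (ContinuousLinearMap.compL ℝ V W ℝ).flip (A y)) x :=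
    contDiffAt_precomp hA
  exact h1.clm_comp (h2.clm_comp hg)

lemma bilinearComp_eq (g : W →L[ℝ] W →L[ℝ] ℝ) (B : V →L[ℝ] W) :
    g.bilinearComp B B = ((ContinuousLinearMap.compL ℝ V W ℝ).flip B) ∘L g ∘L B := by
  ext; rfl

lemma contDiffAt_bilinearComp (hg : ContDiffAt ℝ n g x) (hA : ContDiffAt ℝ n A x) :
    ContDiffAt ℝ n (fun y ↦ (g y).bilinearComp (A y) (A y)) x := by
  simp only [bilinearComp_eq]
  have h2 : ContDiffAt ℝ n (fun y ↦ (ContinuousLinearMap.compL ℝ V W ℝ).flip (A y)) x :=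
    contDiffAt_precomp hA
  exact h2.clm_comp (hg.clm_comp hA)

lemma contDiffAt_gramProjection [FiniteDimensional ℝ V] (hg : ContDiffAt ℝ n g x)
    (hA : ContDiffAt ℝ n A x) (h : IsScalarProduct (g x)) (hi : Function.Injective (A x)) :
    ContDiffAt ℝ n (fun y ↦ gramProjection (g y) (A y)) x :=
  hA.clm_comp (contDiffAt_formAdjoint (contDiffAt_bilinearComp hg hA) hg hA
    (h.bilinearComp hi).isInvertible)

/-- The orthogonal projections onto the ranges of linear maps of constant rank vary smoothly. -/
lemma contDiffAt_rangeProjection [FiniteDimensional ℝ V] [FiniteDimensional ℝ W]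
    (hg : ContDiffAt ℝ n g x) (hA : ContDiffAt ℝ n A x)
    (h : ∀ᶠ y in 𝓝 x, IsScalarProduct (g y))
    (hr : ∀ᶠ y in 𝓝 x, Module.finrank ℝ (LinearMap.range (A y).toLinearMap) =
      Module.finrank ℝ (LinearMap.range (A x).toLinearMap))
    (hP : ∀ᶠ y in 𝓝 x, IsRangeProjection (g y) (A y) (P y)) : ContDiffAt ℝ n P x := by
  -- On a complement of the kernel of `A x` all nearby `A y` are injective. Constant rank forces
  -- their images to be the full ranges, so the smooth Gram formula computes the projections.
  obtain ⟨C, hC⟩ := (LinearMap.ker (A x).toLinearMap).exists_isCompl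
  have hinj : Function.Injective ((A x) ∘L C.subtypeL) := by
    rw [injective_iff_map_eq_zero]
    intro c hc
    have : (c : V) ∈ LinearMap.ker (A x).toLinearMap ⊓ C := ⟨hc, c.2⟩
    rw [hC.inf_eq_bot] at this
    exact Subtype.ext this
  have hdim : Module.finrank ℝ C = Module.finrank ℝ (LinearMap.range (A x).toLinearMap) := by
    have h1 := (A x).toLinearMap.finrank_range_add_finrank_ker
    have h2 := Submodule.finrank_add_eq_of_isCompl hC
    omega
  have hB : ContDiffAt ℝ n (fun y ↦ A y ∘L C.subtypeL) x := hA.clm_comp contDiffAt_const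
  have hinj' : ∀ᶠ y in 𝓝 x, Function.Injective (A y ∘L C.subtypeL) :=
    hB.continuousAt.eventually
      ((ContinuousLinearMap.isOpen_injective (𝕜 := ℝ) (E := C) (F := W)).mem_nhds hinj)
  refine (contDiffAt_gramProjection hg hB h.self_of_nhds hinj).congr_of_eventuallyEq ?_
  filter_upwards [h, hr, hP, hinj'] with y h1 h2 h3 h4
  refine h3.unique h1 ((isRangeProjection_gramProjection h1 h4).of_range ?_)
  apply Submodule.eq_of_le_of_finrank_eq
  · rintro _ ⟨c, rfl⟩
    exact ⟨c, rfl⟩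
  · rw [h2, ← hdim]
    exact LinearMap.finrank_range_of_inj h4

/-- The formula consists of compositions, sums and inverses of invertible maps, and invertibility
does not depend on `l`; smoothness in the parameter thus includes `l = 0`. -/
lemma contDiffAt_deformedForm [FiniteDimensional ℝ V] [FiniteDimensional ℝ W]
    {l : X → ℝ} {b : V →L[ℝ] V →L[ℝ] ℝ}
    (hg : ContDiffAt ℝ n g x) (hA : ContDiffAt ℝ n A x) (hP : ContDiffAt ℝ n P x)
    (hl : ContDiffAt ℝ n l x) (hb : IsScalarProduct b) (h : IsScalarProduct (g x))
    (hp : IsRangeProjection (g x) (A x) (P x)) :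
    ContDiffAt ℝ n (fun y ↦ deformedForm b (g y) (A y) (P y) (l y)) x := by
  have : CompleteSpace W := FiniteDimensional.complete ℝ W
  refine hg.clm_comp (contDiffAt_inverse ?_ (isInvertible_deformationOperator hb h hp))
  exact ((hA.clm_comp (contDiffAt_formAdjoint contDiffAt_const hg hA hb.isInvertible)).add
    ((hl.pow 2).smul hP)).add (contDiffAt_const.sub hP)

end SmoothDependence

/-! ### Uniform convergence of derivatives -/

section UniformConvergence

variable {E : Type*} [NormedAddCommGroup E] [NormedSpace ℝ E]
  {F : Type*} [NormedAddCommGroup F] [NormedSpace ℝ F]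

/-- The derivatives of a smooth function with respect to some of the variables are smooth. -/
lemma contDiffOn_iteratedFDeriv_partial {f : ℝ → E → F} {O : Set E} (hO : IsOpen O)
    (hf : ContDiffOn ℝ ∞ (Function.uncurry f) (Set.univ ×ˢ O)) (j : ℕ) :
    ContDiffOn ℝ ∞ (fun z : ℝ × E ↦ iteratedFDeriv ℝ j (f z.1) z.2) (Set.univ ×ˢ O) := by
  have hΩ : IsOpen (Set.univ ×ˢ O : Set (ℝ × E)) := isOpen_univ.prod hO
  induction j with
  | zero =>
    refine ((continuousMultilinearCurryFin0 ℝ E F).symm.contDiff.comp_contDiffOn hf).congr ?_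
    intro z _
    rfl
  | succ j ih =>
    simp only [iteratedFDeriv_succ_eq_comp_left]
    have h := LinearIsometryEquiv.contDiff (𝕜 := ℝ) (n := ∞) (E := E →L[ℝ] E [×j]→L[ℝ] F)
      (F := E [×(j + 1)]→L[ℝ] F)
      (continuousMultilinearCurryLeftEquiv ℝ (fun _ : Fin (j + 1) ↦ E) F).symm
    refine h.comp_contDiffOn (f := fun z : ℝ × E ↦ fderiv ℝ (iteratedFDeriv ℝ j (f z.1)) z.2) ?_
    intro z hz
    refine ContDiffAt.contDiffWithinAt ?_
    -- The pair `z` is kept as a parameter while an independent copy of its second entry is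
    -- differentiated; setting that copy equal to `z.2` gives the partial derivative.
    have h1 : ContDiffAt ℝ ∞ (Function.uncurry fun (z : ℝ × E) (y : E) ↦
        iteratedFDeriv ℝ j (f z.1) y) (z, z.2) := by
      have h2 : ContDiffAt ℝ ∞ (fun z : ℝ × E ↦ iteratedFDeriv ℝ j (f z.1) z.2)
          ((z, z.2).1.1, (z, z.2).2) := ih.contDiffAt (hΩ.mem_nhds hz)
      exact h2.comp (z, z.2) (((contDiff_fst.comp contDiff_fst).prodMk contDiff_snd).contDiffAt)
    exact h1.fderiv contDiffAt_snd (by simp)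

/-- The partial derivatives are jointly continuous, and joint continuity is uniform over a compact
set of points. -/
lemma tendstoUniformlyOn_iteratedFDeriv {f : ℝ → E → F} {O : Set E} (hO : IsOpen O)
    (hf : ContDiffOn ℝ ∞ (Function.uncurry f) (Set.univ ×ˢ O)) (j : ℕ)
    {K : Set E} (hK : IsCompact K) (hKO : K ⊆ O) :
    TendstoUniformlyOn (fun l ↦ iteratedFDeriv ℝ j (f l)) (iteratedFDeriv ℝ j (f 0)) (𝓝 0) K := by
  have h := (contDiffOn_iteratedFDeriv_partial hO hf j).continuousOn.mono
    (Set.prod_mono_right hKO)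
  intro u hu
  obtain ⟨v, hv, hv'⟩ := hK.mem_uniformity_of_prod (f := fun l y ↦ iteratedFDeriv ℝ j (f l) y)
    h (Set.mem_univ 0) (tendsto_swap_uniformity hu)
  rw [nhdsWithin_univ] at hv
  filter_upwards [hv] with l hl y hy
  exact hv' l hl y hy

end UniformConvergence

/-! ### Local diffeomorphisms, and maps of constant rank -/

section ConstantRank

variable {V : Type*} [NormedAddCommGroup V] [NormedSpace ℝ V] [FiniteDimensional ℝ V]
  {W : Type*} [NormedAddCommGroup W] [NormedSpace ℝ W] [FiniteDimensional ℝ W]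

/-- The local inverse is restricted to points where the derivative is invertible, so that it is
smooth on its whole target and not merely at one point. -/
lemma exists_openPartialHomeomorph {f : V → W} {s : Set V} (hs : IsOpen s) {a : V} (ha : a ∈ s)
    (hf : ContDiffOn ℝ ∞ f s) (hf' : (fderiv ℝ f a).IsInvertible) :
    ∃ e : OpenPartialHomeomorph V W, a ∈ e.source ∧ e.source ⊆ s ∧ (∀ z, e z = f z) ∧
      ContDiffOn ℝ ∞ e.symm e.target := by
  have : CompleteSpace V := FiniteDimensional.complete ℝ V
  obtain ⟨f', hf'⟩ := hf'
  have hfa := hf.contDiffAt (hs.mem_nhds ha)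
  have hd : HasFDerivAt f (f' : V →L[ℝ] W) a :=
    hf' ▸ (hfa.differentiableAt (by simp)).hasFDerivAt
  let e₀ := hfa.toOpenPartialHomeomorph f hd (by simp)
  let s' : Set V := s ∩ fderiv ℝ f ⁻¹' Set.range ((↑) : (V ≃L[ℝ] W) → V →L[ℝ] W)
  have hs' : IsOpen s' :=
    (hf.continuousOn_fderiv_of_isOpen hs (by simp)).isOpen_inter_preimage hs
      ContinuousLinearEquiv.isOpen
  refine ⟨e₀.restr s', ?_, ?_, fun z ↦ rfl, ?_⟩
  · rw [OpenPartialHomeomorph.restr_source, hs'.interior_eq]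
    exact ⟨hfa.mem_toOpenPartialHomeomorph_source hd (by simp), ha, f', hf'⟩
  · rw [OpenPartialHomeomorph.restr_source, hs'.interior_eq]
    exact fun z hz ↦ hz.2.1
  · intro w hw
    have hz := (e₀.restr s').map_target hw
    rw [OpenPartialHomeomorph.restr_source, hs'.interior_eq] at hz
    obtain ⟨f₁, hf₁⟩ := hz.2.2
    have hfz := hf.contDiffAt (hs.mem_nhds hz.2.1)
    refine (OpenPartialHomeomorph.contDiffAt_symm (f₀' := f₁) _ hw ?_ hfz).contDiffWithinAt
    rw [hf₁]
    exact (hfz.differentiableAt (by simp)).hasFDerivAt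

/-- A map with surjective derivative is linear in suitable coordinates of the source. -/
lemma exists_straightening_of_surjective {f : V → W} {s : Set V} (hs : IsOpen s) {a : V}
    (ha : a ∈ s) (hf : ContDiffOn ℝ ∞ f s) (hf' : Function.Surjective (fderiv ℝ f a)) :
    ∃ e : OpenPartialHomeomorph V V, a ∈ e.source ∧ e.source ⊆ s ∧ ContDiffOn ℝ ∞ e e.source ∧
      ContDiffOn ℝ ∞ e.symm e.target ∧ ∀ z, fderiv ℝ f a (e z) = f z := by
  obtain ⟨j, hj⟩ := (fderiv ℝ f a).toLinearMap.exists_rightInverse_of_surjective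
    (LinearMap.range_eq_top.2 hf')
  set Λ := fderiv ℝ f a
  let j' : W →L[ℝ] V := j.toContinuousLinearMap
  have hj' : ∀ w, Λ (j' w) = w := fun w ↦ LinearMap.congr_fun hj w
  -- Since `Λ j' = 1`, applying `Λ` to this correction of the identity gives `f z`; its derivative
  -- at `a` is the identity because `f` and `Λ` agree to first order.
  have hd : ContDiffOn ℝ ∞ (fun z ↦ z + j' (f z - Λ z)) s :=
    contDiffOn_id.add (j'.contDiff.comp_contDiffOn (hf.sub Λ.contDiff.contDiffOn))
  have hder : fderiv ℝ (fun z ↦ z + j' (f z - Λ z)) a = ContinuousLinearMap.id ℝ V := by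
    have h1 : HasFDerivAt f Λ a :=
      ((hf.contDiffAt (hs.mem_nhds ha)).differentiableAt (by simp)).hasFDerivAt
    have h2 := (hasFDerivAt_id (𝕜 := ℝ) a).add
      (j'.hasFDerivAt.comp a (h1.sub Λ.hasFDerivAt))
    refine h2.fderiv.trans ?_
    simp
  obtain ⟨e, he, hes, hef, hsymm⟩ := exists_openPartialHomeomorph hs ha hd
    (by rw [hder]; exact ⟨ContinuousLinearEquiv.refl ℝ V, rfl⟩)
  refine ⟨e, he, hes, (hd.mono hes).congr fun z _ ↦ hef z, hsymm, fun z ↦ ?_⟩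
  rw [hef, map_add, hj']
  abel

/-- A map with injective derivative is linear in suitable coordinates of the target. -/
lemma exists_straightening_of_injective {f : V → W} {s : Set V} (hs : IsOpen s) {a : V}
    (ha : a ∈ s) (hf : ContDiffOn ℝ ∞ f s) (hf' : Function.Injective (fderiv ℝ f a)) :
    ∃ e : OpenPartialHomeomorph W W, fderiv ℝ f a a ∈ e.source ∧ ContDiffOn ℝ ∞ e e.source ∧
      ContDiffOn ℝ ∞ e.symm e.target ∧ ∀ z, e (fderiv ℝ f a z) = f z := by
  obtain ⟨q, hq⟩ := (fderiv ℝ f a).toLinearMap.exists_leftInverse_of_injective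
    (LinearMap.ker_eq_bot.2 hf')
  set Λ := fderiv ℝ f a
  let q' : W →L[ℝ] V := q.toContinuousLinearMap
  have hq' : ∀ w, q' (Λ w) = w := fun w ↦ LinearMap.congr_fun hq w
  -- Since `q' Λ = 1`, this correction of the identity takes `Λ z` to `f z`, and its derivative at
  -- `Λ a` is the identity.
  have hd : ContDiffOn ℝ ∞ (fun w ↦ w + (f (q' w) - Λ (q' w))) (q' ⁻¹' s) :=
    contDiffOn_id.add ((hf.comp q'.contDiff.contDiffOn fun _ h ↦ h).sub
      (Λ.contDiff.comp q'.contDiff).contDiffOn)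
  have hder : fderiv ℝ (fun w ↦ w + (f (q' w) - Λ (q' w))) (Λ a) =
      ContinuousLinearMap.id ℝ W := by
    have h1 : HasFDerivAt f Λ (q' (Λ a)) := by
      rw [hq']
      exact ((hf.contDiffAt (hs.mem_nhds ha)).differentiableAt (by simp)).hasFDerivAt
    have h2 := (hasFDerivAt_id (𝕜 := ℝ) (Λ a)).add
      ((h1.comp (Λ a) q'.hasFDerivAt).sub (Λ.hasFDerivAt.comp (Λ a) q'.hasFDerivAt))
    refine h2.fderiv.trans ?_
    simp
  obtain ⟨e, he, hes, hef, hsymm⟩ := exists_openPartialHomeomorph (hs.preimage q'.continuous)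
    (a := Λ a) (by rw [Set.mem_preimage, hq']; exact ha) hd
    (by rw [hder]; exact ⟨ContinuousLinearEquiv.refl ℝ W, rfl⟩)
  refine ⟨e, he, (hd.mono hes).congr fun z _ ↦ hef z, hsymm, fun z ↦ ?_⟩
  rw [hef, hq']
  abel

/-- A map whose derivative vanishes in the direction of a segment is constant on the segment. -/
lemma eq_of_fderiv_eq_zero_on_segment {f : V → W} {s : Set V} (hs : IsOpen s)
    (hc : Convex ℝ s) (hf : DifferentiableOn ℝ f s) {u v : V} (hu : u ∈ s) (hv : v ∈ s)
    (h : ∀ z ∈ s, fderiv ℝ f z (v - u) = 0) : f v = f u := by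
  have hmem : ∀ t ∈ Set.Icc (0 : ℝ) 1, u + t • (v - u) ∈ s := fun t ht ↦
    hc.add_smul_sub_mem hu hv ht
  have hder : ∀ t ∈ Set.Icc (0 : ℝ) 1,
      HasDerivAt (fun t : ℝ ↦ f (u + t • (v - u))) 0 t := by
    intro t ht
    have h1 := (hf.differentiableAt (hs.mem_nhds (hmem t ht))).hasFDerivAt
    have h2 : HasDerivAt (fun t : ℝ ↦ u + t • (v - u)) (v - u) t := by
      simpa using ((hasDerivAt_id t).smul_const (v - u)).const_add u
    have h3 := h1.comp_hasDerivAt t h2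
    rwa [h _ (hmem t ht)] at h3
  have := constant_of_has_deriv_right_zero (f := fun t : ℝ ↦ f (u + t • (v - u)))
    (fun t ht ↦ (hder t ht).continuousAt.continuousWithinAt)
    (fun t ht ↦ (hder t (Set.Ico_subset_Icc_self ht)).hasDerivWithinAt) 1 (by simp)
  simpa using this

/-- The constant rank theorem: near `a`, the map `f` factors through a map `L ∘ f` with linear `L`
that has a smooth section `σ`. -/
lemma exists_section_of_constant_rank {f : V → W} {s : Set V} (hs : IsOpen s) {a : V} (ha : a ∈ s)
    (hf : ContDiffOn ℝ ∞ f s) {k : ℕ}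
    (hk : ∀ z ∈ s, Module.finrank ℝ (LinearMap.range (fderiv ℝ f z).toLinearMap) = k) :
    ∃ (L : W →L[ℝ] EuclideanSpace ℝ (Fin k)) (σ : EuclideanSpace ℝ (Fin k) → V)
      (N : Set V) (B : Set (EuclideanSpace ℝ (Fin k))),
      IsOpen N ∧ a ∈ N ∧ N ⊆ s ∧ IsOpen B ∧ ContDiffOn ℝ ∞ σ B ∧ Set.MapsTo σ B N ∧
      (∀ z ∈ N, L (f z) ∈ B) ∧ σ (L (f a)) = a ∧ (∀ r ∈ B, L (f (σ r)) = r) ∧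
      ∀ z ∈ N, f (σ (L (f z))) = f z := by
  have hfd : ∀ z ∈ s, HasFDerivAt f (fderiv ℝ f z) z := fun z hz ↦
    ((hf.contDiffAt (hs.mem_nhds hz)).differentiableAt (by simp)).hasFDerivAt
  let ι : LinearMap.range (fderiv ℝ f a).toLinearMap ≃ₗ[ℝ] EuclideanSpace ℝ (Fin k) :=
    LinearEquiv.ofFinrankEq _ _ (by rw [hk a ha]; simp)
  -- `L` extends an isomorphism of the range of the derivative at `a` with `ℝ^k`, so `L ∘ f` is a
  -- submersion at `a`.
  obtain ⟨L₀, hL₀⟩ := LinearMap.exists_extend ι.toLinearMap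
  let L : W →L[ℝ] EuclideanSpace ℝ (Fin k) := L₀.toContinuousLinearMap
  have hL : ∀ v, L (fderiv ℝ f a v) = ι ⟨fderiv ℝ f a v, v, rfl⟩ := fun v ↦
    LinearMap.congr_fun hL₀ ⟨fderiv ℝ f a v, v, rfl⟩
  have hLf : ContDiffOn ℝ ∞ (fun z ↦ L (f z)) s := L.contDiff.comp_contDiffOn hf
  have hLd : ∀ z ∈ s, fderiv ℝ (fun z ↦ L (f z)) z = L ∘L fderiv ℝ f z := fun z hz ↦
    (L.hasFDerivAt.comp z (hfd z hz)).fderiv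
  have hsurj : Function.Surjective (L ∘L fderiv ℝ f a) := by
    intro r
    obtain ⟨⟨_, v, rfl⟩, hw⟩ := ι.surjective r
    exact ⟨v, (hL v).trans hw⟩
  obtain ⟨j, hj⟩ := (L ∘L fderiv ℝ f a).toLinearMap.exists_rightInverse_of_surjective
    (LinearMap.range_eq_top.2 hsurj)
  let j' : EuclideanSpace ℝ (Fin k) →L[ℝ] V := j.toContinuousLinearMap
  have hj' : (L ∘L fderiv ℝ f a) ∘L j' = ContinuousLinearMap.id ℝ _ := by
    ext1 w; exact LinearMap.congr_fun hj w
  -- near `a`, the linear map `L` is injective on the range of the derivative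
  let s' : Set V := s ∩ (fun z ↦ (L ∘L fderiv ℝ f z) ∘L j') ⁻¹'
    Set.range ((↑) : (EuclideanSpace ℝ (Fin k) ≃L[ℝ] EuclideanSpace ℝ (Fin k)) → _)
  have hs' : IsOpen s' := by
    refine ContinuousOn.isOpen_inter_preimage ?_ hs ContinuousLinearEquiv.isOpen
    exact (continuousOn_const.clm_comp
      (hf.continuousOn_fderiv_of_isOpen hs (by simp))).clm_comp continuousOn_const
  have has' : a ∈ s' := ⟨ha, ContinuousLinearEquiv.refl ℝ _, hj'.symm⟩
  have hinj : ∀ z ∈ s', ∀ v, L (fderiv ℝ f z v) = 0 → fderiv ℝ f z v = 0 := by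
    intro z hz v hv
    obtain ⟨e, he⟩ := hz.2
    let R := LinearMap.range (fderiv ℝ f z).toLinearMap
    have hsurj' : Function.Surjective (L.toLinearMap ∘ₗ R.subtype) := by
      intro r
      refine ⟨⟨fderiv ℝ f z (j' (e.symm r)), _, rfl⟩, ?_⟩
      have : ((L ∘L fderiv ℝ f z) ∘L j') (e.symm r) = r := by
        change (fun z ↦ (L ∘L fderiv ℝ f z) ∘L j') z (e.symm r) = r
        rw [← he]; simp
      exact this
    -- The constant rank is used here: the range has dimension `k`, so surjectivity of `L` on it
    -- implies injectivity.
    have hinj' : Function.Injective (L.toLinearMap ∘ₗ R.subtype) :=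
      (LinearMap.injective_iff_surjective_of_finrank_eq_finrank
        (by rw [hk z hz.1]; simp)).2 hsurj'
    have : (⟨fderiv ℝ f z v, v, rfl⟩ : R) = 0 := hinj' (by simpa using hv)
    exact congrArg Subtype.val this
  obtain ⟨e, he, hes, -, hesymm, hee⟩ := exists_straightening_of_surjective hs' has'
    (hLf.mono Set.inter_subset_left) (by rw [hLd a ha]; exact hsurj)
  rw [hLd a ha] at hee
  set Λ := L ∘L fderiv ℝ f a
  have hΛ : ∀ r, Λ (j' r) = r := fun r ↦ congrArg (fun T ↦ T r) hj'
  obtain ⟨ε, hε, hball⟩ := Metric.isOpen_iff.1 e.open_target (e a) (e.map_source he)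
  -- in the new coordinates, `f` only depends on `Λ`
  have hconst : ∀ u ∈ Metric.ball (e a) ε, ∀ v ∈ Metric.ball (e a) ε, Λ u = Λ v →
      f (e.symm u) = f (e.symm v) := by
    intro u hu v hv huv
    have hdiff : ∀ w ∈ Metric.ball (e a) ε, DifferentiableAt ℝ e.symm w := fun w hw ↦
      (hesymm.contDiffAt (e.open_target.mem_nhds (hball hw))).differentiableAt (by simp)
    have hmem : ∀ w ∈ Metric.ball (e a) ε, e.symm w ∈ s' := fun w hw ↦
      hes (e.map_target (hball hw))
    have hcomp : ∀ w ∈ Metric.ball (e a) ε, HasFDerivAt (fun w ↦ f (e.symm w))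
        (fderiv ℝ f (e.symm w) ∘L fderiv ℝ e.symm w) w := fun w hw ↦
      (hfd _ (hmem w hw).1).comp w (hdiff w hw).hasFDerivAt
    refine eq_of_fderiv_eq_zero_on_segment Metric.isOpen_ball (convex_ball _ _)
      (fun w hw ↦ (hcomp w hw).differentiableAt.differentiableWithinAt) hv hu fun w hw ↦ ?_
    rw [(hcomp w hw).fderiv]
    -- `L ∘ f ∘ e.symm` is the linear map `Λ`, so `L` kills the derivative along `u - v`; then the
    -- derivative itself vanishes.
    refine hinj _ (hmem w hw) _ ?_
    have h1 : HasFDerivAt (fun w ↦ L (f (e.symm w))) Λ w := by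
      refine Λ.hasFDerivAt.congr_of_eventuallyEq ?_
      filter_upwards [Metric.isOpen_ball.mem_nhds hw] with w' hw'
      rw [← hee, e.right_inv (hball hw')]
    have h2 := (L.hasFDerivAt.comp w (hcomp w hw)).unique h1
    have h3 : L (fderiv ℝ f (e.symm w) (fderiv ℝ e.symm w (u - v))) = Λ (u - v) :=
      congrArg (fun T ↦ T (u - v)) h2
    exact h3.trans (by rw [map_sub, huv, sub_self])
  -- An affine section of `Λ` through `e a`; in the original coordinates it becomes the section `σ`
  -- of `L ∘ f`.
  let τ : EuclideanSpace ℝ (Fin k) → V := fun r ↦ e a + j' (r - Λ (e a))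
  have hτ : ContDiff ℝ ∞ τ := contDiff_const.add (j'.contDiff.comp (contDiff_id.sub contDiff_const))
  have hΛτ : ∀ r, Λ (τ r) = r := fun r ↦ by simp only [τ, map_add, hΛ]; abel
  have hτΛ : τ (Λ (e a)) = e a := by simp [τ]
  let B : Set (EuclideanSpace ℝ (Fin k)) := τ ⁻¹' Metric.ball (e a) ε
  have hB : IsOpen B := Metric.isOpen_ball.preimage hτ.continuous
  let N : Set V := e.source ∩ e ⁻¹' (Metric.ball (e a) ε ∩ Λ ⁻¹' B)
  refine ⟨L, fun r ↦ e.symm (τ r), N, B,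
    e.isOpen_inter_preimage (Metric.isOpen_ball.inter (hB.preimage Λ.continuous)),
    ⟨he, Metric.mem_ball_self hε, ?_⟩, fun z hz ↦ (hes hz.1).1, hB,
    hesymm.comp hτ.contDiffOn fun r hr ↦ hball hr, ?_, ?_, ?_, ?_, ?_⟩
  · change τ (Λ (e a)) ∈ Metric.ball (e a) ε
    rw [hτΛ]
    exact Metric.mem_ball_self hε
  · intro r hr
    have h1 := e.right_inv (hball hr)
    refine ⟨e.map_target (hball hr), ?_, ?_⟩
    · rw [h1]; exact hr
    · change Λ (e (e.symm (τ r))) ∈ B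
      rw [h1, hΛτ]
      exact hr
  · intro z hz
    rw [← hee]
    exact hz.2.2
  · change e.symm (τ (L (f a))) = a
    rw [← hee, hτΛ, e.left_inv he]
  · intro r hr
    change L (f (e.symm (τ r))) = r
    rw [← hee, e.right_inv (hball hr), hΛτ]
  · intro z hz
    change f (e.symm (τ (L (f z)))) = f z
    have h1 := hconst (τ (L (f z))) (by rw [← hee]; exact hz.2.2) (e z) hz.2.1
      (by rw [hΛτ, hee])
    rw [h1, e.left_inv hz.1]

end ConstantRank

/-! ### Maps and fields of bilinear forms read in charts. -/

section Coordinates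

variable {E : Type*} [NormedAddCommGroup E] [NormedSpace ℝ E] [FiniteDimensional ℝ E]
  {M : Type*} [TopologicalSpace M] [ChartedSpace E M] [IsManifold 𝓘(ℝ, E) ∞ M]
  {F : Type*} [NormedAddCommGroup F] [NormedSpace ℝ F] [FiniteDimensional ℝ F]
  {N : Type*} [TopologicalSpace N] [ChartedSpace F N] [IsManifold 𝓘(ℝ, F) ∞ N]

/-- The derivative of the inverse of the preferred chart at `x₀`. -/
def chartDeriv (x₀ : M) (y : E) : E →L[ℝ] E :=
  mfderiv 𝓘(ℝ, E) 𝓘(ℝ, E) (extChartAt 𝓘(ℝ, E) x₀).symm y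

/-- The derivative at `x` of the preferred chart at `x₀`. -/
def chartDerivInv (x₀ x : M) : E →L[ℝ] E :=
  mfderiv 𝓘(ℝ, E) 𝓘(ℝ, E) (extChartAt 𝓘(ℝ, E) x₀) x

lemma chartDerivInv_comp_chartDeriv {x₀ : M} {y : E} (hy : y ∈ (extChartAt 𝓘(ℝ, E) x₀).target) :
    chartDerivInv x₀ ((extChartAt 𝓘(ℝ, E) x₀).symm y) ∘L chartDeriv x₀ y =
      ContinuousLinearMap.id ℝ E := by
  have := mfderiv_extChartAt_comp_mfderivWithin_extChartAt_symm hy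
  rw [ModelWithCorners.range_eq_univ, mfderivWithin_univ] at this
  exact this

lemma chartDeriv_comp_chartDerivInv {x₀ : M} {y : E} (hy : y ∈ (extChartAt 𝓘(ℝ, E) x₀).target) :
    chartDeriv x₀ y ∘L chartDerivInv x₀ ((extChartAt 𝓘(ℝ, E) x₀).symm y) =
      ContinuousLinearMap.id ℝ E := by
  have := mfderivWithin_extChartAt_symm_comp_mfderiv_extChartAt hy
  rw [ModelWithCorners.range_eq_univ, mfderivWithin_univ] at this
  exact this

/-- The derivative of the inverse of a chart as an equivalence. -/
def chartDerivEquiv (x₀ : M) {y : E} (hy : y ∈ (extChartAt 𝓘(ℝ, E) x₀).target) : E ≃L[ℝ] E :=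
  ContinuousLinearEquiv.equivOfInverse (chartDeriv x₀ y)
    (chartDerivInv x₀ ((extChartAt 𝓘(ℝ, E) x₀).symm y))
    (fun v ↦ congrArg (fun T ↦ T v) (chartDerivInv_comp_chartDeriv hy))
    (fun v ↦ congrArg (fun T ↦ T v) (chartDeriv_comp_chartDerivInv hy))

lemma chartDeriv_self (x₀ : M) : chartDeriv x₀ (extChartAt 𝓘(ℝ, E) x₀ x₀) =
    ContinuousLinearMap.id ℝ E := by
  have := mfderivWithin_range_extChartAt_symm (I := 𝓘(ℝ, E)) (x := x₀)
  rw [ModelWithCorners.range_eq_univ, mfderivWithin_univ] at this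
  exact this

lemma chartDerivInv_self (x₀ : M) : chartDerivInv x₀ x₀ = ContinuousLinearMap.id ℝ E :=
  mfderiv_extChartAt_self (I := 𝓘(ℝ, E)) (x := x₀)

lemma target_mem_nhds {x₀ : M} {y : E} (hy : y ∈ (extChartAt 𝓘(ℝ, E) x₀).target) :
    (extChartAt 𝓘(ℝ, E) x₀).target ∈ 𝓝 y :=
  (isOpen_extChartAt_target x₀).mem_nhds hy

lemma contMDiffAt_chart_symm {x₀ : M} {y : E} (hy : y ∈ (extChartAt 𝓘(ℝ, E) x₀).target) :
    ContMDiffAt 𝓘(ℝ, E) 𝓘(ℝ, E) ∞ (extChartAt 𝓘(ℝ, E) x₀).symm y :=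
  (contMDiffOn_extChartAt_symm x₀).contMDiffAt (target_mem_nhds hy)

lemma contMDiffAt_chart {x₀ x : M} (hx : x ∈ (extChartAt 𝓘(ℝ, E) x₀).source) :
    ContMDiffAt 𝓘(ℝ, E) 𝓘(ℝ, E) ∞ (extChartAt 𝓘(ℝ, E) x₀) x :=
  contMDiffAt_extChartAt' (by rwa [extChartAt_source] at hx)

variable (E F) in
/-- The derivative of a map between manifolds, as a linear map of the model spaces. -/
def modelDeriv (f : M → N) (x : M) : E →L[ℝ] F := mfderiv 𝓘(ℝ, E) 𝓘(ℝ, F) f x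

variable (E F) in
/-- A map between manifolds read in preferred charts. -/
def localRep (f : M → N) (x₀ : M) (y₀ : N) (y : E) : F :=
  extChartAt 𝓘(ℝ, F) y₀ (f ((extChartAt 𝓘(ℝ, E) x₀).symm y))

lemma contDiffAt_localRep {f : M → N} {x₀ : M} {y₀ : N} {y : E} {n : ℕ∞ω} (hn : n ≤ ∞)
    (hy : y ∈ (extChartAt 𝓘(ℝ, E) x₀).target)
    (hf : ContMDiffAt 𝓘(ℝ, E) 𝓘(ℝ, F) n f ((extChartAt 𝓘(ℝ, E) x₀).symm y))
    (hfy : f ((extChartAt 𝓘(ℝ, E) x₀).symm y) ∈ (extChartAt 𝓘(ℝ, F) y₀).source) :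
    ContDiffAt ℝ n (localRep E F f x₀ y₀) y := by
  rw [← contMDiffAt_iff_contDiffAt]
  exact ((contMDiffAt_chart hfy).of_le hn).comp y
    (f := fun y : E ↦ f ((extChartAt 𝓘(ℝ, E) x₀).symm y))
    (hf.comp y ((contMDiffAt_chart_symm hy).of_le hn))

/-- The derivative of a map between manifolds, read in charts. -/
lemma modelDeriv_chartDeriv {f : M → N} {x₀ : M} {y₀ : N} {y : E}
    (hy : y ∈ (extChartAt 𝓘(ℝ, E) x₀).target)
    (hf : MDifferentiableAt 𝓘(ℝ, E) 𝓘(ℝ, F) f ((extChartAt 𝓘(ℝ, E) x₀).symm y))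
    (hfy : f ((extChartAt 𝓘(ℝ, E) x₀).symm y) ∈ (extChartAt 𝓘(ℝ, F) y₀).source) (v : E) :
    modelDeriv E F f ((extChartAt 𝓘(ℝ, E) x₀).symm y) (chartDeriv x₀ y v) =
      chartDeriv y₀ (localRep E F f x₀ y₀ y) (fderiv ℝ (localRep E F f x₀ y₀) y v) := by
  have h1 : MDifferentiableAt 𝓘(ℝ, E) 𝓘(ℝ, E) (extChartAt 𝓘(ℝ, E) x₀).symm y :=
    (contMDiffAt_chart_symm hy).mdifferentiableAt (by simp)
  have h2 : MDifferentiableAt 𝓘(ℝ, F) 𝓘(ℝ, F) (extChartAt 𝓘(ℝ, F) y₀)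
      (f ((extChartAt 𝓘(ℝ, E) x₀).symm y)) := (contMDiffAt_chart hfy).mdifferentiableAt (by simp)
  have h3 : fderiv ℝ (localRep E F f x₀ y₀) y =
      chartDerivInv y₀ (f ((extChartAt 𝓘(ℝ, E) x₀).symm y)) ∘L
      modelDeriv E F f ((extChartAt 𝓘(ℝ, E) x₀).symm y) ∘L chartDeriv x₀ y := by
    rw [← mfderiv_eq_fderiv]
    have h4 := mfderiv_comp y (h2.comp _ hf) h1
    have h5 := mfderiv_comp _ h2 hf
    rw [h5] at h4
    exact h4
  have h7 := chartDeriv_comp_chartDerivInv (x₀ := y₀) ((extChartAt 𝓘(ℝ, F) y₀).map_source hfy)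
  rw [(extChartAt 𝓘(ℝ, F) y₀).left_inv hfy] at h7
  rw [h3]
  exact (congrArg (fun T : F →L[ℝ] F ↦ T (modelDeriv E F f
    ((extChartAt 𝓘(ℝ, E) x₀).symm y) (chartDeriv x₀ y v))) h7).symm

/-- A field of bilinear forms, read in the preferred chart at `x₀`. -/
def coordForm (g : ∀ x : M, TangentSpace 𝓘(ℝ, E) x →L[ℝ] TangentSpace 𝓘(ℝ, E) x →L[ℝ] ℝ)
    (x₀ : M) (y : E) : E →L[ℝ] E →L[ℝ] ℝ :=
  ContinuousLinearMap.bilinearComp (E := E) (F := E)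
    (show E →L[ℝ] E →L[ℝ] ℝ from g ((extChartAt 𝓘(ℝ, E) x₀).symm y))
    (chartDeriv x₀ y) (chartDeriv x₀ y)

lemma coordForm_apply (g : ∀ x : M, TangentSpace 𝓘(ℝ, E) x →L[ℝ] TangentSpace 𝓘(ℝ, E) x →L[ℝ] ℝ)
    (x₀ : M) (y a b : E) : coordForm g x₀ y a b =
      g ((extChartAt 𝓘(ℝ, E) x₀).symm y) (chartDeriv x₀ y a) (chartDeriv x₀ y b) := rfl

lemma coordForm_chart (g : ∀ x : M, TangentSpace 𝓘(ℝ, E) x →L[ℝ] TangentSpace 𝓘(ℝ, E) x →L[ℝ] ℝ)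
    {x₀ x : M} (hx : x ∈ (extChartAt 𝓘(ℝ, E) x₀).source) (a b : E) :
    coordForm g x₀ (extChartAt 𝓘(ℝ, E) x₀ x) a b =
      g x (chartDeriv x₀ (extChartAt 𝓘(ℝ, E) x₀ x) a)
        (chartDeriv x₀ (extChartAt 𝓘(ℝ, E) x₀ x) b) := by
  rw [coordForm_apply, (extChartAt 𝓘(ℝ, E) x₀).left_inv hx]

/-- In finite dimension a linear map is determined by its values on a basis, through a linear
isomorphism. -/
lemma contDiffAt_clm_of_apply {X : Type*} [NormedAddCommGroup X] [NormedSpace ℝ X]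
    {h : X → E →L[ℝ] F} {x : X} {n : ℕ∞ω} (hh : ∀ a, ContDiffAt ℝ n (fun x ↦ h x a) x) :
    ContDiffAt ℝ n h x := by
  let d := Module.finrank ℝ E
  have hd : d = Module.finrank ℝ (Fin d → ℝ) := (Module.finrank_fin_fun ℝ).symm
  let e₁ := ContinuousLinearEquiv.ofFinrankEq hd
  let e₂ := (e₁.arrowCongr (1 : F ≃L[ℝ] F)).trans (ContinuousLinearEquiv.piRing (Fin d))
  rw [← Function.id_comp h, ← e₂.symm_comp_self]
  exact e₂.symm.contDiff.contDiffAt.comp x (contDiffAt_pi.mpr fun i ↦ hh _)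

lemma contDiffAt_form_iff {X : Type*} [NormedAddCommGroup X] [NormedSpace ℝ X]
    {h : X → E →L[ℝ] E →L[ℝ] ℝ} {x : X} {n : ℕ∞ω} :
    ContDiffAt ℝ n h x ↔ ∀ a b, ContDiffAt ℝ n (fun x ↦ h x a b) x := by
  refine ⟨fun hh a b ↦ (hh.clm_apply contDiffAt_const).clm_apply contDiffAt_const, fun hh ↦ ?_⟩
  exact contDiffAt_clm_of_apply fun a ↦ contDiffAt_clm_of_apply fun b ↦ hh a b

/-- A field of bilinear forms is smooth if and only if it is smooth in charts. -/
lemma contMDiffAt_form_iff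
    {g : ∀ x : M, TangentSpace 𝓘(ℝ, E) x →L[ℝ] TangentSpace 𝓘(ℝ, E) x →L[ℝ] ℝ} {x₀ x : M}
    (hx : x ∈ (extChartAt 𝓘(ℝ, E) x₀).source) :
    ContMDiffAt 𝓘(ℝ, E) (𝓘(ℝ, E).prod 𝓘(ℝ, E →L[ℝ] E →L[ℝ] ℝ)) ∞
      (fun x : M ↦ TotalSpace.mk' (E →L[ℝ] E →L[ℝ] ℝ)
      (E := fun x : M ↦ TangentSpace 𝓘(ℝ, E) x →L[ℝ] TangentSpace 𝓘(ℝ, E) x →L[ℝ] ℝ)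
      x (g x)) x ↔
    ContDiffAt ℝ ∞ (coordForm g x₀) (extChartAt 𝓘(ℝ, E) x₀ x) := by
  set e := trivializationAt (E →L[ℝ] E →L[ℝ] ℝ)
      (fun x : M ↦ TangentSpace 𝓘(ℝ, E) x →L[ℝ] TangentSpace 𝓘(ℝ, E) x →L[ℝ] ℝ) x₀ with he
  have hx' : x ∈ (chartAt E x₀).source := by rwa [extChartAt_source] at hx
  have hbase : e.baseSet = (chartAt E x₀).source := by
    simp [he, hom_trivializationAt_baseSet]
  have h0 : (TotalSpace.mk' (E →L[ℝ] E →L[ℝ] ℝ)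
      (E := fun x : M ↦ TangentSpace 𝓘(ℝ, E) x →L[ℝ] TangentSpace 𝓘(ℝ, E) x →L[ℝ] ℝ)
      x (g x)) ∈ e.source := by
    rw [e.mem_source, hbase]; exact hx'
  rw [Trivialization.contMDiffAt_iff (IM := 𝓘(ℝ, E)) (n := ∞) (IB := 𝓘(ℝ, E)) (e := e) h0]
  -- The trivialization of the bundle of forms precomposes both arguments with the inverse tangent
  -- trivialization, which is the derivative of the inverse chart.
  have hcoord : ∀ x' ∈ (chartAt E x₀).source, (e (TotalSpace.mk' (E →L[ℝ] E →L[ℝ] ℝ)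
      (E := fun x : M ↦ TangentSpace 𝓘(ℝ, E) x →L[ℝ] TangentSpace 𝓘(ℝ, E) x →L[ℝ] ℝ)
      x' (g x'))).2 = coordForm g x₀ (extChartAt 𝓘(ℝ, E) x₀ x') := by
    intro x' hx'
    ext a b
    have h2 : ∀ v : E, (trivializationAt E (TangentSpace 𝓘(ℝ, E)) x₀).symm x' v =
        chartDeriv x₀ (extChartAt 𝓘(ℝ, E) x₀ x') v := by
      intro v
      have := TangentBundle.symmL_trivializationAt (I := 𝓘(ℝ, E)) hx'
      rw [ModelWithCorners.range_eq_univ, mfderivWithin_univ] at this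
      rw [← Trivialization.symmL_apply (R := ℝ) _ hx']
      exact congrArg (fun T ↦ T v) this
    have h3 := inCoordinates_apply_eq₂ (𝕜 := ℝ) (F₁ := E) (F₂ := E) (F₃ := ℝ)
      (E₁ := fun x : M ↦ TangentSpace 𝓘(ℝ, E) x) (E₂ := fun x : M ↦ TangentSpace 𝓘(ℝ, E) x)
      (E₃ := fun _ : M ↦ ℝ) (x₀ := x₀) (x := x') (ϕ := g x') (v := a) (w := b) hx' hx'
      (by simp)
    rw [h2 a, h2 b] at h3
    refine Eq.trans ?_ (h3.trans ?_)
    · rfl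
    · rw [coordForm_chart g (by rwa [extChartAt_source])]
      simp
  have hsrc : (chartAt E x₀).source ∈ 𝓝 x := (chartAt E x₀).open_source.mem_nhds hx'
  have hcongr : ContMDiffAt 𝓘(ℝ, E) 𝓘(ℝ, E →L[ℝ] E →L[ℝ] ℝ) ∞
      (fun x : M ↦ (e (TotalSpace.mk' (E →L[ℝ] E →L[ℝ] ℝ)
      (E := fun x : M ↦ TangentSpace 𝓘(ℝ, E) x →L[ℝ] TangentSpace 𝓘(ℝ, E) x →L[ℝ] ℝ)
      x (g x))).2) x ↔ ContMDiffAt 𝓘(ℝ, E) 𝓘(ℝ, E →L[ℝ] E →L[ℝ] ℝ) ∞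
      (fun x ↦ coordForm g x₀ (extChartAt 𝓘(ℝ, E) x₀ x)) x := by
    apply Filter.EventuallyEq.contMDiffAt_iff
    filter_upwards [hsrc] with x' hx' using hcoord x' hx'
  refine ⟨fun h ↦ ?_, fun h ↦ ⟨contMDiffAt_id, hcongr.2 ?_⟩⟩
  · have h4 := hcongr.1 h.2
    rw [← contMDiffAt_iff_contDiffAt]
    have hy := (extChartAt 𝓘(ℝ, E) x₀).map_source hx
    have h5 : ContMDiffAt 𝓘(ℝ, E) 𝓘(ℝ, E →L[ℝ] E →L[ℝ] ℝ) ∞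
        (fun x ↦ coordForm g x₀ (extChartAt 𝓘(ℝ, E) x₀ x))
        ((extChartAt 𝓘(ℝ, E) x₀).symm (extChartAt 𝓘(ℝ, E) x₀ x)) := by
      rwa [(extChartAt 𝓘(ℝ, E) x₀).left_inv hx]
    refine (h5.comp _ (contMDiffAt_chart_symm hy)).congr_of_eventuallyEq ?_
    filter_upwards [target_mem_nhds hy] with y hy
    simp only [Function.comp, (extChartAt 𝓘(ℝ, E) x₀).right_inv hy]
  · exact (contMDiffAt_iff_contDiffAt.2 h).comp x (contMDiffAt_chart hx)

lemma modelDeriv_comp {H : Type*} [NormedAddCommGroup H] [NormedSpace ℝ H]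
    {L : Type*} [TopologicalSpace L] [ChartedSpace H L] {h : N → L} {f : M → N} {x : M}
    (hh : MDifferentiableAt 𝓘(ℝ, F) 𝓘(ℝ, H) h (f x))
    (hf : MDifferentiableAt 𝓘(ℝ, E) 𝓘(ℝ, F) f x) :
    modelDeriv E H (fun y ↦ h (f y)) x = modelDeriv F H h (f x) ∘L modelDeriv E F f x :=
  mfderiv_comp x hh hf

lemma modelDeriv_congr {f g : M → N} {x : M} (h : f =ᶠ[𝓝 x] g) :
    modelDeriv E F f x = modelDeriv E F g x := by
  have hv := h.mfderiv_eq (I := 𝓘(ℝ, E)) (I' := 𝓘(ℝ, F))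
  exact hv

lemma modelDeriv_id (x : M) : modelDeriv E E (fun y : M ↦ y) x = ContinuousLinearMap.id ℝ E :=
  mfderiv_id

/-! ### Criteria for immersions and submersions -/

lemma trans_mem_maximalAtlas {φ : OpenPartialHomeomorph M E}
    (hφ : φ ∈ IsManifold.maximalAtlas 𝓘(ℝ, E) ∞ M) {e : OpenPartialHomeomorph E E}
    (he : ContDiffOn ℝ ∞ e e.source) (he' : ContDiffOn ℝ ∞ e.symm e.target) :
    φ.trans e ∈ IsManifold.maximalAtlas 𝓘(ℝ, E) ∞ M := by
  have heG : e ∈ contDiffGroupoid ∞ 𝓘(ℝ, E) := by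
    rw [contDiffGroupoid, mem_groupoid_of_pregroupoid]
    simpa [contDiffPregroupoid] using ⟨he, he'⟩
  intro e' h'
  obtain ⟨h1, h2⟩ := hφ e' h'
  constructor
  · have h3 := (contDiffGroupoid ∞ 𝓘(ℝ, E)).trans ((contDiffGroupoid ∞ 𝓘(ℝ, E)).symm heG) h1
    rwa [← OpenPartialHomeomorph.trans_assoc,
      ← OpenPartialHomeomorph.trans_symm_eq_symm_trans_symm] at h3
  · have h3 := (contDiffGroupoid ∞ 𝓘(ℝ, E)).trans h2 heG
    rwa [OpenPartialHomeomorph.trans_assoc] at h3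

lemma contDiffOn_localRep {f : M → N} (hf : ContMDiff 𝓘(ℝ, E) 𝓘(ℝ, F) ∞ f) (x₀ : M) (y₀ : N) :
    ContDiffOn ℝ ∞ (localRep E F f x₀ y₀) ((extChartAt 𝓘(ℝ, E) x₀).target ∩
      (extChartAt 𝓘(ℝ, E) x₀).symm ⁻¹' (f ⁻¹' (extChartAt 𝓘(ℝ, F) y₀).source)) :=
  fun _ hy ↦ (contDiffAt_localRep le_rfl hy.1 hf.contMDiffAt hy.2).contDiffWithinAt

lemma isOpen_localRep_domain {f : M → N} (hf : Continuous f) (x₀ : M) (y₀ : N) :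
    IsOpen ((extChartAt 𝓘(ℝ, E) x₀).target ∩
      (extChartAt 𝓘(ℝ, E) x₀).symm ⁻¹' (f ⁻¹' (extChartAt 𝓘(ℝ, F) y₀).source)) :=
  (continuousOn_extChartAt_symm x₀).isOpen_inter_preimage (isOpen_extChartAt_target x₀)
    ((isOpen_extChartAt_source y₀).preimage hf)

lemma fderiv_localRep_self {f : M → N} {x : M} (hf : MDifferentiableAt 𝓘(ℝ, E) 𝓘(ℝ, F) f x) :
    fderiv ℝ (localRep E F f x (f x)) (extChartAt 𝓘(ℝ, E) x x) = modelDeriv E F f x := by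
  ext v
  have hl : (extChartAt 𝓘(ℝ, E) x).symm (extChartAt 𝓘(ℝ, E) x x) = x := extChartAt_to_inv x
  have h := modelDeriv_chartDeriv (f := f) (y₀ := f x) (mem_extChartAt_target (I := 𝓘(ℝ, E)) x)
    (by rwa [hl]) (by rw [hl]; exact mem_extChartAt_source _) v
  rw [chartDeriv_self, hl] at h
  have h2 : localRep E F f x (f x) (extChartAt 𝓘(ℝ, E) x x) = extChartAt 𝓘(ℝ, F) (f x) (f x) := by
    rw [localRep, hl]
  rw [h2, chartDeriv_self] at h
  exact h.symm

/-- A smooth map with injective derivative is an immersion. -/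
lemma isImmersion_of_injective {f : M → N} (hf : ContMDiff 𝓘(ℝ, E) 𝓘(ℝ, F) ∞ f)
    (h : ∀ x, Function.Injective (modelDeriv E F f x)) :
    IsImmersion 𝓘(ℝ, E) 𝓘(ℝ, F) ∞ f := by
  refine IsImmersionOfComplement.isImmersion
    (F := EuclideanSpace ℝ (Fin (Module.finrank ℝ F - Module.finrank ℝ E))) fun x ↦ ?_
  have hl : (extChartAt 𝓘(ℝ, E) x).symm (extChartAt 𝓘(ℝ, E) x x) = x := extChartAt_to_inv x
  have hmd := (hf x).mdifferentiableAt (by simp : (∞ : ℕ∞ω) ≠ 0)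
  obtain ⟨e, hes, he, he', hef⟩ := exists_straightening_of_injective
    (isOpen_localRep_domain hf.continuous x (f x)) (a := extChartAt 𝓘(ℝ, E) x x)
    ⟨mem_extChartAt_target x, by
      rw [Set.mem_preimage, hl]; exact mem_extChartAt_source (f x)⟩
    (contDiffOn_localRep hf x (f x)) (by rw [fderiv_localRep_self hmd]; exact h x)
  rw [fderiv_localRep_self hmd] at hes hef
  set Λ := modelDeriv E F f x
  obtain ⟨C, hC⟩ := (LinearMap.range Λ.toLinearMap).exists_isCompl
  have hdim : Module.finrank ℝ (EuclideanSpace ℝ (Fin (Module.finrank ℝ F - Module.finrank ℝ E))) =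
      Module.finrank ℝ C := by
    have h1 := Submodule.finrank_add_eq_of_isCompl hC
    rw [LinearMap.finrank_range_of_inj (h x)] at h1
    rw [finrank_euclideanSpace_fin]
    omega
  -- `Λ` on the first factor and a complement of its range on the second; in the straightened target
  -- chart `f` becomes `z ↦ ε (z, 0)`.
  let ε : (E × EuclideanSpace ℝ (Fin (Module.finrank ℝ F - Module.finrank ℝ E))) ≃L[ℝ] F :=
    (((LinearEquiv.ofInjective Λ.toLinearMap (h x)).prodCongr
      (LinearEquiv.ofFinrankEq _ _ hdim)).trans
      (Submodule.prodEquivOfIsCompl _ _ hC)).toContinuousLinearEquiv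
  have hε : ∀ v, ε (v, 0) = Λ v := by
    intro v
    simp [ε]
  -- the domain of the chart of the source
  let s : Set M := (extChartAt 𝓘(ℝ, E) x).source ∩ (extChartAt 𝓘(ℝ, E) x) ⁻¹' (Λ ⁻¹' e.source)
  have hs : IsOpen s := (continuousOn_extChartAt x).isOpen_inter_preimage
    (isOpen_extChartAt_source x) (e.open_source.preimage Λ.continuous)
  have hxs : x ∈ s := ⟨mem_extChartAt_source x, hes⟩
  have hfx : extChartAt 𝓘(ℝ, F) (f x) (f x) = e (Λ (extChartAt 𝓘(ℝ, E) x x)) := by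
    rw [hef, localRep, hl]
  refine IsImmersionAtOfComplement.mk_of_continuousAt hf.continuous.continuousAt ε
    ((chartAt E x).restr s) ((chartAt F (f x)).trans e.symm) ?_ ?_
    (restr_mem_maximalAtlas (contDiffGroupoid ∞ 𝓘(ℝ, E)) (IsManifold.chart_mem_maximalAtlas x) hs)
    (trans_mem_maximalAtlas (IsManifold.chart_mem_maximalAtlas (f x)) he' he) ?_
  · rw [OpenPartialHomeomorph.restr_source, hs.interior_eq]
    exact ⟨mem_chart_source E x, hxs⟩
  · rw [OpenPartialHomeomorph.trans_source]
    refine ⟨mem_chart_source F (f x), ?_⟩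
    change extChartAt 𝓘(ℝ, F) (f x) (f x) ∈ e.target
    rw [hfx]
    exact e.map_source hes
  · intro z hz
    have hz' : z ∈ (chartAt E x).target ∧ (chartAt E x).symm z ∈ s := by
      simpa [hs.interior_eq] using hz
    have h1 : extChartAt 𝓘(ℝ, E) x ((chartAt E x).symm z) = z := (chartAt E x).right_inv hz'.1
    have h2 : Λ z ∈ e.source := by
      have := hz'.2.2
      rwa [Set.mem_preimage, h1] at this
    change e.symm (localRep E F f x (f x) z) = ε (z, 0)
    rw [hε, ← hef, e.left_inv h2]

/-- A smooth map with surjective derivative is a submersion. -/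
lemma isSubmersion_of_surjective {f : M → N} (hf : ContMDiff 𝓘(ℝ, E) 𝓘(ℝ, F) ∞ f)
    (h : ∀ x, Function.Surjective (modelDeriv E F f x)) :
    IsSubmersion 𝓘(ℝ, E) 𝓘(ℝ, F) ∞ f := by
  refine IsSubmersionOfComplement.isSubmersion
    (F := EuclideanSpace ℝ (Fin (Module.finrank ℝ E - Module.finrank ℝ F))) fun x ↦ ?_
  have hl : (extChartAt 𝓘(ℝ, E) x).symm (extChartAt 𝓘(ℝ, E) x x) = x := extChartAt_to_inv x
  have hmd := (hf x).mdifferentiableAt (by simp : (∞ : ℕ∞ω) ≠ 0)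
  obtain ⟨e, hes, hes', he, he', hef⟩ := exists_straightening_of_surjective
    (isOpen_localRep_domain hf.continuous x (f x)) (a := extChartAt 𝓘(ℝ, E) x x)
    ⟨mem_extChartAt_target x, by
      rw [Set.mem_preimage, hl]; exact mem_extChartAt_source (f x)⟩
    (contDiffOn_localRep hf x (f x)) (by rw [fderiv_localRep_self hmd]; exact h x)
  rw [fderiv_localRep_self hmd] at hef
  set Λ := modelDeriv E F f x
  have hrange : LinearMap.range Λ.toLinearMap = ⊤ := LinearMap.range_eq_top.2 (h x)
  obtain ⟨C, hC⟩ := (LinearMap.ker Λ.toLinearMap).exists_isCompl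
  have hdim : Module.finrank ℝ (LinearMap.ker Λ.toLinearMap) =
      Module.finrank ℝ (EuclideanSpace ℝ (Fin (Module.finrank ℝ E - Module.finrank ℝ F))) := by
    have h1 := Λ.toLinearMap.finrank_range_add_finrank_ker
    rw [hrange, finrank_top] at h1
    rw [finrank_euclideanSpace_fin]
    omega
  let ι := LinearEquiv.ofFinrankEq _ _ hdim
  -- The first component is `Λ`, the second a projection onto its kernel.
  let ε : E ≃L[ℝ] (F × EuclideanSpace ℝ (Fin (Module.finrank ℝ E - Module.finrank ℝ F))) :=
    ((LinearMap.equivProdOfSurjectiveOfIsCompl Λ.toLinearMap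
      (Submodule.projectionOnto _ _ hC) hrange (by simp) (by simpa using hC)).trans
      ((LinearEquiv.refl ℝ F).prodCongr ι)).toContinuousLinearEquiv
  have hε : ∀ v, (ε v).1 = Λ v := fun v ↦ rfl
  refine IsSubmersionAtOfComplement.mk_of_continuousAt hf.continuous.continuousAt ε
    ((chartAt E x).trans e) (chartAt F (f x)) ?_ (mem_chart_source F (f x))
    (trans_mem_maximalAtlas (IsManifold.chart_mem_maximalAtlas x) he he')
    (IsManifold.chart_mem_maximalAtlas (f x)) ?_
  · rw [OpenPartialHomeomorph.trans_source]
    exact ⟨mem_chart_source E x, hes⟩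
  · intro z hz
    have hz' : z ∈ e.target ∧ e.symm z ∈ (chartAt E x).target := by simpa using hz
    change localRep E F f x (f x) (e.symm z) = (ε z).1
    rw [hε, ← hef, e.right_inv hz'.1]

/-- A submersion has local sections. -/
lemma exists_section_of_isSubmersion {f : M → N} (hf : IsSubmersion 𝓘(ℝ, E) 𝓘(ℝ, F) ∞ f) (x : M) :
    ∃ σ : N → M, ContMDiffAt 𝓘(ℝ, F) 𝓘(ℝ, E) ∞ σ (f x) ∧ σ (f x) = x ∧
      ∀ᶠ y in 𝓝 (f x), f (σ y) = y := by
  have h := hf.isSubmersionAt x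
  set d := h.domChart
  set c := h.codChart
  set ε := h.equiv
  have hd : x ∈ d.source := h.mem_domChart_source
  have hc : f x ∈ c.source := h.mem_codChart_source
  have hw : ∀ z ∈ d.target, c (f (d.symm z)) = (ε z).1 := by
    intro z hz
    exact h.writtenInCharts (by simpa using hz)
  -- The complementary coordinate is frozen at its value at `x`, so that the section passes through
  -- `x`.
  let τ : N → E := fun y ↦ ε.symm (c y, (ε (d x)).2)
  have hτ : τ (f x) = d x := by
    have h1 := hw (d x) (d.map_source hd)
    rw [d.left_inv hd] at h1
    simp only [τ, h1, Prod.mk.eta, ContinuousLinearEquiv.symm_apply_apply]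
  have hc' : ContMDiffAt 𝓘(ℝ, F) 𝓘(ℝ, F) ∞ c (f x) :=
    contMDiffAt_of_mem_maximalAtlas h.codChart_mem_maximalAtlas hc
  have hlin : ContDiff ℝ ∞ (fun w : F ↦ ε.symm (w, (ε (d x)).2)) :=
    ε.symm.contDiff.comp (contDiff_id.prodMk contDiff_const)
  have hτs : ContMDiffAt 𝓘(ℝ, F) 𝓘(ℝ, E) ∞ τ (f x) :=
    hlin.contMDiff.contMDiffAt.comp (f x) hc'
  have hds : ContMDiffAt 𝓘(ℝ, E) 𝓘(ℝ, E) ∞ d.symm (τ (f x)) := by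
    rw [hτ]
    exact contMDiffAt_symm_of_mem_maximalAtlas h.domChart_mem_maximalAtlas (d.map_source hd)
  refine ⟨fun y ↦ d.symm (τ y), hds.comp (f x) hτs, by simp only [hτ, d.left_inv hd], ?_⟩
  have h1 : ∀ᶠ y in 𝓝 (f x), τ y ∈ d.target :=
    hτs.continuousAt.eventually (by rw [hτ]; exact d.open_target.mem_nhds (d.map_source hd))
  filter_upwards [h1, c.open_source.mem_nhds hc] with y hy hy'
  have h2 : f (d.symm (τ y)) ∈ c.source := h.source_subset_preimage_source (d.map_target hy)
  refine c.injOn h2 hy' ?_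
  rw [hw _ hy]
  simp [τ]

/-- The derivative of a map with a local section is surjective. -/
lemma surjective_modelDeriv_of_section {f : M → N} {x : M} {σ : N → M}
    (hf : ContMDiffAt 𝓘(ℝ, E) 𝓘(ℝ, F) ∞ f x) (hσ : ContMDiffAt 𝓘(ℝ, F) 𝓘(ℝ, E) ∞ σ (f x))
    (hx : σ (f x) = x) (hs : ∀ᶠ y in 𝓝 (f x), f (σ y) = y) :
    Function.Surjective (modelDeriv E F f x) := by
  have h1 : modelDeriv F F (fun y ↦ f (σ y)) (f x) = ContinuousLinearMap.id ℝ F := by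
    rw [modelDeriv_congr (g := fun y ↦ y) hs, modelDeriv_id]
  rw [modelDeriv_comp (h := f) (f := σ) (by rw [hx]; exact hf.mdifferentiableAt (by simp))
    (hσ.mdifferentiableAt (by simp)), hx] at h1
  intro v
  exact ⟨_, congrArg (fun T ↦ T v) h1⟩

/-- The derivative of a submersion is surjective. -/
lemma surjective_of_isSubmersion {f : M → N} (hf : IsSubmersion 𝓘(ℝ, E) 𝓘(ℝ, F) ∞ f) (x : M) :
    Function.Surjective (modelDeriv E F f x) := by
  obtain ⟨σ, hσ, hx, hs⟩ := exists_section_of_isSubmersion hf x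
  exact surjective_modelDeriv_of_section hf.contMDiff.contMDiffAt hσ hx hs

end Coordinates

/-! ### Derivatives of a smooth action -/

section SmoothAction

variable {EG : Type*} [NormedAddCommGroup EG] [NormedSpace ℝ EG] [FiniteDimensional ℝ EG]
  {E : Type*} [NormedAddCommGroup E] [NormedSpace ℝ E] [FiniteDimensional ℝ E]
  {G : Type*} [TopologicalSpace G] [ChartedSpace EG G] [Group G] [LieGroup 𝓘(ℝ, EG) ∞ G]
  {M : Type*} [TopologicalSpace M] [ChartedSpace E M] [IsManifold 𝓘(ℝ, E) ∞ M]
  [MulAction G M] [ContMDiffSMul 𝓘(ℝ, EG) 𝓘(ℝ, E) ∞ G M]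

variable (EG E G) in
/-- The derivative at `1` of the orbit map `a ↦ a • x`. -/
def orbitDeriv (x : M) : EG →L[ℝ] E := modelDeriv EG E (fun a : G ↦ a • x) 1

variable (EG E) in
lemma contMDiff_orbitMap (x : M) : ContMDiff 𝓘(ℝ, EG) 𝓘(ℝ, E) ∞ (fun a : G ↦ a • x) :=
  (contMDiff_smul (I := 𝓘(ℝ, EG)) (I' := 𝓘(ℝ, E))).comp (contMDiff_id.prodMk contMDiff_const)

lemma contMDiff_smul_left (EG : Type*) [NormedAddCommGroup EG] [NormedSpace ℝ EG]
    (E : Type*) [NormedAddCommGroup E] [NormedSpace ℝ E]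
    {G : Type*} [TopologicalSpace G] [ChartedSpace EG G] [Group G]
    (M : Type*) [TopologicalSpace M] [ChartedSpace E M]
    [MulAction G M] [ContMDiffSMul 𝓘(ℝ, EG) 𝓘(ℝ, E) ∞ G M] (a : G) : ContMDiff 𝓘(ℝ, E) 𝓘(ℝ, E) ∞ (fun x : M ↦ a • x) :=
  (contMDiff_smul (I := 𝓘(ℝ, EG)) (I' := 𝓘(ℝ, E))).comp (contMDiff_const.prodMk contMDiff_id)

variable (EG) in
lemma contMDiff_mulLeft (a : G) : ContMDiff 𝓘(ℝ, EG) 𝓘(ℝ, EG) ∞ (fun b : G ↦ a * b) :=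
  contMDiff_mul_left

variable (EG) in
lemma contMDiff_mulRight (a : G) : ContMDiff 𝓘(ℝ, EG) 𝓘(ℝ, EG) ∞ (fun b : G ↦ b * a) :=
  contMDiff_mul_right

lemma bijective_modelDeriv_of_inverse {E' : Type*} [NormedAddCommGroup E'] [NormedSpace ℝ E']
    [FiniteDimensional ℝ E']
    {M₁ : Type*} [TopologicalSpace M₁] [ChartedSpace E' M₁] [IsManifold 𝓘(ℝ, E') ∞ M₁]
    {f f' : M₁ → M₁} (hf : ContMDiff 𝓘(ℝ, E') 𝓘(ℝ, E') ∞ f)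
    (hf' : ContMDiff 𝓘(ℝ, E') 𝓘(ℝ, E') ∞ f') (h1 : ∀ x, f' (f x) = x) (h2 : ∀ x, f (f' x) = x)
    (x : M₁) : Function.Bijective (modelDeriv E' E' f x) := by
  have hd : ∀ y, MDifferentiableAt 𝓘(ℝ, E') 𝓘(ℝ, E') f y := fun y ↦
    (hf y).mdifferentiableAt (by simp)
  have hd' : ∀ y, MDifferentiableAt 𝓘(ℝ, E') 𝓘(ℝ, E') f' y := fun y ↦
    (hf' y).mdifferentiableAt (by simp)
  have e1 := modelDeriv_comp (h := f') (f := f) (x := x) (hd' _) (hd _)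
  have e2 := modelDeriv_comp (h := f) (f := f') (x := f x) (hd _) (hd' _)
  simp only [h1] at e1
  simp only [h2] at e2
  have e3 : modelDeriv E' E' (fun y : M₁ ↦ y) x = ContinuousLinearMap.id ℝ E' := mfderiv_id
  have e4 : modelDeriv E' E' (fun y : M₁ ↦ y) (f x) = ContinuousLinearMap.id ℝ E' := mfderiv_id
  rw [e3] at e1
  rw [e4, h1] at e2
  constructor
  · intro v w hvw
    have hv := congrArg (fun T ↦ T v) e1
    have hw := congrArg (fun T ↦ T w) e1
    simp only [ContinuousLinearMap.id_apply, ContinuousLinearMap.comp_apply] at hv hw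
    rw [hv, hvw, ← hw]
  · exact fun v ↦ ⟨_, (congrArg (fun T ↦ T v) e2).symm⟩

variable (EG) in
lemma bijective_modelDeriv_mulLeft (a p : G) :
    Function.Bijective (modelDeriv EG EG (fun b : G ↦ a * b) p) :=
  bijective_modelDeriv_of_inverse (contMDiff_mulLeft EG a) (contMDiff_mulLeft EG a⁻¹)
    (by simp) (by simp) p

variable (EG) in
lemma bijective_modelDeriv_mulRight (a p : G) :
    Function.Bijective (modelDeriv EG EG (fun b : G ↦ b * a) p) :=
  bijective_modelDeriv_of_inverse (contMDiff_mulRight EG a) (contMDiff_mulRight EG a⁻¹)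
    (by simp) (by simp) p

lemma bijective_modelDeriv_smul (EG : Type*) [NormedAddCommGroup EG] [NormedSpace ℝ EG]
    (E : Type*) [NormedAddCommGroup E] [NormedSpace ℝ E] [FiniteDimensional ℝ E]
    {G : Type*} [TopologicalSpace G] [ChartedSpace EG G] [Group G]
    {M : Type*} [TopologicalSpace M] [ChartedSpace E M] [IsManifold 𝓘(ℝ, E) ∞ M]
    [MulAction G M] [ContMDiffSMul 𝓘(ℝ, EG) 𝓘(ℝ, E) ∞ G M] (a : G) (x : M) :
    Function.Bijective (modelDeriv E E (fun y : M ↦ a • y) x) :=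
  bijective_modelDeriv_of_inverse (contMDiff_smul_left EG E M a) (contMDiff_smul_left EG E M a⁻¹)
    (by simp) (by simp) x

/-- The derivative of the orbit map of `x` at `p` in terms of right translations. -/
lemma modelDeriv_orbitMap_mulRight (p : G) (x : M) (X : EG) :
    modelDeriv EG E (fun a : G ↦ a • x) p (modelDeriv EG EG (fun b : G ↦ b * p) 1 X) =
      orbitDeriv EG E G (p • x) X := by
  have h := modelDeriv_comp (E := EG) (F := EG) (H := E) (h := fun a : G ↦ a • x)
    (f := fun b : G ↦ b * p) (x := 1)
    ((contMDiff_orbitMap EG E x _).mdifferentiableAt (by simp))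
    ((contMDiff_mulRight EG p _).mdifferentiableAt (by simp))
  simp only [mul_smul, one_mul] at h
  exact (congrArg (fun T ↦ T X) h).symm

/-- The derivative of the orbit map of `x` at `p` in terms of left translations. -/
lemma modelDeriv_orbitMap_mulLeft (p : G) (x : M) (X : EG) :
    modelDeriv EG E (fun a : G ↦ a • x) p (modelDeriv EG EG (fun b : G ↦ p * b) 1 X) =
      modelDeriv E E (fun y : M ↦ p • y) x (orbitDeriv EG E G x X) := by
  have h1 := modelDeriv_comp (E := EG) (F := EG) (H := E) (h := fun a : G ↦ a • x)
    (f := fun b : G ↦ p * b) (x := 1)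
    ((contMDiff_orbitMap EG E x _).mdifferentiableAt (by simp))
    ((contMDiff_mulLeft EG p _).mdifferentiableAt (by simp))
  have h2 := modelDeriv_comp (E := EG) (F := E) (H := E) (h := fun y : M ↦ p • y)
    (f := fun b : G ↦ b • x) (x := 1)
    ((contMDiff_smul_left EG E M p _).mdifferentiableAt (by simp))
    ((contMDiff_orbitMap EG E x _).mdifferentiableAt (by simp))
  simp only [mul_smul, mul_one, one_smul] at h1 h2
  rw [h1] at h2
  exact congrArg (fun T ↦ T X) h2

/-- The map `S` is `Ad_a`, obtained by undoing the right translation by `a` after the left one. -/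
lemma surjective_conj (a : G) :
    ∃ S : EG →L[ℝ] EG, Function.Surjective S ∧
      (∀ X, modelDeriv EG EG (fun b : G ↦ b * a) 1 (S X) =
        modelDeriv EG EG (fun b : G ↦ a * b) 1 X) := by
  let e := LinearEquiv.ofBijective (modelDeriv EG EG (fun b : G ↦ b * a) 1).toLinearMap
    (bijective_modelDeriv_mulRight EG a 1)
  refine ⟨e.symm.toLinearMap.toContinuousLinearMap ∘L modelDeriv EG EG (fun b : G ↦ a * b) 1,
    e.symm.surjective.comp (bijective_modelDeriv_mulLeft EG a 1).2, fun X ↦ ?_⟩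
  exact e.apply_symm_apply _

/-- Left translation in `G` corresponds to the diffeomorphism `y ↦ p • y` of `M`. The orbit map
therefore has constant rank, the hypothesis of the constant rank theorem. -/
lemma finrank_range_modelDeriv_orbitMap (p : G) (x : M) :
    Module.finrank ℝ (LinearMap.range (modelDeriv EG E (fun a : G ↦ a • x) p).toLinearMap) =
      Module.finrank ℝ (LinearMap.range (orbitDeriv EG E G x).toLinearMap) := by
  have h : LinearMap.range (modelDeriv EG E (fun a : G ↦ a • x) p).toLinearMap =
      (LinearMap.range (orbitDeriv EG E G x).toLinearMap).map
        (modelDeriv E E (fun y : M ↦ p • y) x).toLinearMap := by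
    ext v
    constructor
    · rintro ⟨X, rfl⟩
      obtain ⟨Y, rfl⟩ := (bijective_modelDeriv_mulLeft EG p 1).2 X
      exact ⟨_, ⟨Y, rfl⟩, (modelDeriv_orbitMap_mulLeft p x Y).symm⟩
    · rintro ⟨_, ⟨Y, rfl⟩, rfl⟩
      exact ⟨_, modelDeriv_orbitMap_mulLeft p x Y⟩
  rw [h]
  exact (Submodule.equivMapOfInjective _ (bijective_modelDeriv_smul EG E p x).1 _).finrank_eq.symm

lemma finrank_range_orbitDeriv_smul (p : G) (x : M) :
    Module.finrank ℝ (LinearMap.range (orbitDeriv EG E G (p • x)).toLinearMap) =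
      Module.finrank ℝ (LinearMap.range (orbitDeriv EG E G x).toLinearMap) := by
  rw [← finrank_range_modelDeriv_orbitMap p x]
  suffices h : LinearMap.range (orbitDeriv EG E G (p • x)).toLinearMap =
      LinearMap.range (modelDeriv EG E (fun a : G ↦ a • x) p).toLinearMap by rw [h]
  ext v
  constructor
  · rintro ⟨X, rfl⟩
    exact ⟨_, modelDeriv_orbitMap_mulRight p x X⟩
  · rintro ⟨X, rfl⟩
    obtain ⟨Y, rfl⟩ := (bijective_modelDeriv_mulRight EG p 1).2 X
    exact ⟨Y, (modelDeriv_orbitMap_mulRight p x Y).symm⟩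

variable (EG E G) in
/-- A factorization of the orbit map of `x` near `1`: the image of `a` is determined by its
coordinates in `ℝ^k`, from which a group element with the same image is smoothly recovered. -/
structure OrbitCoordinates (x : M) (k : ℕ) where
  /-- coordinates of points near the orbit -/
  coord : M → EuclideanSpace ℝ (Fin k)
  /-- the group element with given coordinates -/
  lift : EuclideanSpace ℝ (Fin k) → G
  /-- the domain of the coordinates -/
  dom : Set M
  /-- a neighbourhood of `1` -/
  nhd : Set G
  /-- the range of the coordinates -/
  ran : Set (EuclideanSpace ℝ (Fin k))
  isOpen_dom : IsOpen dom
  contMDiffOn_coord : ContMDiffOn 𝓘(ℝ, E) (𝓡 k) ∞ coord dom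
  isOpen_nhd : IsOpen nhd
  one_mem : 1 ∈ nhd
  smul_mem : ∀ a ∈ nhd, a • x ∈ dom
  isOpen_ran : IsOpen ran
  contMDiffOn_lift : ContMDiffOn (𝓡 k) 𝓘(ℝ, EG) ∞ lift ran
  mapsTo_lift : Set.MapsTo lift ran nhd
  coord_mem : ∀ a ∈ nhd, coord (a • x) ∈ ran
  coord_lift : ∀ r ∈ ran, coord (lift r • x) = r
  lift_coord : ∀ a ∈ nhd, lift (coord (a • x)) • x = a • x

variable (EG E) in
-- The constant rank theorem for the orbit map near `1`: `coord` is a linear map after a chart of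
-- `M`, and `lift` is the resulting section carried back to `G`. The conditions on `nhd` and `ran`
-- keep all points where the charts are valid.
lemma nonempty_orbitCoordinates (x : M) {k : ℕ}
    (hk : Module.finrank ℝ (LinearMap.range (orbitDeriv EG E G x).toLinearMap) = k) :
    Nonempty (OrbitCoordinates EG E G x k) := by
  have : IsManifold 𝓘(ℝ, EG) ∞ G := inferInstance
  let f : G → M := fun a ↦ a • x
  have hf : ContMDiff 𝓘(ℝ, EG) 𝓘(ℝ, E) ∞ f := contMDiff_orbitMap EG E x
  let ψ := extChartAt 𝓘(ℝ, EG) (1 : G)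
  let φ := extChartAt 𝓘(ℝ, E) x
  let s : Set EG := ψ.target ∩ ψ.symm ⁻¹' (f ⁻¹' φ.source)
  have hs : IsOpen s := isOpen_localRep_domain hf.continuous 1 x
  have h1 : ψ.symm (ψ 1) = 1 := extChartAt_to_inv (I := 𝓘(ℝ, EG)) (1 : G)
  have hψ1 : ψ 1 ∈ ψ.target := mem_extChartAt_target (1 : G)
  have h1s : ψ 1 ∈ s := by
    refine ⟨hψ1, ?_⟩
    simp only [Set.mem_preimage, h1, f, one_smul]
    exact mem_extChartAt_source x
  have hrank : ∀ z ∈ s, Module.finrank ℝ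
      (LinearMap.range (fderiv ℝ (localRep EG E f 1 x) z).toLinearMap) = k := by
    intro z hz
    rw [← hk, ← finrank_range_modelDeriv_orbitMap (ψ.symm z) x]
    have hmd : MDifferentiableAt 𝓘(ℝ, EG) 𝓘(ℝ, E) f (ψ.symm z) :=
      (hf _).mdifferentiableAt (by simp)
    have hz2 : localRep EG E f 1 x z ∈ φ.target := φ.map_source hz.2
    have hcomm := modelDeriv_chartDeriv (E := EG) (F := E) (y₀ := x) hz.1 hmd hz.2
    have h2 : LinearMap.range (modelDeriv EG E f (ψ.symm z)).toLinearMap =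
        (LinearMap.range (fderiv ℝ (localRep EG E f 1 x) z).toLinearMap).map
          (chartDerivEquiv x hz2).toLinearMap := by
      ext v
      constructor
      · rintro ⟨X, rfl⟩
        obtain ⟨Y, rfl⟩ := (chartDerivEquiv (1 : G) hz.1).surjective X
        exact ⟨_, ⟨Y, rfl⟩, (hcomm Y).symm⟩
      · rintro ⟨_, ⟨Y, rfl⟩, rfl⟩
        exact ⟨_, hcomm Y⟩
    change _ = Module.finrank ℝ (LinearMap.range (modelDeriv EG E f (ψ.symm z)).toLinearMap)
    rw [h2]
    exact (Submodule.equivMapOfInjective _ (chartDerivEquiv x hz2).injective _).finrank_eq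
  obtain ⟨L, σ, N, B, hN, h1N, hNs, hB, hσ, hσN, hNB, -, hLσ, hσL⟩ :=
    exists_section_of_constant_rank hs h1s (contDiffOn_localRep hf 1 x) hrank
  have hNG : ∀ a ∈ ψ.source ∩ ψ ⁻¹' N, a • x ∈ φ.source ∧
      localRep EG E f 1 x (ψ a) = φ (a • x) := by
    intro a ha
    have h3 := (hNs ha.2).2
    simp only [Set.mem_preimage, ψ.left_inv ha.1, f] at h3
    refine ⟨h3, ?_⟩
    simp only [localRep]
    rw [ψ.left_inv ha.1]
  have hσs : ∀ r ∈ B, ψ.symm (σ r) ∈ ψ.source ∩ ψ ⁻¹' N := by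
    intro r hr
    have h3 := (hNs (hσN hr)).1
    exact ⟨ψ.map_target h3, by rw [Set.mem_preimage, ψ.right_inv h3]; exact hσN hr⟩
  refine ⟨⟨fun y ↦ L (φ y), fun r ↦ ψ.symm (σ r), φ.source, ψ.source ∩ ψ ⁻¹' N, B,
    isOpen_extChartAt_source x, ?_, ?_, ⟨mem_extChartAt_source (1 : G), h1N⟩,
    fun a ha ↦ (hNG a ha).1, hB, ?_, hσs, ?_, ?_, ?_⟩⟩
  · intro y hy
    exact (L.contDiff.contMDiff.contMDiffAt.comp y (contMDiffAt_chart hy)).contMDiffWithinAt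
  · exact (continuousOn_extChartAt (1 : G)).isOpen_inter_preimage
      (isOpen_extChartAt_source (1 : G)) hN
  · intro r hr
    have h3 := (hNs (hσN hr)).1
    exact ((contMDiffAt_chart_symm h3).comp r
      (hσ.contDiffAt (hB.mem_nhds hr)).contMDiffAt).contMDiffWithinAt
  · intro a ha
    have h4 := hNB _ ha.2
    rwa [(hNG a ha).2] at h4
  · exact hLσ
  · intro a ha
    have h4 := hσL _ ha.2
    rw [(hNG a ha).2] at h4
    have h5 := hNB _ ha.2
    rw [(hNG a ha).2] at h5
    exact φ.injOn (hNG _ (hσs _ h5)).1 (hNG a ha).1 h4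

/-- The kernel of the derivative of the orbit map is determined by the isotropy group. -/
lemma ker_orbitDeriv_le {x y : M} (h : stabilizer G x ≤ stabilizer G y) {X : EG}
    (hX : orbitDeriv EG E G x X = 0) : orbitDeriv EG E G y X = 0 := by
  obtain ⟨⟨h', σ, O, N, B, hO, hh, hN, h1N, hNO, hB, hσ, -, hNB, -, hfac⟩⟩ :=
    nonempty_orbitCoordinates EG E (G := G) x rfl
  -- The elements `a` and `σ (h' (a • x))` move `x` to the same point, so they differ by an element
  -- of `G_x`, hence of `G_y`. Near `1` the orbit map of `y` is thus a smooth function of that of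
  -- `x`, and the chain rule applies.
  have hev : (fun a : G ↦ a • y) =ᶠ[𝓝 1] fun a ↦ (fun z : M ↦ σ (h' z) • y) (a • x) := by
    filter_upwards [hN.mem_nhds h1N] with a ha
    have h1 := hfac a ha
    have h2 : a⁻¹ * σ (h' (a • x)) ∈ stabilizer G x := by
      rw [mem_stabilizer_iff, mul_smul, h1, inv_smul_smul]
    have h3 := mem_stabilizer_iff.1 (h h2)
    rw [mul_smul, inv_smul_eq_iff] at h3
    exact h3.symm
  have hOx : (1 : G) • x ∈ O := hNO 1 h1N
  have hd : ContMDiffAt 𝓘(ℝ, E) 𝓘(ℝ, E) ∞ (fun z : M ↦ σ (h' z) • y) ((1 : G) • x) := by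
    have e1 := hh.contMDiffAt (hO.mem_nhds hOx)
    have e2 := hσ.contMDiffAt (hB.mem_nhds (hNB 1 h1N))
    exact (contMDiff_orbitMap EG E y _).comp _ (e2.comp _ e1)
  have h2 := modelDeriv_comp (E := EG) (F := E) (H := E) (h := fun z : M ↦ σ (h' z) • y)
    (f := fun a : G ↦ a • x) (x := 1) (hd.mdifferentiableAt (by simp))
    ((contMDiff_orbitMap EG E x _).mdifferentiableAt (by simp))
  rw [← modelDeriv_congr hev] at h2
  have h3 := congrArg (fun T ↦ T X) h2
  change orbitDeriv EG E G y X = modelDeriv E E (fun z : M ↦ σ (h' z) • y) ((1 : G) • x)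
    (orbitDeriv EG E G x X) at h3
  rw [h3, hX, map_zero]

variable (EG E) in
/-- The derivative of the orbit map, read in the preferred chart at `x₀`. -/
def coordOrbitDeriv (G : Type*) [TopologicalSpace G] [ChartedSpace EG G] [Group G] [MulAction G M]
    (x₀ : M) (y : E) : EG →L[ℝ] E :=
  chartDerivInv x₀ ((extChartAt 𝓘(ℝ, E) x₀).symm y) ∘L
    orbitDeriv EG E G ((extChartAt 𝓘(ℝ, E) x₀).symm y)

/-- The action, read in charts, as a function of the group element and the point. -/
def actionRep (G : Type*) [TopologicalSpace G] [ChartedSpace EG G] [Group G] [MulAction G M]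
    (x₀ : M) (y : E) (s : EG) : E :=
  extChartAt 𝓘(ℝ, E) x₀
    ((extChartAt 𝓘(ℝ, EG) (1 : G)).symm s • (extChartAt 𝓘(ℝ, E) x₀).symm y)

lemma contDiffAt_actionRep {x₀ : M} {y : E} (hy : y ∈ (extChartAt 𝓘(ℝ, E) x₀).target) :
    ContDiffAt ℝ ∞ (fun z : E × EG ↦ actionRep G x₀ z.1 z.2)
      (y, extChartAt 𝓘(ℝ, EG) (1 : G) 1) := by
  have : IsManifold 𝓘(ℝ, EG) ∞ G := inferInstance
  rw [← contMDiffAt_iff_contDiffAt]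
  have h1 : ContMDiffAt 𝓘(ℝ, E × EG) 𝓘(ℝ, E) ∞
      (fun z : E × EG ↦ (extChartAt 𝓘(ℝ, E) x₀).symm z.1) (y, extChartAt 𝓘(ℝ, EG) (1 : G) 1) :=
    ContMDiffAt.comp (I' := 𝓘(ℝ, E)) _ (contMDiffAt_chart_symm hy) contDiff_fst.contMDiff.contMDiffAt
  have h2 : ContMDiffAt 𝓘(ℝ, E × EG) 𝓘(ℝ, EG) ∞
      (fun z : E × EG ↦ (extChartAt 𝓘(ℝ, EG) (1 : G)).symm z.2)
      (y, extChartAt 𝓘(ℝ, EG) (1 : G) 1) :=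
    ContMDiffAt.comp (I' := 𝓘(ℝ, EG)) _ (contMDiffAt_chart_symm (mem_extChartAt_target (1 : G)))
      contDiff_snd.contMDiff.contMDiffAt
  have h3 : ContMDiffAt 𝓘(ℝ, E × EG) 𝓘(ℝ, E) ∞ (fun z : E × EG ↦
      (extChartAt 𝓘(ℝ, EG) (1 : G)).symm z.2 • (extChartAt 𝓘(ℝ, E) x₀).symm z.1)
      (y, extChartAt 𝓘(ℝ, EG) (1 : G) 1) :=
    ContMDiffAt.comp _ (contMDiff_smul (I := 𝓘(ℝ, EG)) (I' := 𝓘(ℝ, E))).contMDiffAt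
      (h2.prodMk h1)
  refine ContMDiffAt.comp (I' := 𝓘(ℝ, E)) _ (contMDiffAt_chart ?_) h3
  simp only [extChartAt_to_inv, one_smul]
  exact (extChartAt 𝓘(ℝ, E) x₀).map_target hy

/-- As a partial derivative of the jointly smooth action in the group variable, the family of orbit
derivatives depends smoothly on the point. -/
lemma coordOrbitDeriv_eq {x₀ : M} {y : E} (hy : y ∈ (extChartAt 𝓘(ℝ, E) x₀).target) :
    coordOrbitDeriv EG E G x₀ y =
      fderiv ℝ (actionRep G x₀ y) (extChartAt 𝓘(ℝ, EG) (1 : G) 1) := by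
  have : IsManifold 𝓘(ℝ, EG) ∞ G := inferInstance
  ext X
  set x := (extChartAt 𝓘(ℝ, E) x₀).symm y
  have h1 : (extChartAt 𝓘(ℝ, EG) (1 : G)).symm (extChartAt 𝓘(ℝ, EG) (1 : G) 1) = 1 :=
    extChartAt_to_inv (I := 𝓘(ℝ, EG)) (1 : G)
  have hx : x ∈ (extChartAt 𝓘(ℝ, E) x₀).source := (extChartAt 𝓘(ℝ, E) x₀).map_target hy
  have h2 := modelDeriv_chartDeriv (E := EG) (F := E) (f := fun a : G ↦ a • x) (x₀ := 1) (y₀ := x₀)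
    (mem_extChartAt_target (1 : G)) ((contMDiff_orbitMap EG E x _).mdifferentiableAt (by simp))
    (by rw [h1, one_smul]; exact hx) X
  rw [chartDeriv_self, h1] at h2
  have h3 : localRep EG E (fun a : G ↦ a • x) 1 x₀ (extChartAt 𝓘(ℝ, EG) (1 : G) 1) = y := by
    rw [localRep, h1, one_smul]
    exact (extChartAt 𝓘(ℝ, E) x₀).right_inv hy
  rw [h3] at h2
  change chartDerivInv x₀ x (modelDeriv EG E (fun a : G ↦ a • x) 1 X) = _
  rw [ContinuousLinearMap.id_apply] at h2
  rw [h2]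
  exact congrArg (fun T ↦ T (fderiv ℝ (localRep EG E (fun a : G ↦ a • x) 1 x₀)
    (extChartAt 𝓘(ℝ, EG) (1 : G) 1) X)) (chartDerivInv_comp_chartDeriv hy)

lemma contDiffAt_coordOrbitDeriv {x₀ : M} {y : E} (hy : y ∈ (extChartAt 𝓘(ℝ, E) x₀).target) :
    ContDiffAt ℝ ∞ (coordOrbitDeriv EG E G x₀) y := by
  have h1 : ContDiffAt ℝ ∞ (Function.uncurry (actionRep G x₀ : E → EG → E))
      (y, extChartAt 𝓘(ℝ, EG) (1 : G) 1) := contDiffAt_actionRep hy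
  have h2 : ContDiffAt ℝ ∞
      (fun y ↦ fderiv ℝ (actionRep G x₀ y) (extChartAt 𝓘(ℝ, EG) (1 : G) 1)) y :=
    h1.fderiv contDiffAt_const (by simp)
  refine h2.congr_of_eventuallyEq ?_
  filter_upwards [target_mem_nhds hy] with z hz using coordOrbitDeriv_eq hz

lemma range_coordOrbitDeriv_finrank {x₀ : M} {y : E} (hy : y ∈ (extChartAt 𝓘(ℝ, E) x₀).target) :
    Module.finrank ℝ (LinearMap.range (coordOrbitDeriv EG E G x₀ y).toLinearMap) =
      Module.finrank ℝ (LinearMap.range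
        (orbitDeriv EG E G ((extChartAt 𝓘(ℝ, E) x₀).symm y)).toLinearMap) := by
  have h : LinearMap.range (coordOrbitDeriv EG E G x₀ y).toLinearMap =
      (LinearMap.range (orbitDeriv EG E G ((extChartAt 𝓘(ℝ, E) x₀).symm y)).toLinearMap).map
        (chartDerivEquiv x₀ hy).symm.toLinearMap := by
    ext v
    constructor
    · rintro ⟨X, rfl⟩
      exact ⟨_, ⟨X, rfl⟩, rfl⟩
    · rintro ⟨_, ⟨X, rfl⟩, rfl⟩
      exact ⟨X, rfl⟩
  rw [h]
  exact (Submodule.equivMapOfInjective _ (chartDerivEquiv x₀ hy).symm.injective _).finrank_eq.symm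

/-- The rank of the orbit map is lower semicontinuous. -/
lemma eventually_le_finrank_range_orbitDeriv (x : M) :
    ∀ᶠ y in 𝓝 x, Module.finrank ℝ (LinearMap.range (orbitDeriv EG E G x).toLinearMap) ≤
      Module.finrank ℝ (LinearMap.range (orbitDeriv EG E G y).toLinearMap) := by
  set φ := extChartAt 𝓘(ℝ, E) x
  have hx : φ x ∈ φ.target := mem_extChartAt_target x
  have hinv : φ.symm (φ x) = x := extChartAt_to_inv (I := 𝓘(ℝ, E)) x
  set k := Module.finrank ℝ (LinearMap.range (orbitDeriv EG E G x).toLinearMap) with hk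
  have hk' : Module.finrank ℝ (LinearMap.range (coordOrbitDeriv EG E G x (φ x)).toLinearMap) = k := by
    rw [range_coordOrbitDeriv_finrank hx, hinv]
  -- Having rank at least `k` is an open condition on linear maps.
  have hopen : ∀ᶠ z in 𝓝 (φ x), coordOrbitDeriv EG E G x z ∈
      {f : EG →L[ℝ] E | (k : Cardinal) ≤ (f : EG →ₗ[ℝ] E).rank} := by
    refine (contDiffAt_coordOrbitDeriv hx).continuousAt.eventually
      ((isOpen_setOfPred_nat_le_rank k).mem_nhds ?_)
    rw [← hk']
    exact Module.finrank_eq_rank ℝ _ |>.le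
  have hcont : Tendsto φ (𝓝 x) (𝓝 (φ x)) := continuousAt_extChartAt x
  filter_upwards [hcont.eventually hopen, extChartAt_source_mem_nhds (I := 𝓘(ℝ, E)) x]
    with y hy hys
  have h1 := range_coordOrbitDeriv_finrank (EG := EG) (G := G) (φ.map_source hys)
  rw [φ.left_inv hys] at h1
  rw [← h1]
  have h2 : (k : Cardinal) ≤ (coordOrbitDeriv EG E G x (φ y)).toLinearMap.rank := hy
  rw [LinearMap.rank, ← Module.finrank_eq_rank] at h2
  exact_mod_cast h2

/-- Near a point of a principal orbit, all orbits have the same dimension. -/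
lemma eventually_finrank_eq_of_mem_regularPart {x : M} (hx : x ∈ regularPart G M) :
    ∀ᶠ y in 𝓝 x, Module.finrank ℝ (LinearMap.range (orbitDeriv EG E G y).toLinearMap) =
      Module.finrank ℝ (LinearMap.range (orbitDeriv EG E G x).toLinearMap) := by
  filter_upwards [hx, eventually_le_finrank_range_orbitDeriv (EG := EG) (G := G) (E := E) x]
    with y ⟨a, ha⟩ hy
  refine le_antisymm ?_ hy
  -- Passing to the translate `a • y`, whose isotropy group contains that of `x`, does not change
  -- the rank; the larger kernel bounds it from above.
  rw [← finrank_range_orbitDeriv_smul (EG := EG) (E := E) a y]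
  have h1 := (orbitDeriv EG E G x).toLinearMap.finrank_range_add_finrank_ker
  have h2 := (orbitDeriv EG E G (a • y)).toLinearMap.finrank_range_add_finrank_ker
  have h3 : LinearMap.ker (orbitDeriv EG E G x).toLinearMap ≤
      LinearMap.ker (orbitDeriv EG E G (a • y)).toLinearMap := fun X hX ↦ ker_orbitDeriv_le ha hX
  have h4 := Submodule.finrank_mono h3
  omega

end SmoothAction

/-! ### The limit metric -/

section DeformedField

variable {EG : Type*} [NormedAddCommGroup EG] [NormedSpace ℝ EG] [FiniteDimensional ℝ EG]
  {E : Type*} [NormedAddCommGroup E] [NormedSpace ℝ E] [FiniteDimensional ℝ E]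
  {G : Type*} [TopologicalSpace G] [ChartedSpace EG G] [Group G] [LieGroup 𝓘(ℝ, EG) ∞ G]
  {M : Type*} [TopologicalSpace M] [ChartedSpace E M] [IsManifold 𝓘(ℝ, E) ∞ M]
  [MulAction G M] [ContMDiffSMul 𝓘(ℝ, EG) 𝓘(ℝ, E) ∞ G M]

variable (EG G) in
/-- The orthogonal projection onto the tangent spaces of the orbits. -/
def orbitProjection (g : M → E →L[ℝ] E →L[ℝ] ℝ) (x : M) : E →L[ℝ] E :=
  Classical.epsilon (IsRangeProjection (g x) (orbitDeriv EG E G x))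

lemma isRangeProjection_orbitProjection {g : M → E →L[ℝ] E →L[ℝ] ℝ} {x : M}
    (hg : IsScalarProduct (g x)) :
    IsRangeProjection (g x) (orbitDeriv EG E G x) (orbitProjection EG G g x) :=
  Classical.epsilon_spec (exists_isRangeProjection hg _)

variable (G) in
/-- The rescaled deformation of the field of scalar products `g` and, for `l = 0`, its limit. -/
def deformedField (b : EG →L[ℝ] EG →L[ℝ] ℝ) (g : M → E →L[ℝ] E →L[ℝ] ℝ) (l : ℝ) (x : M) :
    E →L[ℝ] E →L[ℝ] ℝ :=
  deformedForm b (g x) (orbitDeriv EG E G x) (orbitProjection EG G g x) l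

variable (EG E G M) in
/-- The set of points near which all orbits have the same dimension. -/
def constantRankSet : Set M :=
  {x | ∀ᶠ y in 𝓝 x, Module.finrank ℝ (LinearMap.range (orbitDeriv EG E G y).toLinearMap) =
      Module.finrank ℝ (LinearMap.range (orbitDeriv EG E G x).toLinearMap)}

lemma isOpen_constantRankSet : IsOpen (constantRankSet EG E G M) := by
  rw [isOpen_iff_mem_nhds]
  intro x hx
  have hx' : ∀ᶠ y in 𝓝 x, Module.finrank ℝ (LinearMap.range (orbitDeriv EG E G y).toLinearMap) =
      Module.finrank ℝ (LinearMap.range (orbitDeriv EG E G x).toLinearMap) := hx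
  filter_upwards [eventually_eventually_nhds.2 hx', hx'] with y hy hyx
  filter_upwards [hy] with z hz
  rw [hz, hyx]

variable {b : EG →L[ℝ] EG →L[ℝ] ℝ} {g : M → E →L[ℝ] E →L[ℝ] ℝ} {l : ℝ}

lemma isScalarProduct_deformedField (hb : IsScalarProduct b) {x : M} (hg : IsScalarProduct (g x)) :
    IsScalarProduct (deformedField G b g l x) :=
  isScalarProduct_deformedForm hb hg (isRangeProjection_orbitProjection hg)

lemma isScalarProduct_coordForm (hg : ∀ x, IsScalarProduct (g x)) {x₀ : M} {y : E}
    (hy : y ∈ (extChartAt 𝓘(ℝ, E) x₀).target) : IsScalarProduct (coordForm g x₀ y) :=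
  (hg _).bilinearComp (chartDerivEquiv x₀ hy).injective

/-- The orthogonal projection onto the tangent spaces of the orbits, read in a chart. -/
lemma exists_isRangeProjection_coordForm (hg : ∀ x, IsScalarProduct (g x)) (x₀ : M) :
    ∃ P : E → E →L[ℝ] E, ∀ y ∈ (extChartAt 𝓘(ℝ, E) x₀).target,
      IsRangeProjection (coordForm g x₀ y) (coordOrbitDeriv EG E G x₀ y) (P y) := by
  refine ⟨fun y ↦ Classical.epsilon
    (IsRangeProjection (coordForm g x₀ y) (coordOrbitDeriv EG E G x₀ y)), fun y hy ↦ ?_⟩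
  exact Classical.epsilon_spec (exists_isRangeProjection (isScalarProduct_coordForm hg hy) _)

/-- The deformed form is natural under the isomorphism given by the chart, so it can be computed
from chart data, on which the smoothness statements for normed spaces apply. -/
lemma coordForm_deformedField (hb : IsScalarProduct b) (hg : ∀ x, IsScalarProduct (g x))
    {x₀ : M} {y : E} (hy : y ∈ (extChartAt 𝓘(ℝ, E) x₀).target) {P : E →L[ℝ] E}
    (hP : IsRangeProjection (coordForm g x₀ y) (coordOrbitDeriv EG E G x₀ y) P) :
    coordForm (deformedField G b g l) x₀ y =
      deformedForm b (coordForm g x₀ y) (coordOrbitDeriv EG E G x₀ y) P l :=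
  (deformedForm_bilinearComp hb (hg _) (isRangeProjection_orbitProjection (hg _))
    (chartDerivEquiv x₀ hy) hP).symm

/-- The deformations depend smoothly on the point and the parameter. -/
lemma contDiffAt_coordForm_deformedField (hb : IsScalarProduct b)
    (hg : ∀ x, IsScalarProduct (g x)) {x₀ : M}
    (hgs : ∀ y ∈ (extChartAt 𝓘(ℝ, E) x₀).target, ContDiffAt ℝ ∞ (coordForm g x₀) y) {y : E}
    (hy : y ∈ (extChartAt 𝓘(ℝ, E) x₀).target)
    (hyr : (extChartAt 𝓘(ℝ, E) x₀).symm y ∈ constantRankSet EG E G M) (l : ℝ) :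
    ContDiffAt ℝ ∞ (fun z : ℝ × E ↦ coordForm (deformedField G b g z.1) x₀ z.2) (l, y) := by
  obtain ⟨P, hP⟩ := exists_isRangeProjection_coordForm (EG := EG) (G := G) hg x₀
  have ht := target_mem_nhds hy
  have hAs : ContDiffAt ℝ ∞ (coordOrbitDeriv EG E G x₀) y := contDiffAt_coordOrbitDeriv hy
  have hr : ∀ᶠ z in 𝓝 y, Module.finrank ℝ
      (LinearMap.range (coordOrbitDeriv EG E G x₀ z).toLinearMap) =
      Module.finrank ℝ (LinearMap.range (coordOrbitDeriv EG E G x₀ y).toLinearMap) := by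
    have h1 := (contMDiffAt_chart_symm hy).continuousAt.eventually hyr
    filter_upwards [h1, ht] with z hz hzt
    rw [range_coordOrbitDeriv_finrank hzt, range_coordOrbitDeriv_finrank hy, hz]
  have hPs : ContDiffAt ℝ ∞ P y := by
    refine contDiffAt_rangeProjection (hgs y hy) hAs ?_ hr ?_
    · filter_upwards [ht] with z hz using isScalarProduct_coordForm hg hz
    · filter_upwards [ht] with z hz using hP z hz
  have hsnd : ContDiffAt ℝ ∞ (Prod.snd : ℝ × E → E) (l, y) := contDiffAt_snd
  have h := contDiffAt_deformedForm (x := (l, y)) (n := ∞) (b := b) (l := Prod.fst)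
    (g := fun z : ℝ × E ↦ coordForm g x₀ z.2) (A := fun z : ℝ × E ↦ coordOrbitDeriv EG E G x₀ z.2)
    (P := fun z : ℝ × E ↦ P z.2)
    (ContDiffAt.comp (g := coordForm g x₀) (l, y) (hgs y hy) hsnd) (ContDiffAt.comp (g := coordOrbitDeriv EG E G x₀) (l, y) hAs hsnd)
    (ContDiffAt.comp (g := P) (l, y) hPs hsnd) contDiffAt_fst hb (isScalarProduct_coordForm hg hy) (hP y hy)
  refine h.congr_of_eventuallyEq ?_
  filter_upwards [continuousAt_snd.eventually ht] with z hz
  exact coordForm_deformedField hb hg hz (hP _ hz)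

/-- The deformations are smooth. -/
lemma contDiffAt_coordForm_deformedField_const (hb : IsScalarProduct b)
    (hg : ∀ x, IsScalarProduct (g x))
    (hgs : ∀ x₀ : M, ∀ y ∈ (extChartAt 𝓘(ℝ, E) x₀).target, ContDiffAt ℝ ∞ (coordForm g x₀) y)
    {x x₀ : M} (hx₀ : x ∈ (extChartAt 𝓘(ℝ, E) x₀).source)
    (hx : x ∈ constantRankSet EG E G M) (l : ℝ) :
    ContDiffAt ℝ ∞ (coordForm (deformedField G b g l) x₀) (extChartAt 𝓘(ℝ, E) x₀ x) := by
  have h := contDiffAt_coordForm_deformedField (G := G) hb hg (hgs x₀)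
    ((extChartAt 𝓘(ℝ, E) x₀).map_source hx₀)
    (by rwa [(extChartAt 𝓘(ℝ, E) x₀).left_inv hx₀]) l
  exact ContDiffAt.comp (g := fun z : ℝ × E ↦ coordForm (deformedField G b g z.1) x₀ z.2)
    (f := fun y : E ↦ ((l, y) : ℝ × E)) _ h (contDiffAt_const.prodMk contDiffAt_id)

/-- The deformations converge in all `C^p`-topologies. -/
lemma tendstoInCp_deformedField (hb : IsScalarProduct b)
    (hg : ∀ x, IsScalarProduct (g x))
    (hgs : ∀ x₀ : M, ∀ y ∈ (extChartAt 𝓘(ℝ, E) x₀).target, ContDiffAt ℝ ∞ (coordForm g x₀) y)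
    {U : Set M} (hU : closure U ⊆ constantRankSet EG E G M)
    {T : ℝ → ∀ x : M, TangentSpace 𝓘(ℝ, E) x → TangentSpace 𝓘(ℝ, E) x → ℝ}
    (hT : ∀ l ≠ 0, ∀ (x : M) (v w : E), T l x v w = deformedField G b g l x v w) (p : ℕ) :
    TendstoInCp p U T (fun x v w ↦ deformedField G b g 0 x v w) := by
  intro x₀ a a'
  set φ := extChartAt 𝓘(ℝ, E) x₀
  have hcomp : ∀ l ≠ 0, tensorComponent (T l) x₀ a a' =
      fun y ↦ coordForm (deformedField G b g l) x₀ y a a' := by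
    intro l hl
    funext y
    exact hT l hl _ _ _
  have hcomp0 : tensorComponent
      (fun (x : M) (v w : TangentSpace 𝓘(ℝ, E) x) ↦ deformedField G b g 0 x v w) x₀ a a' =
      fun y ↦ coordForm (deformedField G b g 0) x₀ y a a' := rfl
  have hsm : ∀ l, ContDiffOn ℝ p (fun y ↦ coordForm (deformedField G b g l) x₀ y a a')
      (φ '' (φ.source ∩ U)) := by
    rintro l _ ⟨x, hx, rfl⟩
    have h := contDiffAt_coordForm_deformedField_const (G := G) hb hg hgs hx.1 (hU (subset_closure hx.2)) l
    exact ((contDiffAt_form_iff.1 h a a').of_le (by exact_mod_cast le_top)).contDiffWithinAt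
  refine ⟨fun l hl ↦ ?_, ?_, fun K hK hKs j hj ↦ ?_⟩
  · rw [hcomp l hl.ne']
    exact hsm l
  · exact hsm 0
  · let O : Set E := φ.target ∩ φ.symm ⁻¹' constantRankSet EG E G M
    have hO : IsOpen O := (continuousOn_extChartAt_symm x₀).isOpen_inter_preimage
      (isOpen_extChartAt_target x₀) isOpen_constantRankSet
    have hf : ContDiffOn ℝ ∞ (Function.uncurry
        fun (l : ℝ) (y : E) ↦ coordForm (deformedField G b g l) x₀ y a a') (Set.univ ×ˢ O) := by
      rintro ⟨l, y⟩ ⟨-, hy, hyr⟩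
      exact (contDiffAt_form_iff.1
        (contDiffAt_coordForm_deformedField (G := G) hb hg (hgs x₀) hy hyr l) a a').contDiffWithinAt
    -- `K ∩ U` need not be compact; its enlargement by the closure is, and it still lies where the
    -- rank is locally constant.
    have hK' : IsCompact (φ '' (K ∩ closure U)) :=
      (hK.inter_right isClosed_closure).image_of_continuousOn
        ((continuousOn_extChartAt x₀).mono fun x hx ↦ hKs hx.1)
    have hKO : φ '' (K ∩ closure U) ⊆ O := by
      rintro _ ⟨x, hx, rfl⟩
      refine ⟨φ.map_source (hKs hx.1), ?_⟩
      rw [Set.mem_preimage, φ.left_inv (hKs hx.1)]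
      exact hU hx.2
    have h := ((tendstoUniformlyOn_iteratedFDeriv hO hf j hK' hKO).mono
      (Set.image_mono (Set.inter_subset_inter_right K subset_closure)))
    rw [hcomp0]
    have h2 : TendstoUniformlyOn (fun l ↦ iteratedFDeriv ℝ j
        (fun y ↦ coordForm (deformedField G b g l) x₀ y a a'))
        (iteratedFDeriv ℝ j (fun y ↦ coordForm (deformedField G b g 0) x₀ y a a')) (𝓝[>] 0)
        (φ '' (K ∩ U)) := fun u hu ↦ (h u hu).filter_mono nhdsWithin_le_nhds
    -- The given tensors are the deformed fields only for `l ≠ 0`, which suffices for the one-sided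
    -- limit.
    refine h2.congr ?_
    filter_upwards [self_mem_nhdsWithin] with l hl y _
    have hl' : l ≠ 0 := ne_of_gt hl
    simp only [hcomp l hl']

/-- The limit metric is invariant. -/
lemma deformedField_zero_smul (hb : IsScalarProduct b) (hg : ∀ x, IsScalarProduct (g x)) (a : G)
    (hba : ∀ S : EG →L[ℝ] EG, (∀ X, modelDeriv EG EG (fun c : G ↦ c * a) 1 (S X) =
      modelDeriv EG EG (fun c : G ↦ a * c) 1 X) → ∀ X Y, b (S X) (S Y) = b X Y) (x : M)
    (hga : ∀ v w, g (a • x) (modelDeriv E E (fun y : M ↦ a • y) x v)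
      (modelDeriv E E (fun y : M ↦ a • y) x w) = g x v w) (v w : E) :
    deformedField G b g 0 (a • x) (modelDeriv E E (fun y : M ↦ a • y) x v)
      (modelDeriv E E (fun y : M ↦ a • y) x w) = deformedField G b g 0 x v w := by
  -- `Ad_a` preserves `b`, the differential of `a` preserves `g`, and together they intertwine the
  -- orbit derivatives at `x` and `a • x`.
  obtain ⟨S, hS, hSa⟩ := surjective_conj (EG := EG) a
  refine deformedForm_zero_map hb (hg x) (isRangeProjection_orbitProjection (hg x)) hb
    (hg _) (isRangeProjection_orbitProjection (hg _)) S hS (hba S hSa) _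
    (bijective_modelDeriv_smul EG E a x).1 hga (fun X ↦ ?_) v w
  rw [← modelDeriv_orbitMap_mulRight, hSa, modelDeriv_orbitMap_mulLeft]

end DeformedField

/-! ### The rescaled Cheeger deformation -/

section RescaledMetric

variable {EG : Type*} [NormedAddCommGroup EG] [NormedSpace ℝ EG] [FiniteDimensional ℝ EG]
  {G : Type*} [TopologicalSpace G] [ChartedSpace EG G] [Group G] [LieGroup 𝓘(ℝ, EG) ∞ G]

/-- A Riemannian metric on a Lie group, as a field of bilinear forms on the model space. -/
def groupForm
    (gbi : ContMDiffRiemannianMetric 𝓘(ℝ, EG) ∞ EG (fun p : G ↦ TangentSpace 𝓘(ℝ, EG) p))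
    (p : G) : EG →L[ℝ] EG →L[ℝ] ℝ := gbi.inner p

lemma isScalarProduct_groupForm
    (gbi : ContMDiffRiemannianMetric 𝓘(ℝ, EG) ∞ EG (fun p : G ↦ TangentSpace 𝓘(ℝ, EG) p))
    (p : G) : IsScalarProduct (groupForm gbi p) :=
  ⟨gbi.symm p, gbi.pos p⟩

variable {gbi : ContMDiffRiemannianMetric 𝓘(ℝ, EG) ∞ EG (fun p : G ↦ TangentSpace 𝓘(ℝ, EG) p)}

lemma IsBiinvariant.mulRight (h : IsBiinvariant gbi) (p : G) (X Y : EG) :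
    groupForm gbi p (modelDeriv EG EG (fun c : G ↦ c * p) 1 X)
      (modelDeriv EG EG (fun c : G ↦ c * p) 1 Y) = groupForm gbi 1 X Y := by
  have h1 : groupForm gbi (1 * p) (modelDeriv EG EG (fun c : G ↦ c * p) 1 X)
      (modelDeriv EG EG (fun c : G ↦ c * p) 1 Y) = groupForm gbi 1 X Y := (h p 1 X Y).2
  rwa [one_mul] at h1

lemma IsBiinvariant.mulLeft (h : IsBiinvariant gbi) (p : G) (X Y : EG) :
    groupForm gbi p (modelDeriv EG EG (fun c : G ↦ p * c) 1 X)
      (modelDeriv EG EG (fun c : G ↦ p * c) 1 Y) = groupForm gbi 1 X Y := by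
  have h1 : groupForm gbi (p * 1) (modelDeriv EG EG (fun c : G ↦ p * c) 1 X)
      (modelDeriv EG EG (fun c : G ↦ p * c) 1 Y) = groupForm gbi 1 X Y := (h p 1 X Y).1
  rwa [mul_one] at h1

/-- This is the `Ad`-invariance of the scalar product at `1`. -/
lemma IsBiinvariant.conj (h : IsBiinvariant gbi) (a : G) (S : EG →L[ℝ] EG)
    (hS : ∀ X, modelDeriv EG EG (fun c : G ↦ c * a) 1 (S X) =
      modelDeriv EG EG (fun c : G ↦ a * c) 1 X) (X Y : EG) :
    groupForm gbi 1 (S X) (S Y) = groupForm gbi 1 X Y := by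
  rw [← h.mulRight a, hS, hS, h.mulLeft]

variable {E : Type*} [NormedAddCommGroup E] [NormedSpace ℝ E] [FiniteDimensional ℝ E]
  {M : Type*} [EMetricSpace M] [ChartedSpace E M] [IsManifold 𝓘(ℝ, E) ∞ M]
  [RiemannianBundle (fun x : M ↦ TangentSpace 𝓘(ℝ, E) x)]
  [MulAction G M] [ContMDiffSMul 𝓘(ℝ, EG) 𝓘(ℝ, E) ∞ G M]

variable (E M) in
/-- The Riemannian metric of `M` as a field of bilinear forms on the model space. -/
lemma exists_ambientForm
    [IsContMDiffRiemannianBundle 𝓘(ℝ, E) ∞ E (fun x : M ↦ TangentSpace 𝓘(ℝ, E) x)] :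
    ∃ g : M → E →L[ℝ] E →L[ℝ] ℝ, (∀ x, IsScalarProduct (g x)) ∧
      (∀ (x : M) (v w : E), ambientMetric E M x v w = g x v w) ∧
      ∀ x₀ : M, ∀ y ∈ (extChartAt 𝓘(ℝ, E) x₀).target, ContDiffAt ℝ ∞ (coordForm g x₀) y := by
  obtain ⟨g, hg, hgi⟩ := IsContMDiffRiemannianBundle.exists_contMDiff (IB := 𝓘(ℝ, E)) (n := ∞)
    (F := E) (E := fun x : M ↦ TangentSpace 𝓘(ℝ, E) x)
  refine ⟨g, fun x ↦ ⟨fun v w ↦ ?_, fun v hv ↦ ?_⟩, hgi, fun x₀ y hy ↦ ?_⟩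
  · exact ((hgi x v w).symm.trans (real_inner_comm _ _)).trans (hgi x w v)
  · exact (real_inner_self_pos (F := TangentSpace 𝓘(ℝ, E) x).2 hv).trans_eq (hgi x v v)
  · have h := (contMDiffAt_form_iff (g := g) ((extChartAt 𝓘(ℝ, E) x₀).map_target hy)).1 (hg _)
    rwa [(extChartAt 𝓘(ℝ, E) x₀).right_inv hy] at h

lemma cheegerQuotientDeriv_apply (x : M) (X : EG) (v : E) :
    cheegerQuotientDeriv (G := G) EG E x (X, v) = orbitDeriv EG E G x X + v := by
  have h1 : MDifferentiableAt (𝓘(ℝ, EG).prod 𝓘(ℝ, E)) 𝓘(ℝ, E) (fun z : G × M ↦ z.1 • z.2) (1, x) :=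
    (contMDiff_smul (I := 𝓘(ℝ, EG)) (I' := 𝓘(ℝ, E)) (n := ∞) _).mdifferentiableAt (by simp)
  have h2 := mfderiv_prod_eq_add_apply (v := ((X, v) : EG × E)) h1
  have h3 : modelDeriv E E (fun y : M ↦ (1 : G) • y) x v = v := by
    simp only [one_smul]
    rw [modelDeriv_id]; rfl
  refine h2.trans ?_
  exact congrArg (fun u : E ↦ orbitDeriv EG E G x X + u) h3

lemma orbitComponent_eq {g : M → E →L[ℝ] E →L[ℝ] ℝ} (hg : ∀ x, IsScalarProduct (g x))
    (hgi : ∀ (x : M) (v w : E), ambientMetric E M x v w = g x v w) (x : M)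
    (v : TangentSpace 𝓘(ℝ, E) x) :
    orbitComponent EG G x v = orbitProjection EG G g x v := by
  have hP := isRangeProjection_orbitProjection (EG := EG) (G := G) (hg x)
  have hex : ∃ u : TangentSpace 𝓘(ℝ, E) x, u ∈ orbitTangent EG G x ∧
      ∀ z ∈ orbitTangent EG G x, ambientMetric E M x (v - u) z = 0 := by
    refine ⟨orbitProjection EG G g x v, hP.mem_range v, ?_⟩
    rintro _ ⟨X, rfl⟩
    exact (hgi x _ _).trans (hP.orthogonal v X)
  obtain ⟨hu1, hu2⟩ := Classical.epsilon_spec hex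
  refine (hP.eq_of_mem_of_orthogonal (hg x) hu1 fun X ↦ ?_).symm
  exact (hgi x _ _).symm.trans (hu2 _ ⟨X, rfl⟩)

/-- The passage from the geometric definition at `(1, x)` to the closed formula, which unlike the
definition is meaningful and smooth at `l = 0`. -/
lemma rescaledMetric_eq {g : M → E →L[ℝ] E →L[ℝ] ℝ} (hg : ∀ x, IsScalarProduct (g x))
    (hgi : ∀ (x : M) (v w : E), ambientMetric E M x v w = g x v w) {l : ℝ} (hl : l ≠ 0)
    (x : M) (v w : E) :
    rescaledMetric gbi l x v w = deformedField G (groupForm gbi 1) g l x v w := by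
  have h := rescaled_eq_deformedForm (isScalarProduct_groupForm gbi 1) (hg x)
    (isRangeProjection_orbitProjection (EG := EG) (G := G) (hg x)) hl
    (h := productMetric gbi l ((1, x) : G × M)) (D := cheegerQuotientDeriv (G := G) EG E x)
    (fun z z' ↦ congrArg (fun t ↦ l ^ 2 * groupForm gbi 1 z.1 z'.1 + t) (hgi x _ _))
    (fun z ↦ cheegerQuotientDeriv_apply x z.1 z.2) v w
  rw [← orbitComponent_eq hg hgi x v, ← orbitComponent_eq hg hgi x w] at h
  exact h

end RescaledMetric

/-! ### The smooth structure of the quotient by an isotropy group -/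

section Quotient

variable {EG : Type*} [NormedAddCommGroup EG] [NormedSpace ℝ EG] [FiniteDimensional ℝ EG]
  {E : Type*} [NormedAddCommGroup E] [NormedSpace ℝ E] [FiniteDimensional ℝ E]
  {G : Type*} [TopologicalSpace G] [ChartedSpace EG G] [Group G] [LieGroup 𝓘(ℝ, EG) ∞ G]
  {M : Type*} [TopologicalSpace M] [ChartedSpace E M] [IsManifold 𝓘(ℝ, E) ∞ M]
  [MulAction G M] [ContMDiffSMul 𝓘(ℝ, EG) 𝓘(ℝ, E) ∞ G M]

lemma mk_eq_mk_of_smul_eq {x : M} {a c : G} (h : a • x = c • x) :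
    (a : G ⧸ stabilizer G x) = c :=
  injective_ofQuotientStabilizer G x h

lemma continuous_ofQuotientStabilizer {x : M} (h : Continuous fun a : G ↦ a • x) :
    Continuous (ofQuotientStabilizer G x) :=
  continuous_quot_lift _ h

lemma isOpenMap_mk (EG : Type*) [NormedAddCommGroup EG] [NormedSpace ℝ EG]
    (G : Type*) [TopologicalSpace G] [ChartedSpace EG G] [Group G] [LieGroup 𝓘(ℝ, EG) ∞ G]
    (H : Subgroup G) : IsOpenMap (QuotientGroup.mk : G → G ⧸ H) := by
  have := topologicalGroup_of_lieGroup 𝓘(ℝ, EG) ∞ (G := G)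
  exact QuotientGroup.isOpenMap_coe

/-- The chart of `G / G_x` around the coset of `a`. -/
def OrbitCoordinates.quotientChart {x : M} {k : ℕ} (c : OrbitCoordinates EG E G x k) (a : G) :
    OpenPartialHomeomorph (G ⧸ stabilizer G x) (EuclideanSpace ℝ (Fin k)) where
  toFun q := c.coord (a⁻¹ • ofQuotientStabilizer G x q)
  invFun r := ((a * c.lift r : G) : G ⧸ stabilizer G x)
  source := QuotientGroup.mk '' ((fun d : G ↦ a⁻¹ * d) ⁻¹' c.nhd)
  target := c.ran
  map_source' := by
    rintro _ ⟨d, hd, rfl⟩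
    rw [ofQuotientStabilizer_mk, ← mul_smul]
    exact c.coord_mem _ hd
  map_target' r hr := by
    refine ⟨a * c.lift r, ?_, rfl⟩
    simpa using c.mapsTo_lift hr
  left_inv' := by
    rintro _ ⟨d, hd, rfl⟩
    refine mk_eq_mk_of_smul_eq ?_
    rw [ofQuotientStabilizer_mk, ← mul_smul, mul_smul, c.lift_coord _ hd, ← mul_smul,
      mul_inv_cancel_left]
  right_inv' r hr := by
    rw [ofQuotientStabilizer_mk, ← mul_smul, inv_mul_cancel_left, c.coord_lift r hr]
  open_source := isOpenMap_mk EG G _ _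
    (c.isOpen_nhd.preimage (contMDiff_mulLeft EG a⁻¹).continuous)
  open_target := c.isOpen_ran
  continuousOn_toFun := by
    refine c.contMDiffOn_coord.continuousOn.comp (((contMDiff_smul_left EG E M a⁻¹).continuous.comp
      (continuous_ofQuotientStabilizer (contMDiff_orbitMap EG E x).continuous)).continuousOn) ?_
    rintro _ ⟨d, hd, rfl⟩
    simp only [ofQuotientStabilizer_mk, ← mul_smul]
    exact c.smul_mem _ hd
  continuousOn_invFun :=
    (continuous_quotient_mk'.comp (contMDiff_mulLeft EG a).continuous).comp_continuousOn
      c.contMDiffOn_lift.continuousOn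

variable {x : M} {k : ℕ}

lemma OrbitCoordinates.mem_quotientChart_source (c : OrbitCoordinates EG E G x k) (a : G) :
    (a : G ⧸ stabilizer G x) ∈ (c.quotientChart a).source :=
  ⟨a, by simpa using c.one_mem, rfl⟩

lemma OrbitCoordinates.smul_mem_dom (c : OrbitCoordinates EG E G x k) {a d : G}
    (h : (d : G ⧸ stabilizer G x) ∈ (c.quotientChart a).source) : a⁻¹ • d • x ∈ c.dom := by
  obtain ⟨e, he, hed⟩ := h
  have h1 : e • x = d • x := by
    rw [← ofQuotientStabilizer_mk G x e, hed, ofQuotientStabilizer_mk]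
  rw [← h1, ← mul_smul]
  exact c.smul_mem _ he

/-- The coordinates of a coset depend smoothly on the group element. -/
lemma OrbitCoordinates.contMDiffAt_coord (c : OrbitCoordinates EG E G x k) {a d : G}
    (h : (d : G ⧸ stabilizer G x) ∈ (c.quotientChart a).source) :
    ContMDiffAt 𝓘(ℝ, EG) (𝓡 k) ∞ (fun e : G ↦ c.coord (a⁻¹ • e • x)) d :=
  ContMDiffAt.comp (I' := 𝓘(ℝ, E)) (g := c.coord) d
    (c.contMDiffOn_coord.contMDiffAt (c.isOpen_dom.mem_nhds (c.smul_mem_dom h)))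
    (((contMDiff_smul_left EG E M a⁻¹).comp (contMDiff_orbitMap EG E x)).contMDiffAt)

/-- The smooth structure of `G / G_x`. -/
abbrev OrbitCoordinates.chartedSpace (c : OrbitCoordinates EG E G x k) :
    ChartedSpace (EuclideanSpace ℝ (Fin k)) (G ⧸ stabilizer G x) where
  atlas := Set.range c.quotientChart
  chartAt q := c.quotientChart q.out
  mem_chart_source q := by
    have h := c.mem_quotientChart_source q.out
    rwa [QuotientGroup.out_eq'] at h
  chart_mem_atlas q := ⟨_, rfl⟩

/-- A change of charts is `r ↦ coord (a'⁻¹ • (a * lift r) • x)`, a composition of smooth maps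
through `G` and `M`. -/
lemma OrbitCoordinates.isManifold (c : OrbitCoordinates EG E G x k) :
    letI := c.chartedSpace
    IsManifold (𝓡 k) ∞ (G ⧸ stabilizer G x) := by
  let := c.chartedSpace
  apply isManifold_of_contDiffOn
  rintro _ _ ⟨a, rfl⟩ ⟨a', rfl⟩
  intro r hr
  have hr' : r ∈ c.ran ∧ ((a * c.lift r : G) : G ⧸ stabilizer G x) ∈ (c.quotientChart a').source := by
    simp only [modelWithCornersSelf_coe, Set.range_id, Set.inter_univ,
      OpenPartialHomeomorph.trans_source, OpenPartialHomeomorph.symm_source] at hr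
    exact hr
  have h1 := c.contMDiffAt_coord hr'.2
  have h2 : ContMDiffAt (𝓡 k) 𝓘(ℝ, EG) ∞ (fun r ↦ a * c.lift r) r :=
    ContMDiffAt.comp (I' := 𝓘(ℝ, EG)) (g := fun b : G ↦ a * b) r (contMDiff_mulLeft EG a _)
      (c.contMDiffOn_lift.contMDiffAt (c.isOpen_ran.mem_nhds hr'.1))
  have h3 := ContMDiffAt.comp (I' := 𝓘(ℝ, EG)) (g := fun e : G ↦ c.coord (a'⁻¹ • e • x))
    (f := fun r ↦ a * c.lift r) r h1 h2
  exact h3.contDiffAt.contDiffWithinAt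

/-- The inverse charts lift to `G`, so the projection has smooth local sections, and these make its
derivative surjective. -/
lemma OrbitCoordinates.isSubmersion_mk (c : OrbitCoordinates EG E G x k) :
    letI := c.chartedSpace
    IsSubmersion 𝓘(ℝ, EG) (𝓡 k) ∞ (QuotientGroup.mk : G → G ⧸ stabilizer G x) := by
  let := c.chartedSpace
  have hM : IsManifold (𝓡 k) ∞ (G ⧸ stabilizer G x) := c.isManifold
  have : IsManifold 𝓘(ℝ, EG) ∞ G := inferInstance
  have hmem : ∀ a : G, (a : G ⧸ stabilizer G x) ∈
      (c.quotientChart (a : G ⧸ stabilizer G x).out).source := fun a ↦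
    mem_chart_source (EuclideanSpace ℝ (Fin k)) (a : G ⧸ stabilizer G x)
  have hsm : ContMDiff 𝓘(ℝ, EG) (𝓡 k) ∞ (QuotientGroup.mk : G → G ⧸ stabilizer G x) := by
    intro a
    rw [contMDiffAt_iff_target]
    exact ⟨continuous_quotient_mk'.continuousAt, c.contMDiffAt_coord (hmem a)⟩
  refine isSubmersion_of_surjective hsm fun a ↦ ?_
  set a₀ := (a : G ⧸ stabilizer G x).out
  set χ := c.quotientChart a₀ 
  have hχs : ContMDiffAt (𝓡 k) (𝓡 k) ∞ χ (a : G ⧸ stabilizer G x) :=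
    contMDiffAt_extChartAt (I := 𝓡 k) (n := ∞) (x := (a : G ⧸ stabilizer G x))
  -- The chart at the coset yields a section through some representative; right multiplication by
  -- `t`, an element of the isotropy group, moves it through `a` itself.
  set t : G := (a₀ * c.lift (χ (a : G ⧸ stabilizer G x)))⁻¹ * a
  have hinv : ∀ q ∈ χ.source, ((a₀ * c.lift (χ q) : G) : G ⧸ stabilizer G x) = q :=
    fun q hq ↦ χ.left_inv hq
  have htH : t ∈ stabilizer G x := QuotientGroup.eq.1 (hinv _ (hmem a))
  refine surjective_modelDeriv_of_section (σ := fun q ↦ a₀ * c.lift (χ q) * t) (hsm a) ?_ ?_ ?_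
  · have h1 : ContMDiffAt (𝓡 k) 𝓘(ℝ, EG) ∞ c.lift (χ (a : G ⧸ stabilizer G x)) :=
      c.contMDiffOn_lift.contMDiffAt (c.isOpen_ran.mem_nhds (χ.map_source (hmem a)))
    exact (((contMDiff_mulRight EG t).comp (contMDiff_mulLeft EG a₀)).contMDiffAt).comp _
      (h1.comp _ hχs)
  · exact mul_inv_cancel_left _ _
  · filter_upwards [χ.open_source.mem_nhds (hmem a)] with q hq
    rw [QuotientGroup.mk_mul_of_mem _ htH, hinv q hq]

/-- The quotient by an isotropy group has a smooth structure for which the projection is a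
submersion. -/
lemma exists_quotient_structure
    (EG : Type*) [NormedAddCommGroup EG] [NormedSpace ℝ EG] [FiniteDimensional ℝ EG]
    (E : Type*) [NormedAddCommGroup E] [NormedSpace ℝ E] [FiniteDimensional ℝ E]
    {G : Type*} [TopologicalSpace G] [ChartedSpace EG G] [Group G] [LieGroup 𝓘(ℝ, EG) ∞ G]
    {M : Type*} [TopologicalSpace M] [ChartedSpace E M] [IsManifold 𝓘(ℝ, E) ∞ M]
    [MulAction G M] [ContMDiffSMul 𝓘(ℝ, EG) 𝓘(ℝ, E) ∞ G M] (x : M) :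
    ∃ (k : ℕ) (_ : ChartedSpace (EuclideanSpace ℝ (Fin k)) (G ⧸ stabilizer G x)),
      IsManifold (𝓡 k) ∞ (G ⧸ stabilizer G x) ∧
      IsSubmersion 𝓘(ℝ, EG) (𝓡 k) ∞ (QuotientGroup.mk : G → G ⧸ stabilizer G x) := by
  obtain ⟨c⟩ := nonempty_orbitCoordinates EG E (G := G) x rfl
  exact ⟨_, c.chartedSpace, c.isManifold, c.isSubmersion_mk⟩

/-! ### The orbit as the image of the quotient -/

variable [ChartedSpace (EuclideanSpace ℝ (Fin k)) (G ⧸ stabilizer G x)]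
  [IsManifold (𝓡 k) ∞ (G ⧸ stabilizer G x)]

/-- Locally this is the orbit map after a smooth section of the projection, so any smooth structure
making the projection a submersion will do. -/
lemma contMDiff_ofQuotientStabilizer
    (hπ : IsSubmersion 𝓘(ℝ, EG) (𝓡 k) ∞ (QuotientGroup.mk : G → G ⧸ stabilizer G x)) :
    ContMDiff (𝓡 k) 𝓘(ℝ, E) ∞ (ofQuotientStabilizer G x) := by
  have : IsManifold 𝓘(ℝ, EG) ∞ G := inferInstance
  intro q
  obtain ⟨a, rfl⟩ := QuotientGroup.mk_surjective q
  obtain ⟨σ, hσ, -, hs⟩ := exists_section_of_isSubmersion hπ a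
  refine (((contMDiff_orbitMap EG E x).contMDiffAt).comp _ hσ).congr_of_eventuallyEq ?_
  filter_upwards [hs] with q hq
  conv_lhs => rw [← hq]
  rfl

lemma modelDeriv_ofQuotientStabilizer_mk
    (hπ : IsSubmersion 𝓘(ℝ, EG) (𝓡 k) ∞ (QuotientGroup.mk : G → G ⧸ stabilizer G x)) (a : G)
    (X : EG) :
    modelDeriv (EuclideanSpace ℝ (Fin k)) E (ofQuotientStabilizer G x) (a : G ⧸ stabilizer G x)
      (modelDeriv EG (EuclideanSpace ℝ (Fin k)) (QuotientGroup.mk : G → G ⧸ stabilizer G x) a X) =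
      modelDeriv EG E (fun c : G ↦ c • x) a X := by
  have : IsManifold 𝓘(ℝ, EG) ∞ G := inferInstance
  have h := modelDeriv_comp (E := EG) (F := EuclideanSpace ℝ (Fin k)) (H := E)
    (h := ofQuotientStabilizer G x) (f := (QuotientGroup.mk : G → G ⧸ stabilizer G x)) (x := a)
    ((contMDiff_ofQuotientStabilizer hπ _).mdifferentiableAt (by simp))
    ((hπ.contMDiff _).mdifferentiableAt (by simp))
  exact (congrArg (fun T ↦ T X) h).symm

/-- The kernel of the derivative of the orbit map is the kernel of the derivative of the
projection. -/
lemma modelDeriv_mk_eq_zero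
    (hπ : IsSubmersion 𝓘(ℝ, EG) (𝓡 k) ∞ (QuotientGroup.mk : G → G ⧸ stabilizer G x)) {a : G}
    {X : EG} (hX : modelDeriv EG E (fun c : G ↦ c • x) a X = 0) :
    modelDeriv EG (EuclideanSpace ℝ (Fin k)) (QuotientGroup.mk : G → G ⧸ stabilizer G x) a X = 0 := by
  have : IsManifold 𝓘(ℝ, EG) ∞ G := inferInstance
  obtain ⟨d, hd⟩ : ∃ d, d = Module.finrank ℝ (LinearMap.range (orbitDeriv EG E G x).toLinearMap) :=
    ⟨_, rfl⟩
  obtain ⟨c⟩ := nonempty_orbitCoordinates EG E (G := G) x hd.symm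
  -- Near `a` the projection factors through the orbit map as `K (d • x)` with `K` smooth, so its
  -- derivative kills whatever that of the orbit map kills.
  let K : M → G ⧸ stabilizer G x := fun y ↦ ((a * c.lift (c.coord (a⁻¹ • y)) : G) : G ⧸ stabilizer G x)
  have hmem : a ∈ (fun d : G ↦ a⁻¹ * d) ⁻¹' c.nhd := by simpa using c.one_mem
  have hev : (QuotientGroup.mk : G → G ⧸ stabilizer G x) =ᶠ[𝓝 a] fun d ↦ K (d • x) := by
    filter_upwards [(c.isOpen_nhd.preimage (contMDiff_mulLeft EG a⁻¹).continuous).mem_nhds hmem]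
      with d hd
    refine mk_eq_mk_of_smul_eq ?_
    rw [← mul_smul, mul_smul, c.lift_coord _ hd, ← mul_smul, mul_inv_cancel_left]
  have hK : ContMDiffAt 𝓘(ℝ, E) (𝓡 k) ∞ K (a • x) := by
    have h0 : a⁻¹ • a • x = (1 : G) • x := by simp
    have e1 : ContMDiffAt 𝓘(ℝ, E) (𝓡 d) ∞ c.coord (a⁻¹ • a • x) := by
      rw [h0]
      exact c.contMDiffOn_coord.contMDiffAt (c.isOpen_dom.mem_nhds (c.smul_mem _ c.one_mem))
    have e2 : ContMDiffAt (𝓡 d) 𝓘(ℝ, EG) ∞ c.lift (c.coord (a⁻¹ • a • x)) := by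
      rw [h0]
      exact c.contMDiffOn_lift.contMDiffAt (c.isOpen_ran.mem_nhds (c.coord_mem _ c.one_mem))
    have e3 := ContMDiffAt.comp (g := c.lift) (f := fun y : M ↦ c.coord (a⁻¹ • y)) (a • x) e2
      (ContMDiffAt.comp (g := c.coord) (f := fun y : M ↦ a⁻¹ • y) (a • x) e1
        (contMDiff_smul_left EG E M a⁻¹ _))
    exact ContMDiffAt.comp (g := fun d : G ↦ ((a * d : G) : G ⧸ stabilizer G x)) (a • x)
      ((hπ.contMDiff.comp (contMDiff_mulLeft EG a)).contMDiffAt) e3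
  have h := modelDeriv_comp (E := EG) (F := E) (H := EuclideanSpace ℝ (Fin k))
    (h := K) (f := fun d : G ↦ d • x) (x := a) (hK.mdifferentiableAt (by simp))
    ((contMDiff_orbitMap EG E x _).mdifferentiableAt (by simp))
  rw [← modelDeriv_congr hev] at h
  have h2 := congrArg (fun T ↦ T X) h
  simp only [ContinuousLinearMap.comp_apply, hX, map_zero] at h2
  exact h2

lemma injective_modelDeriv_ofQuotientStabilizer
    (hπ : IsSubmersion 𝓘(ℝ, EG) (𝓡 k) ∞ (QuotientGroup.mk : G → G ⧸ stabilizer G x))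
    (q : G ⧸ stabilizer G x) :
    Function.Injective
      (modelDeriv (EuclideanSpace ℝ (Fin k)) E (ofQuotientStabilizer G x) q) := by
  have : IsManifold 𝓘(ℝ, EG) ∞ G := inferInstance
  rw [injective_iff_map_eq_zero]
  intro u hu
  obtain ⟨a, rfl⟩ := QuotientGroup.mk_surjective q
  obtain ⟨X, rfl⟩ := surjective_of_isSubmersion hπ a u
  rw [modelDeriv_ofQuotientStabilizer_mk hπ] at hu
  exact modelDeriv_mk_eq_zero hπ hu

/-- `G / G_x` is compact, so a continuous injection into a Hausdorff space is a closed embedding. -/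
lemma isSmoothEmbedding_ofQuotientStabilizer [CompactSpace G] [T2Space M]
    (hπ : IsSubmersion 𝓘(ℝ, EG) (𝓡 k) ∞ (QuotientGroup.mk : G → G ⧸ stabilizer G x)) :
    IsSmoothEmbedding (𝓡 k) 𝓘(ℝ, E) ∞ (ofQuotientStabilizer G x) :=
  ⟨isImmersion_of_injective (contMDiff_ofQuotientStabilizer hπ)
    (injective_modelDeriv_ofQuotientStabilizer hπ),
    ((continuous_ofQuotientStabilizer (contMDiff_orbitMap EG E x).continuous).isClosedEmbedding
      (injective_ofQuotientStabilizer G x)).isEmbedding⟩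

end Quotient

/-! ### The second fundamental form in coordinates -/

section SecondFundamentalForm

variable {E : Type*} [NormedAddCommGroup E] [NormedSpace ℝ E]
  {F : Type*} [NormedAddCommGroup F] [NormedSpace ℝ F]

/-- The Killing equation for the vector field generated by a family of isometries. -/
lemma killing_equation {T : E × F → E} {z₀ : E} {s₀ : F} (hT : ContDiffAt ℝ 2 T (z₀, s₀))
    (hid : ∀ᶠ z in 𝓝 z₀, T (z, s₀) = z) {g : E → E →L[ℝ] E →L[ℝ] ℝ}
    (hg : DifferentiableAt ℝ g z₀)
    (hinv : ∀ᶠ s in 𝓝 s₀, ∀ v w, g (T (z₀, s)) (fderiv ℝ T (z₀, s) (v, 0))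
      (fderiv ℝ T (z₀, s) (w, 0)) = g z₀ v w) (X : F) {K : E → E}
    (hK : ∀ᶠ z in 𝓝 z₀, K z = fderiv ℝ T (z, s₀) (0, X)) (v w : E) :
    DifferentiableAt ℝ K z₀ ∧
    fderiv ℝ g z₀ (K z₀) v w + g z₀ (fderiv ℝ K z₀ v) w + g z₀ v (fderiv ℝ K z₀ w) = 0 := by
  have hT1 : HasFDerivAt T (fderiv ℝ T (z₀, s₀)) (z₀, s₀) :=
    (hT.differentiableAt (by simp)).hasFDerivAt
  have hT2 : HasFDerivAt (fderiv ℝ T) (fderiv ℝ (fderiv ℝ T) (z₀, s₀)) (z₀, s₀) :=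
    ((hT.fderiv_right (m := 1) le_rfl).differentiableAt (by simp)).hasFDerivAt
  have hT0 : T (z₀, s₀) = z₀ := hid.self_of_nhds
  have hsymm : ∀ u u' : E × F, fderiv ℝ (fderiv ℝ T) (z₀, s₀) u u' =
      fderiv ℝ (fderiv ℝ T) (z₀, s₀) u' u := hT.isSymmSndFDerivAt (by simp)
  have hl : HasFDerivAt (fun z : E ↦ (z, s₀)) (ContinuousLinearMap.inl ℝ E F) z₀ :=
    hasFDerivAt_prodMk_left z₀ s₀
  have hr : HasFDerivAt (fun s : F ↦ (z₀, s)) (ContinuousLinearMap.inr ℝ E F) s₀ :=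
    hasFDerivAt_prodMk_right z₀ s₀
  have hone : ∀ v : E, fderiv ℝ T (z₀, s₀) (v, 0) = v := by
    have h1 : HasFDerivAt (fun z ↦ T (z, s₀)) (fderiv ℝ T (z₀, s₀) ∘L
      ContinuousLinearMap.inl ℝ E F) z₀ := HasFDerivAt.comp z₀ hT1 hl
    have h2 := h1.unique ((hasFDerivAt_id z₀).congr_of_eventuallyEq hid)
    exact fun v ↦ congrArg (fun L ↦ L v) h2
  have hKd : HasFDerivAt K
      ((fderiv ℝ (fderiv ℝ T) (z₀, s₀) ∘L ContinuousLinearMap.inl ℝ E F).flip (0, X)) z₀ := by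
    have h1 : HasFDerivAt (fun z ↦ fderiv ℝ T (z, s₀)) _ z₀ := HasFDerivAt.comp z₀ hT2 hl
    have h2 := h1.clm_apply (hasFDerivAt_const ((0 : E), X) z₀)
    simp only [ContinuousLinearMap.comp_zero, zero_add] at h2
    exact h2.congr_of_eventuallyEq hK
  -- By symmetry of second derivatives, the derivative of `K` along `v` is the rate of change in
  -- direction `X` of the differentials of the maps `T (·, s)` applied to `v`.
  have hKv : ∀ v, fderiv ℝ K z₀ v = fderiv ℝ (fderiv ℝ T) (z₀, s₀) (0, X) (v, 0) := by
    intro v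
    rw [hKd.fderiv, hsymm]
    rfl
  refine ⟨hKd.differentiableAt, ?_⟩
  have hΓ : HasFDerivAt (fun s ↦ g (T (z₀, s)))
      (fderiv ℝ g z₀ ∘L (fderiv ℝ T (z₀, s₀) ∘L ContinuousLinearMap.inr ℝ E F)) s₀ := by
    have h1 : HasFDerivAt (fun s ↦ T (z₀, s)) _ s₀ := HasFDerivAt.comp s₀ hT1 hr
    have h2 : HasFDerivAt g (fderiv ℝ g z₀) (T (z₀, s₀)) := by rw [hT0]; exact hg.hasFDerivAt
    exact HasFDerivAt.comp (g := g) (f := fun s ↦ T (z₀, s)) s₀ h2 h1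
  have hD : ∀ v : E, HasFDerivAt (fun s ↦ fderiv ℝ T (z₀, s) (v, 0))
      ((fderiv ℝ (fderiv ℝ T) (z₀, s₀) ∘L ContinuousLinearMap.inr ℝ E F).flip (v, 0)) s₀ := by
    intro v
    have h1 : HasFDerivAt (fun s ↦ fderiv ℝ T (z₀, s)) _ s₀ := HasFDerivAt.comp s₀ hT2 hr
    have h2 := h1.clm_apply (hasFDerivAt_const (v, (0 : F)) s₀)
    simp only [ContinuousLinearMap.comp_zero, zero_add] at h2
    exact h2
  have hall := (hΓ.clm_apply (hD v)).clm_apply (hD w)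
  -- The invariance identity is constant in `s`; its derivative at `s₀` in direction `X` is the
  -- Killing equation.
  have hzero := hall.unique ((hasFDerivAt_const (g z₀ v w) s₀).congr_of_eventuallyEq
    (hinv.mono fun s hs ↦ hs v w))
  have h := congrArg (fun L ↦ L X) hzero
  simp only [add_apply, ContinuousLinearMap.comp_apply, ContinuousLinearMap.flip_apply,
    ContinuousLinearMap.inr_apply, hone, hT0, zero_apply] at h
  rw [hK.self_of_nhds, hKv, hKv]
  linarith

/-- The Koszul form of the Levi-Civita connection in coordinates. -/
def koszulForm (g : E → E →L[ℝ] E →L[ℝ] ℝ) (z₀ : E) (D X Y Z : E) : ℝ :=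
  2 * g z₀ D Z + fderiv ℝ g z₀ X Y Z + fderiv ℝ g z₀ Y X Z - fderiv ℝ g z₀ Z X Y

/-- The derivative of a vector field tangent to the image of `f`, up to tangent vectors. -/
lemma exists_fderiv_eq_of_tangent [FiniteDimensional ℝ F] [FiniteDimensional ℝ E]
    {f : F → E} {u₀ : F} (hf : ContDiffAt ℝ 2 f u₀) (hinj : Function.Injective (fderiv ℝ f u₀))
    {Y : E → E} (hY : DifferentiableAt ℝ Y (f u₀))
    (ht : ∀ᶠ u in 𝓝 u₀, ∃ η, fderiv ℝ f u η = Y (f u)) {η₀ : F} (hη₀ : fderiv ℝ f u₀ η₀ = Y (f u₀))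
    (ξ : F) : ∃ ζ, fderiv ℝ Y (f u₀) (fderiv ℝ f u₀ ξ) =
      fderiv ℝ (fderiv ℝ f) u₀ ξ η₀ + fderiv ℝ f u₀ ζ := by
  obtain ⟨q, hq⟩ := (fderiv ℝ f u₀).toLinearMap.exists_leftInverse_of_injective
    (LinearMap.ker_eq_bot.2 hinj)
  let q' : E →L[ℝ] F := q.toContinuousLinearMap
  have hq' : q' ∘L fderiv ℝ f u₀ = ContinuousLinearMap.id ℝ F := by
    ext w
    exact LinearMap.congr_fun hq w
  have hf1 : HasFDerivAt f (fderiv ℝ f u₀) u₀ := (hf.differentiableAt (by simp)).hasFDerivAt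
  have hf2 : HasFDerivAt (fderiv ℝ f) (fderiv ℝ (fderiv ℝ f) u₀) u₀ :=
    ((hf.fderiv_right (m := 1) le_rfl).differentiableAt (by simp)).hasFDerivAt
  have hcont : ContDiffAt ℝ 1 (fun u ↦ q' ∘L fderiv ℝ f u) u₀ :=
    contDiffAt_const.clm_comp (hf.fderiv_right (m := 1) le_rfl)
  have hinv0 : (q' ∘L fderiv ℝ f u₀).IsInvertible := by
    rw [hq']
    exact ⟨ContinuousLinearEquiv.refl ℝ F, rfl⟩
  have : CompleteSpace F := FiniteDimensional.complete ℝ F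
  have hinv : DifferentiableAt ℝ (fun u ↦ (q' ∘L fderiv ℝ f u).inverse) u₀ :=
    (contDiffAt_inverse hcont hinv0).differentiableAt (by simp)
  have hYf : HasFDerivAt (fun u ↦ Y (f u)) (fderiv ℝ Y (f u₀) ∘L fderiv ℝ f u₀) u₀ :=
    hY.hasFDerivAt.comp u₀ hf1
  -- Since `q'` is a left inverse of the derivative at `u₀`, the map `q' ∘ fderiv f u` stays
  -- invertible nearby and recovers differentiably the preimage of `Y (f u)`. The product rule for
  -- `Y ∘ f = fderiv f · η` then gives the claim.
  let η : F → F := fun u ↦ (q' ∘L fderiv ℝ f u).inverse (q' (Y (f u)))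
  have hη : DifferentiableAt ℝ η u₀ :=
    hinv.clm_apply (q'.differentiableAt.comp u₀ hYf.differentiableAt)
  have hev : ∀ᶠ u in 𝓝 u₀, (q' ∘L fderiv ℝ f u).IsInvertible := by
    obtain ⟨e, he⟩ := hinv0
    have h1 := hcont.continuousAt.eventually
      (by simpa only [← he] using e.nhds : Set.range ((↑) : (F ≃L[ℝ] F) → F →L[ℝ] F) ∈ _)
    filter_upwards [h1] with u ⟨e', he'⟩ using ⟨e', he'⟩
  have hval : ∀ᶠ u in 𝓝 u₀, Y (f u) = fderiv ℝ f u (η u) := by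
    filter_upwards [ht, hev] with u ⟨η', h'⟩ ⟨e, he⟩
    have h3 : η u = η' := by
      simp only [η, ← h']
      rw [← he, ContinuousLinearMap.inverse_equiv, ContinuousLinearEquiv.coe_coe,
        ContinuousLinearEquiv.symm_apply_eq]
      exact (congrArg (fun L ↦ L η') he).symm
    rw [h3, h']
  have hprod := (hf2.clm_apply hη.hasFDerivAt).congr_of_eventuallyEq hval
  have h := congrArg (fun L ↦ L ξ) (hYf.unique hprod)
  have hη0 : η u₀ = η₀ := hinj (hval.self_of_nhds.symm.trans hη₀.symm)
  simp only [add_apply, ContinuousLinearMap.comp_apply, ContinuousLinearMap.flip_apply, hη0] at h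
  exact ⟨fderiv ℝ η u₀ ξ, by rw [h, add_comm]⟩

/-- A submanifold through each of whose tangent vectors there passes a tangent Killing field of
critical length is totally geodesic. -/
lemma koszulForm_eq_zero [FiniteDimensional ℝ F] [FiniteDimensional ℝ E]
    {f : F → E} {u₀ : F} (hf : ContDiffAt ℝ 2 f u₀) (hinj : Function.Injective (fderiv ℝ f u₀))
    {g : E → E →L[ℝ] E →L[ℝ] ℝ} (hg : DifferentiableAt ℝ g (f u₀))
    (hsymm : ∀ᶠ z in 𝓝 (f u₀), ∀ v w, g z v w = g z w v)
    (hK : ∀ ξ, ∃ K : E → E, DifferentiableAt ℝ K (f u₀) ∧ K (f u₀) = fderiv ℝ f u₀ ξ ∧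
      (∀ᶠ u in 𝓝 u₀, ∃ η, fderiv ℝ f u η = K (f u)) ∧
      (∀ v w, fderiv ℝ g (f u₀) (K (f u₀)) v w + g (f u₀) (fderiv ℝ K (f u₀) v) w +
        g (f u₀) v (fderiv ℝ K (f u₀) w) = 0) ∧
      fderiv ℝ (fun z ↦ g z (K z) (K z)) (f u₀) = 0)
    {Y : E → E} (hY : DifferentiableAt ℝ Y (f u₀))
    (ht : ∀ᶠ u in 𝓝 u₀, ∃ η, fderiv ℝ f u η = Y (f u)) (ξ : F) {Z : E}
    (hZ : ∀ ζ, g (f u₀) (fderiv ℝ f u₀ ζ) Z = 0) :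
    koszulForm g (f u₀) (fderiv ℝ Y (f u₀) (fderiv ℝ f u₀ ξ)) (fderiv ℝ f u₀ ξ) (Y (f u₀)) Z = 0 := by
  set z₀ := f u₀
  set A := fderiv ℝ f u₀
  have hgs : ∀ v w, g z₀ v w = g z₀ w v := hsymm.self_of_nhds
  have hdsymm : ∀ u v w, fderiv ℝ g z₀ u v w = fderiv ℝ g z₀ u w v := by
    intro u v w
    have h1 : ∀ a b : E, HasFDerivAt (fun z ↦ g z a b) (((fderiv ℝ g z₀).flip a).flip b) z₀ := by
      intro a b
      have h2 := (hg.hasFDerivAt.clm_apply (hasFDerivAt_const a z₀)).clm_apply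
        (hasFDerivAt_const b z₀)
      simp only [ContinuousLinearMap.comp_zero, zero_add] at h2
      exact h2
    have h3 := (h1 v w).unique ((h1 w v).congr_of_eventuallyEq (hsymm.mono fun z hz ↦ hz v w))
    exact congrArg (fun L ↦ L u) h3
  have hf2symm : ∀ ξ η, fderiv ℝ (fderiv ℝ f) u₀ ξ η = fderiv ℝ (fderiv ℝ f) u₀ η ξ :=
    hf.isSymmSndFDerivAt (by simp)
  -- the second fundamental form in the direction `Z`
  let S : F → F → ℝ := fun ξ η ↦ koszulForm g z₀ (fderiv ℝ (fderiv ℝ f) u₀ ξ η) (A ξ) (A η) Z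
  -- A tangent correction to the derivative of `Y` pairs to zero with the normal vector `Z`, so only
  -- the value of `Y` at the point matters.
  have hS : ∀ {Y : E → E}, DifferentiableAt ℝ Y z₀ →
      (∀ᶠ u in 𝓝 u₀, ∃ η, fderiv ℝ f u η = Y (f u)) → ∀ (ξ η : F), A η = Y z₀ →
      koszulForm g z₀ (fderiv ℝ Y z₀ (A ξ)) (A ξ) (Y z₀) Z = S ξ η := by
    intro Y hY ht ξ η hη
    obtain ⟨ζ, hζ⟩ := exists_fderiv_eq_of_tangent hf hinj hY ht hη ξ
    have hζ' : fderiv ℝ Y z₀ (A ξ) = fderiv ℝ (fderiv ℝ f) u₀ ξ η + A ζ := hζ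
    simp only [S, koszulForm, hζ', map_add, add_apply, hη]
    rw [hZ ζ, add_zero]
  -- The Killing equation for the pair `K, Z` turns the Koszul form of `K, K, Z` into minus the
  -- derivative of `|K|²` along `Z`, which vanishes.
  have hdiag : ∀ ξ, S ξ ξ = 0 := by
    intro ξ
    obtain ⟨K, hKd, hK0, hKt, hkill, hcrit⟩ := hK ξ
    rw [← hS hKd hKt ξ ξ hK0.symm, ← hK0]
    have h1 := hkill (K z₀) Z
    have h2 : fderiv ℝ (fun z ↦ g z (K z) (K z)) z₀ Z = 0 := by rw [hcrit]; rfl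
    have h3 := ((hg.hasFDerivAt.clm_apply hKd.hasFDerivAt).clm_apply hKd.hasFDerivAt).fderiv
    rw [h3] at h2
    simp only [add_apply, ContinuousLinearMap.comp_apply, ContinuousLinearMap.flip_apply] at h2
    simp only [koszulForm]
    have h4 := hgs (fderiv ℝ K z₀ Z) (K z₀)
    linarith
  have hSsymm : ∀ ξ η, S ξ η = S η ξ := by
    intro ξ η
    simp only [S, koszulForm, hf2symm ξ η, hdsymm Z (A ξ) (A η)]
    ring
  have hadd : ∀ ξ η, S (ξ + η) (ξ + η) = S ξ ξ + S ξ η + S η ξ + S η η := by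
    intro ξ η
    simp only [S, koszulForm, map_add, add_apply]
    ring
  obtain ⟨η, hη⟩ := ht.self_of_nhds
  rw [hS hY ht ξ η hη]
  have h1 := hadd ξ η
  rw [hdiag, hdiag, hdiag, hSsymm η ξ] at h1
  linarith

end SecondFundamentalForm

/-! ### Vector fields and the Levi-Civita connection in charts -/

section VectorFields

variable {E : Type*} [NormedAddCommGroup E] [NormedSpace ℝ E] [FiniteDimensional ℝ E]
  {M : Type*} [TopologicalSpace M] [ChartedSpace E M] [IsManifold 𝓘(ℝ, E) ∞ M]
  {F : Type*} [NormedAddCommGroup F] [NormedSpace ℝ F] [FiniteDimensional ℝ F]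
  {N : Type*} [TopologicalSpace N] [ChartedSpace F N] [IsManifold 𝓘(ℝ, F) ∞ N]

/-- A vector field, read in the preferred chart at `p`. -/
def coordField (X : ∀ x : M, TangentSpace 𝓘(ℝ, E) x) (p : M) (z : E) : E :=
  chartDerivInv p ((extChartAt 𝓘(ℝ, E) p).symm z) (X ((extChartAt 𝓘(ℝ, E) p).symm z))

lemma coordField_self (X : ∀ x : M, TangentSpace 𝓘(ℝ, E) x) (p : M) :
    coordField X p (extChartAt 𝓘(ℝ, E) p p) = X p := by
  rw [coordField, extChartAt_to_inv (I := 𝓘(ℝ, E)) p, chartDerivInv_self]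
  rfl

lemma chartDeriv_coordField (X : ∀ x : M, TangentSpace 𝓘(ℝ, E) x) {p : M} {z : E}
    (hz : z ∈ (extChartAt 𝓘(ℝ, E) p).target) :
    chartDeriv p z (coordField X p z) = X ((extChartAt 𝓘(ℝ, E) p).symm z) :=
  congrArg (fun T : E →L[ℝ] E ↦ T (X ((extChartAt 𝓘(ℝ, E) p).symm z)))
    (chartDeriv_comp_chartDerivInv hz)

lemma mpullbackWithin_eq_coordField (X : ∀ x : M, TangentSpace 𝓘(ℝ, E) x) {p : M} {z : E}
    (hz : z ∈ (extChartAt 𝓘(ℝ, E) p).target) :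
    VectorField.mpullbackWithin 𝓘(ℝ, E) 𝓘(ℝ, E) (extChartAt 𝓘(ℝ, E) p).symm X
      (Set.range 𝓘(ℝ, E)) z = coordField X p z := by
  rw [VectorField.mpullbackWithin_apply, ModelWithCorners.range_eq_univ, mfderivWithin_univ]
  have h : (chartDeriv p z).inverse = chartDerivInv p ((extChartAt 𝓘(ℝ, E) p).symm z) :=
    ContinuousLinearMap.inverse_eq (chartDeriv_comp_chartDerivInv hz)
      (chartDerivInv_comp_chartDeriv hz)
  exact congrArg (fun T : E →L[ℝ] E ↦ T (X ((extChartAt 𝓘(ℝ, E) p).symm z))) h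

lemma eventuallyEq_coordField (X : ∀ x : M, TangentSpace 𝓘(ℝ, E) x) (p : M) :
    (fun z : E ↦ (VectorField.mpullbackWithin 𝓘(ℝ, E) 𝓘(ℝ, E) (extChartAt 𝓘(ℝ, E) p).symm X
      (Set.range 𝓘(ℝ, E)) z : E)) =ᶠ[𝓝 (extChartAt 𝓘(ℝ, E) p p)] coordField X p := by
  filter_upwards [target_mem_nhds (mem_extChartAt_target p)] with z hz
  exact mpullbackWithin_eq_coordField X hz

lemma differentiableAt_coordField {X : ∀ x : M, TangentSpace 𝓘(ℝ, E) x} {p : M}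
    (hX : MDifferentiableAt 𝓘(ℝ, E) 𝓘(ℝ, E).tangent
      (fun x ↦ (⟨x, X x⟩ : TangentBundle 𝓘(ℝ, E) M)) p) :
    DifferentiableAt ℝ (coordField X p) (extChartAt 𝓘(ℝ, E) p p) := by
  have : CompleteSpace E := FiniteDimensional.complete ℝ E
  have : IsManifold 𝓘(ℝ, E) 2 M := inferInstance
  have h := MDifferentiableWithinAt.differentiableWithinAt_mpullbackWithin_vectorField
    (mdifferentiableWithinAt_univ.2 hX)
  have h2 : DifferentiableAt ℝ (fun z : E ↦ (VectorField.mpullbackWithin 𝓘(ℝ, E) 𝓘(ℝ, E)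
      (extChartAt 𝓘(ℝ, E) p).symm X (Set.range 𝓘(ℝ, E)) z : E)) (extChartAt 𝓘(ℝ, E) p p) :=
    h.differentiableAt (by simp)
  exact h2.congr_of_eventuallyEq (eventuallyEq_coordField X p).symm

lemma lieBracketWithin_eq_of_eventuallyEq {X Y X' Y' : E → E} {s : Set E} (hs : s = Set.univ) {z : E}
    (hX : X =ᶠ[𝓝 z] X') (hY : Y =ᶠ[𝓝 z] Y') :
    VectorField.lieBracketWithin ℝ X Y s z = fderiv ℝ Y' z (X' z) - fderiv ℝ X' z (Y' z) := by
  rw [hs, VectorField.lieBracketWithin_univ, VectorField.lieBracket, hX.fderiv_eq, hY.fderiv_eq,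
    hX.self_of_nhds, hY.self_of_nhds]

/-- The preferred chart at `p` has identity derivative at `p`, so pulling the bracket back
introduces no further factor. -/
lemma mlieBracket_eq_coordField (X Y : ∀ x : M, TangentSpace 𝓘(ℝ, E) x) (p : M) :
    (VectorField.mlieBracket 𝓘(ℝ, E) X Y p : E) =
      fderiv ℝ (coordField Y p) (extChartAt 𝓘(ℝ, E) p p)
        (coordField X p (extChartAt 𝓘(ℝ, E) p p)) -
      fderiv ℝ (coordField X p) (extChartAt 𝓘(ℝ, E) p p)
        (coordField Y p (extChartAt 𝓘(ℝ, E) p p)) := by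
  rw [← VectorField.mlieBracketWithin_univ, VectorField.mlieBracketWithin_apply]
  have h : (chartDerivInv p p).inverse = ContinuousLinearMap.id ℝ E := by
    rw [chartDerivInv_self]
    exact ContinuousLinearMap.inverse_id
  have h2 : ∀ v : E, (chartDerivInv p p).inverse v = v := fun v ↦ by rw [h]; rfl
  refine (h2 _).trans ?_
  exact lieBracketWithin_eq_of_eventuallyEq (by simp) (eventuallyEq_coordField X p)
    (eventuallyEq_coordField Y p)

lemma derivInner_eq
    {g : ∀ x : M, TangentSpace 𝓘(ℝ, E) x →L[ℝ] TangentSpace 𝓘(ℝ, E) x →L[ℝ] ℝ} {p : M}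
    (hg : DifferentiableAt ℝ (coordForm g p) (extChartAt 𝓘(ℝ, E) p p))
    {Y Z : ∀ x : M, TangentSpace 𝓘(ℝ, E) x}
    (hY : DifferentiableAt ℝ (coordField Y p) (extChartAt 𝓘(ℝ, E) p p))
    (hZ : DifferentiableAt ℝ (coordField Z p) (extChartAt 𝓘(ℝ, E) p p)) (v : E) :
    derivInner g Y Z p v =
      fderiv ℝ (coordForm g p) (extChartAt 𝓘(ℝ, E) p p) v
        (coordField Y p (extChartAt 𝓘(ℝ, E) p p)) (coordField Z p (extChartAt 𝓘(ℝ, E) p p)) +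
      coordForm g p (extChartAt 𝓘(ℝ, E) p p)
        (fderiv ℝ (coordField Y p) (extChartAt 𝓘(ℝ, E) p p) v)
        (coordField Z p (extChartAt 𝓘(ℝ, E) p p)) +
      coordForm g p (extChartAt 𝓘(ℝ, E) p p) (coordField Y p (extChartAt 𝓘(ℝ, E) p p))
        (fderiv ℝ (coordField Z p) (extChartAt 𝓘(ℝ, E) p p) v) := by
  have hd := (hg.hasFDerivAt.clm_apply hY.hasFDerivAt).clm_apply hZ.hasFDerivAt
  have hev : (fun x : M ↦ g x (Y x) (Z x)) =ᶠ[𝓝 p] fun x ↦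
      (fun z ↦ coordForm g p z (coordField Y p z) (coordField Z p z)) (extChartAt 𝓘(ℝ, E) p x) := by
    filter_upwards [extChartAt_source_mem_nhds (I := 𝓘(ℝ, E)) p] with x hx
    have hx' := (extChartAt 𝓘(ℝ, E) p).map_source hx
    simp only [coordForm_apply, chartDeriv_coordField _ hx']
    rw [(extChartAt 𝓘(ℝ, E) p).left_inv hx]
  have h1 : derivInner g Y Z p v = modelDeriv E ℝ (fun x : M ↦ g x (Y x) (Z x)) p v := rfl
  rw [h1, modelDeriv_congr hev, modelDeriv_comp (F := E)
    (h := fun z : E ↦ coordForm g p z (coordField Y p z) (coordField Z p z))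
    (f := extChartAt 𝓘(ℝ, E) p) hd.differentiableAt.mdifferentiableAt
    ((contMDiffAt_chart (mem_extChartAt_source p)).mdifferentiableAt (by simp))]
  have h2 : modelDeriv E E (extChartAt 𝓘(ℝ, E) p) p = ContinuousLinearMap.id ℝ E :=
    chartDerivInv_self p
  have h3 : modelDeriv E ℝ (fun z : E ↦ coordForm g p z (coordField Y p z) (coordField Z p z))
      (extChartAt 𝓘(ℝ, E) p p) = _ := mfderiv_eq_fderiv.trans hd.fderiv
  rw [h2, h3]
  simp only [ContinuousLinearMap.comp_id, add_apply, ContinuousLinearMap.comp_apply,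
    ContinuousLinearMap.flip_apply]
  ring

/-- The Koszul formula in coordinates. -/
lemma isLeviCivitaDerivAt_of_koszulForm
    {g : ∀ x : M, TangentSpace 𝓘(ℝ, E) x →L[ℝ] TangentSpace 𝓘(ℝ, E) x →L[ℝ] ℝ} {p : M}
    (hg : DifferentiableAt ℝ (coordForm g p) (extChartAt 𝓘(ℝ, E) p p))
    (hs : ∀ v w : TangentSpace 𝓘(ℝ, E) p, g p v w = g p w v)
    {X Y : ∀ x : M, TangentSpace 𝓘(ℝ, E) x}
    (hX : DifferentiableAt ℝ (coordField X p) (extChartAt 𝓘(ℝ, E) p p))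
    (hY : DifferentiableAt ℝ (coordField Y p) (extChartAt 𝓘(ℝ, E) p p)) {W : E}
    (hW : ∀ Z : E, 2 * coordForm g p (extChartAt 𝓘(ℝ, E) p p) W Z =
      koszulForm (coordForm g p) (extChartAt 𝓘(ℝ, E) p p)
        (fderiv ℝ (coordField Y p) (extChartAt 𝓘(ℝ, E) p p)
          (coordField X p (extChartAt 𝓘(ℝ, E) p p)))
        (coordField X p (extChartAt 𝓘(ℝ, E) p p)) (coordField Y p (extChartAt 𝓘(ℝ, E) p p)) Z) :
    IsLeviCivitaDerivAt g X Y p W := by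
  intro Z hZ
  have hZ' := differentiableAt_coordField hZ
  have hgp : ∀ v w : E, g p v w = coordForm g p (extChartAt 𝓘(ℝ, E) p p) v w := by
    intro v w
    rw [coordForm_chart g (mem_extChartAt_source p), chartDeriv_self]
    rfl
  set z₀ := extChartAt 𝓘(ℝ, E) p p
  have hsym : ∀ v w : E, coordForm g p z₀ v w = coordForm g p z₀ w v := by
    intro v w
    rw [← hgp, ← hgp]
    exact hs v w
  have hgv : ∀ {v w v' w' : E}, v = v' → w = w' → g p v w = coordForm g p z₀ v' w' := by
    rintro v w _ _ rfl rfl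
    exact hgp v w
  have hd : ∀ {A B : ∀ x : M, TangentSpace 𝓘(ℝ, E) x} {v v' : E}, v = v' →
      derivInner g A B p v = derivInner g A B p v' := by
    rintro A B v _ rfl
    rfl
  have pX : (X p : E) = coordField X p z₀ := (coordField_self X p).symm
  have pY : (Y p : E) = coordField Y p z₀ := (coordField_self Y p).symm
  have pZ : (Z p : E) = coordField Z p z₀ := (coordField_self Z p).symm
  have e0 := hW (coordField Z p z₀)
  have e1 : derivInner g Y Z p (X p) = _ := (hd pX).trans (derivInner_eq hg hY hZ' _)
  have e2 : derivInner g X Z p (Y p) = _ := (hd pY).trans (derivInner_eq hg hX hZ' _)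
  have e3 : derivInner g X Y p (Z p) = _ := (hd pZ).trans (derivInner_eq hg hX hY _)
  have b1 := hgv (mlieBracket_eq_coordField X Y p) pZ
  have b2 := hgv (mlieBracket_eq_coordField X Z p) pY
  have b3 := hgv (mlieBracket_eq_coordField Y Z p) pX
  have w0 : g p W (Z p) = coordForm g p z₀ W (coordField Z p z₀) := hgv rfl pZ
  rw [map_sub, sub_apply] at b1 b2 b3
  -- Symmetry of the form matches the remaining terms: the derivatives of `Z`, and those of `X` and
  -- `Y` along `Z`, cancel between the inner products and the brackets.
  have s1 := hsym (coordField Y p z₀) (fderiv ℝ (coordField Z p) z₀ (coordField X p z₀))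
  have s2 := hsym (coordField X p z₀) (fderiv ℝ (coordField Z p) z₀ (coordField Y p z₀))
  have s3 := hsym (coordField X p z₀) (fderiv ℝ (coordField Y p) z₀ (coordField Z p z₀))
  rw [koszulForm] at e0
  refine (congrArg (fun t ↦ 2 * t) w0).trans ?_
  refine Eq.trans ?_ (congrArg₂ (· - ·) (congrArg₂ (· - ·) (congrArg₂ (· + ·)
    (congrArg₂ (· - ·) (congrArg₂ (· + ·) e1 e2) e3) b1) b2) b3).symm
  linarith

/-- A vector field tangent to the image of `f` is tangent to it in charts. -/
lemma eventually_tangent_coordField {f : N → M} (hf : ContMDiff 𝓘(ℝ, F) 𝓘(ℝ, E) ∞ f) (n : N)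
    {Y : ∀ x : M, TangentSpace 𝓘(ℝ, E) x} (hY : ∀ n : N, ∃ u, modelDeriv F E f n u = Y (f n)) :
    ∀ᶠ u in 𝓝 (extChartAt 𝓘(ℝ, F) n n), ∃ η,
      fderiv ℝ (localRep F E f n (f n)) u η = coordField Y (f n) (localRep F E f n (f n) u) := by
  have hmem : extChartAt 𝓘(ℝ, F) n n ∈ (extChartAt 𝓘(ℝ, F) n).target ∩
      (extChartAt 𝓘(ℝ, F) n).symm ⁻¹' (f ⁻¹' (extChartAt 𝓘(ℝ, E) (f n)).source) := by
    refine ⟨mem_extChartAt_target n, ?_⟩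
    rw [Set.mem_preimage, extChartAt_to_inv (I := 𝓘(ℝ, F)) n]
    exact mem_extChartAt_source (f n)
  filter_upwards [(isOpen_localRep_domain hf.continuous n (f n)).mem_nhds hmem] with u hu
  obtain ⟨v, hv⟩ := hY ((extChartAt 𝓘(ℝ, F) n).symm u)
  obtain ⟨η, rfl⟩ := (chartDerivEquiv n hu.1).surjective v
  have h1 := modelDeriv_chartDeriv (E := F) (F := E) (y₀ := f n) hu.1
    ((hf _).mdifferentiableAt (by simp)) hu.2 η
  have hz : localRep F E f n (f n) u ∈ (extChartAt 𝓘(ℝ, E) (f n)).target :=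
    (extChartAt 𝓘(ℝ, E) (f n)).map_source hu.2
  have h2 := chartDeriv_coordField Y hz
  have h3 : (extChartAt 𝓘(ℝ, E) (f n)).symm (localRep F E f n (f n) u) =
      f ((extChartAt 𝓘(ℝ, F) n).symm u) := (extChartAt 𝓘(ℝ, E) (f n)).left_inv hu.2
  rw [h3] at h2
  refine ⟨η, (chartDerivEquiv (f n) hz).injective ?_⟩
  exact h1.symm.trans (hv.trans h2.symm)

end VectorFields

/-! ### Pulling back a metric by an immersion. -/

section Pullback

variable {E : Type*} [NormedAddCommGroup E] [NormedSpace ℝ E] [FiniteDimensional ℝ E]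
  {M : Type*} [TopologicalSpace M] [ChartedSpace E M] [IsManifold 𝓘(ℝ, E) ∞ M]
  {F : Type*} [NormedAddCommGroup F] [NormedSpace ℝ F] [FiniteDimensional ℝ F]
  {N : Type*} [TopologicalSpace N] [ChartedSpace F N] [IsManifold 𝓘(ℝ, F) ∞ N]

/-- On the compact unit sphere the form has a positive minimum, so its unit ball is bounded; this is
part of the data of a `ContMDiffRiemannianMetric`. -/
lemma IsScalarProduct.isVonNBounded {g : E →L[ℝ] E →L[ℝ] ℝ} (hg : IsScalarProduct g) :
    Bornology.IsVonNBounded ℝ {v : E | g v v < 1} := by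
  rw [NormedSpace.isVonNBounded_iff]
  rcases subsingleton_or_nontrivial E with hE | hE
  · exact (Set.toFinite _).isBounded
  have hc : Continuous fun v ↦ g v v := g.continuous.clm_apply continuous_id
  obtain ⟨v₀, hv₀, hmin⟩ := (isCompact_sphere (0 : E) 1).exists_isMinOn
    (NormedSpace.sphere_nonempty.2 zero_le_one) hc.continuousOn
  have hpos : 0 < g v₀ v₀ := hg.pos v₀ fun h ↦ by simp [h] at hv₀
  refine (Metric.isBounded_ball (x := (0 : E)) (r := (g v₀ v₀)⁻¹ + 1)).subset fun v hv ↦ ?_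
  rw [mem_ball_zero_iff]
  by_cases hv0 : v = 0
  · rw [hv0, norm_zero]
    positivity
  have hn : 0 < ‖v‖ := norm_pos_iff.2 hv0
  have h1 : g v₀ v₀ ≤ g (‖v‖⁻¹ • v) (‖v‖⁻¹ • v) :=
    hmin (by rw [mem_sphere_zero_iff_norm, norm_smul, norm_inv, norm_norm, inv_mul_cancel₀ hn.ne'])
  rw [map_smul g, smul_apply, map_smul, smul_eq_mul, smul_eq_mul, ← mul_assoc, ← mul_inv,
    ← div_eq_inv_mul, le_div_iff₀ (by positivity)] at h1
  have h2 : g v₀ v₀ * (‖v‖ * ‖v‖) < 1 := h1.trans_lt hv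
  have h3 : ‖v‖ * ‖v‖ < (g v₀ v₀)⁻¹ := by
    rwa [← one_div, lt_div_iff₀ hpos, mul_comm]
  -- With `c` the inverse of the minimum, `2‖v‖ ≤ ‖v‖² + 1 < c + 1`, which avoids a square root in
  -- the radius.
  nlinarith [sq_nonneg (‖v‖ - 1)]

/-- The pullback of a metric by an immersion. -/
lemma exists_pullback_metric {f : N → M} (hf : ContMDiff 𝓘(ℝ, F) 𝓘(ℝ, E) ∞ f)
    (hinj : ∀ n, Function.Injective (modelDeriv F E f n)) {g : M → E →L[ℝ] E →L[ℝ] ℝ}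
    (hg : ∀ x, IsScalarProduct (g x))
    (hgs : ∀ n, ContDiffAt ℝ ∞ (coordForm g (f n)) (extChartAt 𝓘(ℝ, E) (f n) (f n))) :
    ∃ h : ContMDiffRiemannianMetric 𝓘(ℝ, F) ∞ F (fun n : N ↦ TangentSpace 𝓘(ℝ, F) n),
      ∀ (n : N) (v w : F), h.inner n v w = g (f n) (modelDeriv F E f n v) (modelDeriv F E f n w) := by
  let h : N → F →L[ℝ] F →L[ℝ] ℝ := fun n ↦
    (g (f n)).bilinearComp (modelDeriv F E f n) (modelDeriv F E f n)
  have hsp : ∀ n, IsScalarProduct (h n) := fun n ↦ (hg _).bilinearComp (hinj n)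
  refine ⟨⟨h, fun n ↦ (hsp n).symm, fun n ↦ (hsp n).pos, fun n ↦ (hsp n).isVonNBounded,
    fun n ↦ ?_⟩, fun n v w ↦ rfl⟩
  refine (contMDiffAt_form_iff (g := h) (mem_extChartAt_source n)).2 ?_
  have hl : (extChartAt 𝓘(ℝ, F) n).symm (extChartAt 𝓘(ℝ, F) n n) = n :=
    extChartAt_to_inv (I := 𝓘(ℝ, F)) n
  have hmem : extChartAt 𝓘(ℝ, F) n n ∈ (extChartAt 𝓘(ℝ, F) n).target ∩
      (extChartAt 𝓘(ℝ, F) n).symm ⁻¹' (f ⁻¹' (extChartAt 𝓘(ℝ, E) (f n)).source) := by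
    refine ⟨mem_extChartAt_target n, ?_⟩
    rw [Set.mem_preimage, hl]
    exact mem_extChartAt_source (f n)
  have hopen := (isOpen_localRep_domain (E := F) (F := E) hf.continuous n (f n)).mem_nhds hmem
  have hrep : ContDiffAt ℝ ∞ (localRep F E f n (f n)) (extChartAt 𝓘(ℝ, F) n n) :=
    (contDiffOn_localRep hf n (f n)).contDiffAt hopen
  have hval : localRep F E f n (f n) (extChartAt 𝓘(ℝ, F) n n) = extChartAt 𝓘(ℝ, E) (f n) (f n) := by
    rw [localRep, hl]
  have hg' : ContDiffAt ℝ ∞ (fun u ↦ coordForm g (f n) (localRep F E f n (f n) u))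
      (extChartAt 𝓘(ℝ, F) n n) :=
    ContDiffAt.comp (g := coordForm g (f n)) _ (by rw [hval]; exact hgs n) hrep
  have hall := contDiffAt_bilinearComp hg' (hrep.fderiv_right (m := ∞) (by simp))
  refine hall.congr_of_eventuallyEq ?_
  filter_upwards [hopen] with u hu
  ext v w
  have hmd : MDifferentiableAt 𝓘(ℝ, F) 𝓘(ℝ, E) f ((extChartAt 𝓘(ℝ, F) n).symm u) :=
    (hf _).mdifferentiableAt (by simp)
  have h3 : (extChartAt 𝓘(ℝ, E) (f n)).symm (localRep F E f n (f n) u) =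
      f ((extChartAt 𝓘(ℝ, F) n).symm u) := (extChartAt 𝓘(ℝ, E) (f n)).left_inv hu.2
  have hl : coordForm h n u v w = g (f ((extChartAt 𝓘(ℝ, F) n).symm u))
      (modelDeriv F E f ((extChartAt 𝓘(ℝ, F) n).symm u) (chartDeriv n u v))
      (modelDeriv F E f ((extChartAt 𝓘(ℝ, F) n).symm u) (chartDeriv n u w)) := rfl
  refine hl.trans ?_
  rw [modelDeriv_chartDeriv hu.1 hmd hu.2, modelDeriv_chartDeriv hu.1 hmd hu.2, ← h3]
  rfl

end Pullback

/-! ### Action fields are Killing fields, and orbits are totally geodesic. -/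

section Orbits

variable {EG : Type*} [NormedAddCommGroup EG] [NormedSpace ℝ EG] [FiniteDimensional ℝ EG]
  {E : Type*} [NormedAddCommGroup E] [NormedSpace ℝ E] [FiniteDimensional ℝ E]
  {G : Type*} [TopologicalSpace G] [ChartedSpace EG G] [Group G] [LieGroup 𝓘(ℝ, EG) ∞ G]
  {M : Type*} [TopologicalSpace M] [ChartedSpace E M] [IsManifold 𝓘(ℝ, E) ∞ M]
  [MulAction G M] [ContMDiffSMul 𝓘(ℝ, EG) 𝓘(ℝ, E) ∞ G M]

lemma fderiv_actionRep_apply {p : M} {z : E} {s : EG}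
    (h : DifferentiableAt ℝ (fun y : E × EG ↦ actionRep G p y.1 y.2) (z, s)) (v : E) (X : EG) :
    fderiv ℝ (fun y : E × EG ↦ actionRep G p y.1 y.2) (z, s) (v, 0) =
      fderiv ℝ (fun y ↦ actionRep G p y s) z v ∧
    fderiv ℝ (fun y : E × EG ↦ actionRep G p y.1 y.2) (z, s) (0, X) =
      fderiv ℝ (actionRep G p z) s X := by
  have h1 := HasFDerivAt.comp (f := fun y : E ↦ (y, s)) z h.hasFDerivAt (hasFDerivAt_prodMk_left z s)
  have h2 := HasFDerivAt.comp (f := fun t : EG ↦ (z, t)) s h.hasFDerivAt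
    (hasFDerivAt_prodMk_right z s)
  constructor
  · exact (congrArg (fun L ↦ L v) h1.fderiv).symm
  · exact (congrArg (fun L ↦ L X) h2.fderiv).symm

/-- The fundamental vector fields of an isometric action satisfy the Killing equation. -/
lemma killing_equation_coordOrbitDeriv {g : M → E →L[ℝ] E →L[ℝ] ℝ} {p : M}
    (hg : DifferentiableAt ℝ (coordForm g p) (extChartAt 𝓘(ℝ, E) p p))
    (hinv : ∀ (a : G) (v w : E), g (a • p) (modelDeriv E E (fun y : M ↦ a • y) p v)
      (modelDeriv E E (fun y : M ↦ a • y) p w) = g p v w) (X : EG) (v w : E) :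
    DifferentiableAt ℝ (fun z ↦ coordOrbitDeriv EG E G p z X) (extChartAt 𝓘(ℝ, E) p p) ∧
    fderiv ℝ (coordForm g p) (extChartAt 𝓘(ℝ, E) p p)
        (coordOrbitDeriv EG E G p (extChartAt 𝓘(ℝ, E) p p) X) v w +
      coordForm g p (extChartAt 𝓘(ℝ, E) p p)
        (fderiv ℝ (fun z ↦ coordOrbitDeriv EG E G p z X) (extChartAt 𝓘(ℝ, E) p p) v) w +
      coordForm g p (extChartAt 𝓘(ℝ, E) p p) v
        (fderiv ℝ (fun z ↦ coordOrbitDeriv EG E G p z X) (extChartAt 𝓘(ℝ, E) p p) w) = 0 := by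
  have : IsManifold 𝓘(ℝ, EG) ∞ G := inferInstance
  set φ := extChartAt 𝓘(ℝ, E) p
  set ψ := extChartAt 𝓘(ℝ, EG) (1 : G)
  have hp : φ.symm (φ p) = p := extChartAt_to_inv (I := 𝓘(ℝ, E)) p
  have h1 : ψ.symm (ψ 1) = 1 := extChartAt_to_inv (I := 𝓘(ℝ, EG)) (1 : G)
  have hpt : φ p ∈ φ.target := mem_extChartAt_target p
  have hT : ContDiffAt ℝ 2 (fun y : E × EG ↦ actionRep G p y.1 y.2) (φ p, ψ 1) :=
    (contDiffAt_actionRep hpt).of_le (ENat.LEInfty.out)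
  have hdiff : ∀ᶠ y in 𝓝 (φ p, ψ 1),
      DifferentiableAt ℝ (fun y : E × EG ↦ actionRep G p y.1 y.2) y :=
    (hT.eventually (by simp)).mono fun y hy ↦ hy.differentiableAt (by simp)
  have hcz : ContinuousAt (fun z : E ↦ (z, ψ 1)) (φ p) := by fun_prop
  have hcs : ContinuousAt (fun s : EG ↦ (φ p, s)) (ψ 1) := by fun_prop
  -- The isometries are the group elements with coordinate `s`, the identity at `s = ψ 1`; their
  -- derivative there in direction `X` is the action field.
  refine killing_equation (T := fun y : E × EG ↦ actionRep G p y.1 y.2) (s₀ := ψ 1) hT ?_ hg ?_ X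
    ?_ v w
  · filter_upwards [target_mem_nhds hpt] with z hz
    simp only [actionRep]
    rw [h1, one_smul]
    exact φ.right_inv hz
  · have hs1 : ContinuousAt (fun s ↦ ψ.symm s • p) (ψ 1) :=
      (contMDiff_orbitMap EG E p).continuous.continuousAt.comp
        (contMDiffAt_chart_symm (mem_extChartAt_target (1 : G))).continuousAt
    have hs2 : ∀ᶠ s in 𝓝 (ψ 1), ψ.symm s • p ∈ φ.source := by
      refine hs1.eventually ((isOpen_extChartAt_source p).mem_nhds ?_)
      simp only [h1, one_smul]
      exact mem_extChartAt_source p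
    filter_upwards [hcs.eventually hdiff, hs2] with s hs hsp v w
    rw [(fderiv_actionRep_apply hs v 0).1, (fderiv_actionRep_apply hs w 0).1]
    have hmd : MDifferentiableAt 𝓘(ℝ, E) 𝓘(ℝ, E) (fun y : M ↦ ψ.symm s • y) (φ.symm (φ p)) :=
      (contMDiff_smul_left EG E M (ψ.symm s) _).mdifferentiableAt (by simp)
    have hd := modelDeriv_chartDeriv (E := E) (F := E) (y₀ := p) hpt hmd (by rwa [hp])
    rw [hp, chartDeriv_self] at hd
    have hL : localRep E E (fun y : M ↦ ψ.symm s • y) p p = fun y ↦ actionRep G p y s := rfl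
    have hval : actionRep G p (φ p) s = φ (ψ.symm s • p) := by
      simp only [actionRep]
      rw [hp]
    rw [hL] at hd
    simp only [ContinuousLinearMap.id_apply] at hd
    rw [hval] at hd ⊢
    rw [coordForm_chart g hsp, coordForm_chart g (mem_extChartAt_source p), chartDeriv_self]
    change g _ _ _ = _
    rw [← hd v, ← hd w]
    exact hinv _ v w
  · filter_upwards [target_mem_nhds hpt, hcz.eventually hdiff] with z hz hzd
    rw [(fderiv_actionRep_apply hzd 0 X).2, coordOrbitDeriv_eq hz]

variable {x : M} {k : ℕ} [ChartedSpace (EuclideanSpace ℝ (Fin k)) (G ⧸ stabilizer G x)]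
  [IsManifold (𝓡 k) ∞ (G ⧸ stabilizer G x)]
  {b : EG →L[ℝ] EG →L[ℝ] ℝ} {g : M → E →L[ℝ] E →L[ℝ] ℝ}

/-- The fundamental vector fields are tangent to the orbits. -/
lemma exists_modelDeriv_ofQuotientStabilizer_eq
    (hπ : IsSubmersion 𝓘(ℝ, EG) (𝓡 k) ∞ (QuotientGroup.mk : G → G ⧸ stabilizer G x))
    (X : EG) (q : G ⧸ stabilizer G x) :
    ∃ u, modelDeriv (EuclideanSpace ℝ (Fin k)) E (ofQuotientStabilizer G x) q u =
      orbitDeriv EG E G (ofQuotientStabilizer G x q) X := by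
  obtain ⟨a, rfl⟩ := QuotientGroup.mk_surjective q
  refine ⟨_, (modelDeriv_ofQuotientStabilizer_mk hπ a
    (modelDeriv EG EG (fun c : G ↦ c * a) 1 X)).trans ?_⟩
  exact modelDeriv_orbitMap_mulRight a x X

/-- Tangent vectors of orbits are values of fundamental vector fields. -/
lemma exists_orbitDeriv_eq
    (hπ : IsSubmersion 𝓘(ℝ, EG) (𝓡 k) ∞ (QuotientGroup.mk : G → G ⧸ stabilizer G x))
    (q : G ⧸ stabilizer G x) (u : EuclideanSpace ℝ (Fin k)) :
    ∃ X, orbitDeriv EG E G (ofQuotientStabilizer G x q) X =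
      modelDeriv (EuclideanSpace ℝ (Fin k)) E (ofQuotientStabilizer G x) q u := by
  have : IsManifold 𝓘(ℝ, EG) ∞ G := inferInstance
  obtain ⟨a, rfl⟩ := QuotientGroup.mk_surjective q
  obtain ⟨v, rfl⟩ := surjective_of_isSubmersion hπ a u
  obtain ⟨X, rfl⟩ := (bijective_modelDeriv_mulRight EG a 1).2 v
  exact ⟨X, (modelDeriv_orbitMap_mulRight a x X).symm.trans
    (modelDeriv_ofQuotientStabilizer_mk hπ a (modelDeriv EG EG (fun c : G ↦ c * a) 1 X)).symm⟩

/-- The orbits are totally geodesic for the limit metric. -/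
lemma hasTotallyGeodesicImage_ofQuotientStabilizer
    (hπ : IsSubmersion 𝓘(ℝ, EG) (𝓡 k) ∞ (QuotientGroup.mk : G → G ⧸ stabilizer G x))
    (hb : IsScalarProduct b) (hg : ∀ x, IsScalarProduct (g x)) {U : Set M} (hU : IsOpen U)
    (hxU : ∀ q : G ⧸ stabilizer G x, ofQuotientStabilizer G x q ∈ U)
    (hgs : ∀ p ∈ U, ContDiffAt ℝ ∞ (coordForm (deformedField G b g 0) p) (extChartAt 𝓘(ℝ, E) p p))
    (hinv : ∀ (a : G), ∀ p ∈ U, ∀ v w : E,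
      deformedField G b g 0 (a • p) (modelDeriv E E (fun y : M ↦ a • y) p v)
        (modelDeriv E E (fun y : M ↦ a • y) p w) = deformedField G b g 0 p v w) :
    HasTotallyGeodesicImage (𝓡 k) U (deformedField G b g 0) (ofQuotientStabilizer G x) := by
  intro X Y hX hY hXt hYt n
  set f := ofQuotientStabilizer G x with hfdef
  set p := f n
  set h := deformedField G b g 0
  have hh : ∀ x, IsScalarProduct (h x) := fun x ↦ isScalarProduct_deformedField hb (hg x)
  have hf : ContMDiff (𝓡 k) 𝓘(ℝ, E) ∞ f := contMDiff_ofQuotientStabilizer hπ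
  have hl : (extChartAt (𝓡 k) n).symm (extChartAt (𝓡 k) n n) = n :=
    extChartAt_to_inv (I := 𝓡 k) n
  set u₀ := extChartAt (𝓡 k) n n
  set z₀ := extChartAt 𝓘(ℝ, E) p p
  set fc := localRep (EuclideanSpace ℝ (Fin k)) E f n p
  have hz₀ : fc u₀ = z₀ := by
    simp only [fc, localRep]
    rw [hl]
  have hfd : fderiv ℝ fc u₀ = modelDeriv (EuclideanSpace ℝ (Fin k)) E f n :=
    fderiv_localRep_self ((hf n).mdifferentiableAt (by simp))
  have hfc : ContDiffAt ℝ 2 fc u₀ := by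
    refine contDiffAt_localRep (ENat.LEInfty.out) (mem_extChartAt_target n)
      ((hf _).of_le (ENat.LEInfty.out)) ?_
    rw [hl]
    exact mem_extChartAt_source (f n)
  have hpU : p ∈ U := hxU n
  have hgd : DifferentiableAt ℝ (coordForm h p) z₀ := (hgs p hpU).differentiableAt (by simp)
  have hXd : DifferentiableAt ℝ (coordField X p) z₀ := differentiableAt_coordField
    ((hX.contMDiffAt (hU.mem_nhds hpU)).mdifferentiableAt (by simp))
  have hYd : DifferentiableAt ℝ (coordField Y p) z₀ := differentiableAt_coordField
    ((hY.contMDiffAt (hU.mem_nhds hpU)).mdifferentiableAt (by simp))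
  have hzt : z₀ ∈ (extChartAt 𝓘(ℝ, E) p).target := mem_extChartAt_target p
  have hsp : IsScalarProduct (coordForm h p z₀) := isScalarProduct_coordForm hh hzt
  have hinj : Function.Injective (fderiv ℝ fc u₀) := by
    rw [hfd]
    exact injective_modelDeriv_ofQuotientStabilizer hπ n
  have hcp : coordOrbitDeriv EG E G p z₀ = orbitDeriv EG E G p := by
    rw [coordOrbitDeriv, extChartAt_to_inv (I := 𝓘(ℝ, E)) p, chartDerivInv_self]
    rfl
  have hkill : ∀ ξ, ∃ K : E → E, DifferentiableAt ℝ K (fc u₀) ∧ K (fc u₀) = fderiv ℝ fc u₀ ξ ∧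
      (∀ᶠ u in 𝓝 u₀, ∃ η, fderiv ℝ fc u η = K (fc u)) ∧
      (∀ v w, fderiv ℝ (coordForm h p) (fc u₀) (K (fc u₀)) v w +
        coordForm h p (fc u₀) (fderiv ℝ K (fc u₀) v) w +
        coordForm h p (fc u₀) v (fderiv ℝ K (fc u₀) w) = 0) ∧
      fderiv ℝ (fun z ↦ coordForm h p z (K z) (K z)) (fc u₀) = 0 := by
    intro ξ
    rw [hz₀]
    obtain ⟨X₀, hX₀⟩ := exists_orbitDeriv_eq (E := E) hπ n ξ
    -- The generator is changed to the one horizontal at `p`, which has the same value at `p` but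
    -- the largest possible length there.
    obtain ⟨X₁, hX₁, hhor⟩ := exists_horizontal hb (hg p) (orbitDeriv EG E G p) X₀
    have hK := killing_equation_coordOrbitDeriv (EG := EG) (G := G) hgd
      (fun a v w ↦ hinv a p hpU v w) X₁
    refine ⟨fun z ↦ coordOrbitDeriv EG E G p z X₁, (hK 0 0).1, ?_, ?_, fun v w ↦ (hK v w).2, ?_⟩
    · simp only [hfd, hcp, hX₁]
      exact hX₀
    · exact eventually_tangent_coordField hf n (Y := fun y : M ↦ orbitDeriv EG E G y X₁)
        (exists_modelDeriv_ofQuotientStabilizer_eq hπ X₁)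
    · have hval : ∀ z ∈ (extChartAt 𝓘(ℝ, E) p).target,
          coordForm h p z (coordOrbitDeriv EG E G p z X₁) (coordOrbitDeriv EG E G p z X₁) =
          h ((extChartAt 𝓘(ℝ, E) p).symm z)
            (orbitDeriv EG E G ((extChartAt 𝓘(ℝ, E) p).symm z) X₁)
            (orbitDeriv EG E G ((extChartAt 𝓘(ℝ, E) p).symm z) X₁) := by
        intro z hz
        have h1 := chartDeriv_coordField (fun y : M ↦ orbitDeriv EG E G y X₁) hz
        exact congrArg₂ (fun s t : E ↦ h ((extChartAt 𝓘(ℝ, E) p).symm z) s t) h1 h1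
      -- The squared length is bounded by `b X₁ X₁` everywhere, with equality at `p`.
      refine IsLocalMax.fderiv_eq_zero ?_
      filter_upwards [target_mem_nhds hzt] with z hz
      rw [hval z hz, hval z₀ hzt, extChartAt_to_inv (I := 𝓘(ℝ, E)) p]
      refine (deformedForm_zero_le hb (hg _) (isRangeProjection_orbitProjection (hg _)) X₁).trans
        (le_of_eq ?_)
      exact (deformedForm_zero_apply hb (hg _) (isRangeProjection_orbitProjection (hg _))
        hhor X₁).symm
  have hsymm : ∀ᶠ z in 𝓝 (fc u₀), ∀ v w, coordForm h p z v w = coordForm h p z w v := by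
    rw [hz₀]
    filter_upwards [target_mem_nhds hzt] with z hz
    exact (isScalarProduct_coordForm hh hz).symm
  have hYt' : ∀ᶠ u in 𝓝 u₀, ∃ η, fderiv ℝ fc u η = coordField Y p (fc u) :=
    eventually_tangent_coordField hf n hYt
  obtain ⟨ξ, hξ⟩ := hXt n
  have hξ' : fderiv ℝ fc u₀ ξ = coordField X p z₀ := by
    rw [hfd]
    exact hξ.trans (coordField_self X p).symm
  have hzero : ∀ Z : E, (∀ ζ, coordForm h p z₀ (fderiv ℝ fc u₀ ζ) Z = 0) →
      koszulForm (coordForm h p) z₀ (fderiv ℝ (coordField Y p) z₀ (coordField X p z₀))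
        (coordField X p z₀) (coordField Y p z₀) Z = 0 := by
    intro Z hZ
    have h1 := koszulForm_eq_zero hfc hinj (by rwa [hz₀]) hsymm hkill (by rwa [hz₀]) hYt' ξ
      (Z := Z) (by rwa [hz₀])
    rwa [hz₀, hξ'] at h1
  -- Nondegeneracy represents half the Koszul form by a vector `W`, the covariant derivative of `Y`
  -- along `X`.
  obtain ⟨W, hW⟩ := hsp.exists_eq ((1 / 2 : ℝ) •
    ((2 : ℝ) • coordForm h p z₀ (fderiv ℝ (coordField Y p) z₀ (coordField X p z₀)) +
      fderiv ℝ (coordForm h p) z₀ (coordField X p z₀) (coordField Y p z₀) +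
      fderiv ℝ (coordForm h p) z₀ (coordField Y p z₀) (coordField X p z₀) -
      ((fderiv ℝ (coordForm h p) z₀).flip (coordField X p z₀)).flip (coordField Y p z₀)))
  have hWZ : ∀ Z, 2 * coordForm h p z₀ W Z = koszulForm (coordForm h p) z₀
      (fderiv ℝ (coordField Y p) z₀ (coordField X p z₀))
        (coordField X p z₀) (coordField Y p z₀) Z := by
    intro Z
    rw [hW, koszulForm]
    simp only [smul_apply, add_apply, sub_apply, ContinuousLinearMap.flip_apply, smul_eq_mul]
    ring
  obtain ⟨P, hP⟩ := exists_isRangeProjection hsp (fderiv ℝ fc u₀)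
  -- The normal part of `W` is a normal vector, against which the Koszul form vanishes; it is
  -- therefore orthogonal to itself.
  have hWP : W - P W = 0 := by
    apply hsp.eq_zero
    have h1 := hWZ (W - P W)
    rw [hzero _ fun ζ ↦ by rw [hsp.symm]; exact hP.orthogonal W ζ] at h1
    have h2 := hP.orthogonal' W W
    rw [hsp.symm] at h2
    have h3 : coordForm h p z₀ (W - P W) (W - P W) =
        coordForm h p z₀ W (W - P W) - coordForm h p z₀ (P W) (W - P W) := by
      rw [map_sub (coordForm h p z₀), sub_apply]
    linarith
  obtain ⟨u, hu⟩ := hP.mem_range W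
  refine ⟨u, ?_⟩
  have hWu : W = modelDeriv (EuclideanSpace ℝ (Fin k)) E f n u := by
    rw [← hfd, hu]
    exact sub_eq_zero.1 hWP
  have hfin := isLeviCivitaDerivAt_of_koszulForm (g := h) (p := p) hgd (hh p).symm hXd hYd hWZ
  rw [hWu] at hfin
  exact hfin

end Orbits

/-! ### The metric induced on an orbit is normal homogeneous. -/

section Submersion

variable {EG : Type*} [NormedAddCommGroup EG] [NormedSpace ℝ EG] [FiniteDimensional ℝ EG]
  {E : Type*} [NormedAddCommGroup E] [NormedSpace ℝ E] [FiniteDimensional ℝ E]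
  {G : Type*} [TopologicalSpace G] [ChartedSpace EG G] [Group G] [LieGroup 𝓘(ℝ, EG) ∞ G]
  {M : Type*} [TopologicalSpace M] [ChartedSpace E M] [IsManifold 𝓘(ℝ, E) ∞ M]
  [MulAction G M] [ContMDiffSMul 𝓘(ℝ, EG) 𝓘(ℝ, E) ∞ G M]
  {x : M} {k : ℕ} [ChartedSpace (EuclideanSpace ℝ (Fin k)) (G ⧸ stabilizer G x)]
  [IsManifold (𝓡 k) ∞ (G ⧸ stabilizer G x)]
  {gbi : ContMDiffRiemannianMetric 𝓘(ℝ, EG) ∞ EG (fun p : G ↦ TangentSpace 𝓘(ℝ, EG) p)}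
  {g : M → E →L[ℝ] E →L[ℝ] ℝ}

/-- The limit metric induces the normal homogeneous metric on the orbits. -/
lemma isRiemannianSubmersion_mk (hgbi : IsBiinvariant gbi) (hg : ∀ x, IsScalarProduct (g x))
    (hπ : IsSubmersion 𝓘(ℝ, EG) (𝓡 k) ∞ (QuotientGroup.mk : G → G ⧸ stabilizer G x))
    {h : ∀ q : G ⧸ stabilizer G x, TangentSpace (𝓡 k) q → TangentSpace (𝓡 k) q → ℝ}
    (hh : ∀ (q : G ⧸ stabilizer G x) (v w : EuclideanSpace ℝ (Fin k)), h q v w =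
      deformedField G (groupForm gbi 1) g 0 (ofQuotientStabilizer G x q)
        (modelDeriv (EuclideanSpace ℝ (Fin k)) E (ofQuotientStabilizer G x) q v)
        (modelDeriv (EuclideanSpace ℝ (Fin k)) E (ofQuotientStabilizer G x) q w)) :
    IsRiemannianSubmersion 𝓘(ℝ, EG) (𝓡 k) (fun p v w ↦ gbi.inner p v w) h
      (QuotientGroup.mk : G → G ⧸ stabilizer G x) := by
  refine ⟨hπ, fun a v w hv _ ↦ ?_⟩
  obtain ⟨X, rfl⟩ := (bijective_modelDeriv_mulRight EG a 1).2 v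
  obtain ⟨Y, rfl⟩ := (bijective_modelDeriv_mulRight EG a 1).2 w
  have hd : ∀ Z : EG, modelDeriv (EuclideanSpace ℝ (Fin k)) E (ofQuotientStabilizer G x)
      (a : G ⧸ stabilizer G x) (modelDeriv EG (EuclideanSpace ℝ (Fin k))
        (QuotientGroup.mk : G → G ⧸ stabilizer G x) a (modelDeriv EG EG (fun c : G ↦ c * a) 1 Z)) =
      orbitDeriv EG E G (a • x) Z := fun Z ↦
    (modelDeriv_ofQuotientStabilizer_mk hπ a _).trans (modelDeriv_orbitMap_mulRight a x Z)
  -- Right translation carries vectors horizontal for the projection at `a` to vectors of the Lie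
  -- algebra horizontal for the orbit derivative at `a • x`.
  have hX : ∀ Z, orbitDeriv EG E G (a • x) Z = 0 → groupForm gbi 1 X Z = 0 := by
    intro Z hZ
    rw [← hgbi.mulRight a]
    refine hv (modelDeriv EG EG (fun c : G ↦ c * a) 1 Z) ?_
    exact modelDeriv_mk_eq_zero hπ ((modelDeriv_orbitMap_mulRight a x Z).trans hZ)
  refine (hh _ _ _).trans ?_
  refine (congrArg₂ (fun s t : E ↦ deformedField G (groupForm gbi 1) g 0 (a • x) s t)
    (hd X) (hd Y)).trans ?_
  refine Eq.trans ?_ (hgbi.mulRight a X Y).symm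
  exact deformedForm_zero_apply (isScalarProduct_groupForm gbi 1) (hg _)
    (isRangeProjection_orbitProjection (hg _)) hX Y

end Submersion

end Cheeger

end

theorem theoremB
    -- the compact Lie group `G` with a bi-invariant metric
    {EG : Type*} [NormedAddCommGroup EG] [NormedSpace ℝ EG] [FiniteDimensional ℝ EG]
    {G : Type*} [TopologicalSpace G] [T2Space G] [CompactSpace G] [ChartedSpace EG G] [Group G]
    [LieGroup 𝓘(ℝ, EG) ∞ G]
    (gbi : ContMDiffRiemannianMetric 𝓘(ℝ, EG) ∞ EG (fun p : G ↦ TangentSpace 𝓘(ℝ, EG) p))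
    (hgbi : Cheeger.IsBiinvariant gbi)
    -- the complete Riemannian manifold `M`
    {E : Type*} [NormedAddCommGroup E] [NormedSpace ℝ E] [FiniteDimensional ℝ E]
    {M : Type*} [EMetricSpace M] [ChartedSpace E M] [IsManifold 𝓘(ℝ, E) ∞ M]
    [RiemannianBundle (fun x : M ↦ TangentSpace 𝓘(ℝ, E) x)]
    [IsContMDiffRiemannianBundle 𝓘(ℝ, E) ∞ E (fun x : M ↦ TangentSpace 𝓘(ℝ, E) x)]
    [IsRiemannianManifold 𝓘(ℝ, E) M] [CompleteSpace M]
    -- the smooth isometric action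
    [MulAction G M] [ContMDiffSMul 𝓘(ℝ, EG) 𝓘(ℝ, E) ∞ G M]
    (hiso : Cheeger.IsInvariantOn G Set.univ (Cheeger.ambientMetric E M))
    -- the invariant open set `U`, relatively compact in the regular part
    (U : Set M) (hUo : IsOpen U) (hUinv : ∀ a : G, ∀ x ∈ U, a • x ∈ U)
    (hUc : IsCompact (closure U)) (hUreg : closure U ⊆ Cheeger.regularPart G M) :
    ∃ gt : Cheeger.RiemannianMetricOn (E := E) U,
      (∀ p : ℕ, Cheeger.TendstoInCp p U (fun l ↦ Cheeger.rescaledMetric gbi l)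
        (fun x v w ↦ gt.inner x v w)) ∧
      Cheeger.IsInvariantOn G U (fun x v w ↦ gt.inner x v w) ∧
      ∀ x ∈ U,
        Set.range (ofQuotientStabilizer G x) = orbit G x ∧ orbit G x ⊆ U ∧
        -- the smooth structure on `G / G_x` for which `G → G / G_x` is a submersion exists
        (∃ (k : ℕ) (_ : ChartedSpace (EuclideanSpace ℝ (Fin k)) (G ⧸ stabilizer G x)),
          IsManifold (𝓡 k) ∞ (G ⧸ stabilizer G x) ∧
          IsSubmersion 𝓘(ℝ, EG) (𝓡 k) ∞ (QuotientGroup.mk : G → G ⧸ stabilizer G x)) ∧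
        -- and for it the normal homogeneous metric exists and `Φ_x` is a Riemannian embedding
        -- with totally geodesic image
        ∀ (k : ℕ) [ChartedSpace (EuclideanSpace ℝ (Fin k)) (G ⧸ stabilizer G x)]
          [IsManifold (𝓡 k) ∞ (G ⧸ stabilizer G x)],
          IsSubmersion 𝓘(ℝ, EG) (𝓡 k) ∞ (QuotientGroup.mk : G → G ⧸ stabilizer G x) →
          ∃ gnh : ContMDiffRiemannianMetric (𝓡 k) ∞ (EuclideanSpace ℝ (Fin k))
              (fun q : G ⧸ stabilizer G x ↦ TangentSpace (𝓡 k) q),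
            Cheeger.IsRiemannianSubmersion 𝓘(ℝ, EG) (𝓡 k) (fun p v w ↦ gbi.inner p v w)
              (fun q v w ↦ gnh.inner q v w) (QuotientGroup.mk : G → G ⧸ stabilizer G x) ∧
            IsSmoothEmbedding (𝓡 k) 𝓘(ℝ, E) ∞ (ofQuotientStabilizer G x) ∧
            (∀ (q : G ⧸ stabilizer G x) (v w : TangentSpace (𝓡 k) q),
              gt.inner (ofQuotientStabilizer G x q)
                (mfderiv (𝓡 k) 𝓘(ℝ, E) (ofQuotientStabilizer G x) q v)
                (mfderiv (𝓡 k) 𝓘(ℝ, E) (ofQuotientStabilizer G x) q w) = gnh.inner q v w) ∧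
            Cheeger.HasTotallyGeodesicImage (𝓡 k) U gt.inner (ofQuotientStabilizer G x) := by
  obtain ⟨g, hg, hgi, hgs⟩ := Cheeger.exists_ambientForm E M
  have hb := Cheeger.isScalarProduct_groupForm gbi 1
  -- The regularity hypothesis is needed only through the local constancy of the rank, and up to the
  -- closure of `U`.
  have hUr : closure U ⊆ Cheeger.constantRankSet EG E G M := fun x hx ↦
    Cheeger.eventually_finrank_eq_of_mem_regularPart (hUreg hx)
  have hsp : ∀ x, Cheeger.IsScalarProduct (Cheeger.deformedField G (Cheeger.groupForm gbi 1) g 0 x) :=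
    fun x ↦ Cheeger.isScalarProduct_deformedField hb (hg x)
  have hsm : ∀ x ∈ U, ContDiffAt ℝ ∞
      (Cheeger.coordForm (Cheeger.deformedField G (Cheeger.groupForm gbi 1) g 0) x)
      (extChartAt 𝓘(ℝ, E) x x) := fun x hx ↦
    Cheeger.contDiffAt_coordForm_deformedField_const hb hg hgs (mem_extChartAt_source x)
      (hUr (subset_closure hx)) 0
  have hinv : ∀ (a : G) (x : M) (v w : E),
      Cheeger.deformedField G (Cheeger.groupForm gbi 1) g 0 (a • x)
        (Cheeger.modelDeriv E E (fun y : M ↦ a • y) x v)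
        (Cheeger.modelDeriv E E (fun y : M ↦ a • y) x w) =
      Cheeger.deformedField G (Cheeger.groupForm gbi 1) g 0 x v w := by
    intro a x v w
    refine Cheeger.deformedField_zero_smul hb hg a (fun S hS ↦ hgbi.conj a S hS) x
      (fun v w ↦ ?_) v w
    exact ((hgi _ _ _).symm.trans (hiso a x (Set.mem_univ x) v w)).trans (hgi _ _ _)
  refine ⟨⟨Cheeger.deformedField G (Cheeger.groupForm gbi 1) g 0, fun x _ ↦ (hsp x).symm,
    fun x _ ↦ (hsp x).pos, fun x hx ↦ ?_⟩, fun p ↦ ?_, fun a x _ v w ↦ hinv a x v w,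
    fun x hx ↦ ?_⟩
  · exact ((Cheeger.contMDiffAt_form_iff (mem_extChartAt_source x)).2
      (hsm x hx)).contMDiffWithinAt
  · exact Cheeger.tendstoInCp_deformedField hb hg hgs hUr
      (fun l hl x v w ↦ Cheeger.rescaledMetric_eq hg hgi hl x v w) p
  have hxU : ∀ q : G ⧸ stabilizer G x, ofQuotientStabilizer G x q ∈ U := by
    intro q
    obtain ⟨a, rfl⟩ := QuotientGroup.mk_surjective q
    exact hUinv a x hx
  refine ⟨?_, ?_, Cheeger.exists_quotient_structure EG E x, fun k _ _ hπ ↦ ?_⟩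
  · ext y
    constructor
    · rintro ⟨q, rfl⟩
      exact ofQuotientStabilizer_mem_orbit G x q
    · rintro ⟨a, rfl⟩
      exact ⟨(a : G ⧸ stabilizer G x), rfl⟩
  · rintro _ ⟨a, rfl⟩
    exact hUinv a x hx
  -- The normal homogeneous metric is constructed as the pullback of the limit metric; that the
  -- projection is a Riemannian submersion onto it is then the value of the limit metric on
  -- horizontal vectors.
  obtain ⟨gnh, hgnh⟩ := Cheeger.exists_pullback_metric
    (Cheeger.contMDiff_ofQuotientStabilizer (E := E) hπ)
    (Cheeger.injective_modelDeriv_ofQuotientStabilizer hπ) hsp (fun q ↦ hsm _ (hxU q))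
  exact ⟨gnh, Cheeger.isRiemannianSubmersion_mk hgbi hg hπ hgnh,
    Cheeger.isSmoothEmbedding_ofQuotientStabilizer hπ, fun q v w ↦ (hgnh q v w).symm,
    Cheeger.hasTotallyGeodesicImage_ofQuotientStabilizer hπ hb hg hUo hxU hsm
      (fun a p _ v w ↦ hinv a p v w)⟩
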